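/- Let $0<\alpha<1$ and $0\le\gamma<\alpha$. Let $\mathcal S^\downarrow=\{s=(s_i)_{i\ge1}: s_1\ge s_2\ge\dots\ge0,\ \sum_i s_i\le1\}$. Let $\sigma$ be an $\alpha$-stable subordinator with $\mathbb E(e^{-\lambda\sigma_1})=e^{-\lambda^\alpha}$, let $\Delta\sigma_{[0,1]}$ be the ranked sequence of its jumps on $[0,1]$, and define measures on $\mathcal S^\downarrow$ by $$\int f\,d\mathrm{PD}^*_{\alpha,\theta}=\mathbb E\big(\sigma_1^{-\theta}f(\Delta\sigma_{[0,1]}/\sigma_1)\big),\qquad \nu_{\alpha,\gamma}(ds)=\Big(\gamma+(1-\alpha-\gamma)\sum_{i\ne j}s_is_j\Big)\mathrm{PD}^*_{\alpha,-\alpha-\gamma}(ds).$$ The size-biased measure associated with a measure $\nu$ on $\mathcal S^\downarrow$ is the measure $\nu^{\rm sb}$ on $[0,1]^{\mathbb N}$ such that, for all $k\ge1$ and all Borel sets $A_1,\dots,A_k\subset[0,1]$, $$\nu^{\rm sb}(A_1\times\dots\times A_k\times[0,1]^{\mathbb N})=\sum_{i_1,\dots,i_k\ge1\text{ distinct}}\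 \int_{\{s\in\mathcal S^\downarrow:\,s_{i_1}\in A_1,\dots,s_{i_k}\in A_k\}}\frac{s_{i_1}\cdots s_{i_k}}{\prod_{j=1}^{k-1}\big(1-\sum_{l=1}^js_{i_l}\big)}\,\nu(ds).$$ Then the size-biased measures $\nu^{\rm sb}_{\alpha,\gamma}$ of $\nu_{\alpha,\gamma}$ and $\mathrm{GEM}^*_{\alpha,-\alpha-\gamma}$ of $\mathrm{PD}^*_{\alpha,-\alpha-\gamma}$ exist and are unique, and for every $k\ge1$ the first $k$ marginals $\nu^{\rm sb}_k$ of $\nu^{\rm sb}_{\alpha,\gamma}$ are given, for $x=(x_1,\dots,x_k)$, by $$\nu_k^{\rm sb}(dx)=\Big(\gamma+(1-\alpha-\gamma)\Big(1-\sum_{i=1}^kx_i^2-\frac{1-\alpha}{1+(k-1)\alpha-\gamma}\Big(1-\sum_{i=1}^kx_i\Big)^2\Big)\Big)\,\mathrm{GEM}^*_{\alpha,-\alpha-\gamma}(dx),$$ where $\mathrm{GEM}^*_{\alpha,-\alpha-\gamma}(dx)$ denotes the first $k$ marginals of $\mathrm{GEM}^*_{\alpha,-\alpha-\gamma}$; with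 $\theta=-\alpha-\gamma$ and $B$ the beta function, these have density $$\frac{\alpha\,\Gamma(2+\theta/\alpha)}{\Gamma(1-\alpha)\Gamma(\theta+\alpha+1)\prod_{j=2}^kB(1-\alpha,\theta+j\alpha)}\cdot\frac{\big(1-\sum_{i=1}^kx_i\big)^{\theta+k\alpha}\prod_{j=1}^kx_j^{-\alpha}}{\prod_{j=1}^k\big(1-\sum_{i=1}^jx_i\big)}$$ with respect to Lebesgue measure on $\{x_1,\dots,x_k>0,\ \sum_{i=1}^k x_i<1\}$, and no mass elsewhere. -/

import Mathlib

open MeasureTheory ProbabilityTheory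
open scoped NNReal ENNReal

/-- The space `𝒮↓` of sequences `s₁ ≥ s₂ ≥ … ≥ 0` with `s₁ + s₂ + … ≤ 1`
(ranks are numbered from `0`, so `s 0` is the largest entry). -/
def RankedMassSeq : Set (ℕ → ℝ) :=
  {s | Antitone s ∧ (∀ i, 0 ≤ s i) ∧ Summable s ∧ ∑' i, s i ≤ 1}

/-- `σ = (σ_t)_{t ≥ 0}` is an `α`-stable subordinator with Laplace exponent `λ ↦ λ ^ α`: it starts
at `0`, has stationary independent increments, has almost surely nondecreasing right-continuous
paths, and `E[exp (-λ σ_1)] = exp (-λ ^ α)`. -/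
structure IsStableSubordinator {Ω : Type*} [MeasurableSpace Ω] (P : Measure Ω)
    (σ : ℝ≥0 → Ω → ℝ) (α : ℝ) : Prop where
  measurable : ∀ t, Measurable (σ t)
  zero : ∀ᵐ ω ∂P, σ 0 ω = 0
  indep : HasIndepIncrements σ P
  stationary : ∀ s t : ℝ≥0, IdentDistrib (fun ω => σ (s + t) ω - σ s ω) (σ t) P P
  mono : ∀ᵐ ω ∂P, Monotone fun t => σ t ω
  rightCont : ∀ᵐ ω ∂P, ∀ t, ContinuousWithinAt (fun u => σ u ω) (Set.Ioi t) t
  laplace : ∀ l : ℝ, 0 < l → ∫ ω, Real.exp (-(l * σ 1 ω)) ∂P = Real.exp (-(l ^ α))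

/-- The jump `Δf_t = f(t) - f(t-)` of a path `f` at time `t` (it is `0` at `t = 0`). -/
noncomputable def jump (f : ℝ≥0 → ℝ) (t : ℝ≥0) : ℝ := f t - Function.leftLim f t

/-- The `n`-th largest (counting from `0`, and with multiplicity) positive jump of the path `f`
on the time interval `[0, 1]`; it is `0` if there are at most `n` positive jumps. -/
noncomputable def rankedJump (f : ℝ≥0 → ℝ) (n : ℕ) : ℝ :=
  sSup {x : ℝ | 0 < x ∧ ((n + 1 : ℕ) : ℕ∞) ≤ Set.encard {t : ℝ≥0 | t ≤ 1 ∧ x ≤ jump f t}}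

/-- The Poisson-Dirichlet type measure `PD*_{α,θ}` on ranked sequences,
`∫ f dPD* = E[σ_1 ^ (-θ) f (Δσ_{[0,1]} / σ_1)]`, built from an `α`-stable subordinator `σ`
(the parameter `α` enters through the law of `σ`). -/
noncomputable def PDStar {Ω : Type*} [MeasurableSpace Ω] (P : Measure Ω)
    (σ : ℝ≥0 → Ω → ℝ) (θ : ℝ) : Measure (ℕ → ℝ) :=
  (P.withDensity fun ω => ENNReal.ofReal (σ 1 ω ^ (-θ))).map
    fun ω n => rankedJump (fun t => σ t ω) n / σ 1 ω

/-- The alpha-gamma dislocation measure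
`ν_{α,γ}(ds) = (γ + (1 - α - γ) ∑_{i ≠ j} s_i s_j) PD*_{α,-α-γ}(ds)`. -/
noncomputable def alphaGammaDislocation {Ω : Type*} [MeasurableSpace Ω] (P : Measure Ω)
    (σ : ℝ≥0 → Ω → ℝ) (α γ : ℝ) : Measure (ℕ → ℝ) :=
  (PDStar P σ (-α - γ)).withDensity fun s => ENNReal.ofReal
    (γ + (1 - α - γ) * ∑' p : ℕ × ℕ, if p.1 ≠ p.2 then s p.1 * s p.2 else 0)

/-- The probability that the first `k` picks of a size-biased reordering of `s` are the entries of
ranks `i 0, …, i (k - 1)`: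
`∏_j s_{i_j} / (1 - s_{i_0} - … - s_{i_{j-1}})`; the factor with `j = 0` is `s_{i_0}`. -/
noncomputable def sizeBiasedWeight {k : ℕ} (i : Fin k ↪ ℕ) (s : ℕ → ℝ) : ℝ :=
  ∏ j : Fin k, s (i j) / (1 - ∑ l ∈ Finset.Iio j, s (i l))

/-- `μ`, a measure on `[0,1]^ℕ`, is the size-biased measure associated with the measure `ν` on
ranked sequences. The sum is over all `k`-tuples of distinct ranks. -/
def IsSizeBiased (ν : Measure (ℕ → ℝ)) (μ : Measure (ℕ → unitInterval)) : Prop :=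
  ∀ k : ℕ, 1 ≤ k → ∀ A : Fin k → Set ℝ, (∀ j, MeasurableSet (A j)) →
    μ {x | ∀ j : Fin k, (x j : ℝ) ∈ A j} =
      ∑' i : Fin k ↪ ℕ, ∫⁻ s in {s | s ∈ RankedMassSeq ∧ ∀ j, s (i j) ∈ A j},
        ENNReal.ofReal (sizeBiasedWeight i s) ∂ν

/-- The first `k` marginals of a measure on `[0,1]^ℕ`, as a measure on `ℝ^k`. -/
noncomputable def firstMarginals (k : ℕ) (μ : Measure (ℕ → unitInterval)) :
    Measure (Fin k → ℝ) :=
  μ.map fun x (j : Fin k) => (x j : ℝ)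

/-- The density `gem*_{α,θ}(x_1, …, x_k)` on the open simplex
`x_1, …, x_k > 0`, `x_1 + … + x_k < 1`, and `0` elsewhere.
`ProbabilityTheory.beta` is the beta function. -/
noncomputable def gemStarDensity (α θ : ℝ) (k : ℕ) (x : Fin k → ℝ) : ℝ :=
  open Classical in
  if (∀ j, 0 < x j) ∧ ∑ j, x j < 1 then
    α * Real.Gamma (2 + θ / α) /
        (Real.Gamma (1 - α) * Real.Gamma (θ + α + 1) *
          ∏ j ∈ Finset.Icc 2 k, ProbabilityTheory.beta (1 - α) (θ + j * α)) *
      ((1 - ∑ j, x j) ^ (θ + k * α) * (∏ j, x j ^ (-α)) /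
        ∏ j, (1 - ∑ l ∈ Finset.Iic j, x l))
  else 0

/-- The factor
`γ + (1 - α - γ) (1 - ∑ x_i² - (1 - α) / (1 + (k - 1) α - γ) (1 - ∑ x_i)²)`. -/
noncomputable def alphaGammaFactor (α γ : ℝ) (k : ℕ) (x : Fin k → ℝ) : ℝ :=
  γ + (1 - α - γ) *
    (1 - ∑ j, x j ^ 2 - (1 - α) / (1 + ((k : ℝ) - 1) * α - γ) * (1 - ∑ j, x j) ^ 2)

/-! The jumps of a stable subordinator are those of a Poisson process, and only a Palm formula is
needed of this fact: summing over `k` distinct ranked jumps, each weighted by its size, amounts to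
drawing `k` points from the size-weighted Lévy measure with density `α / Γ(1 - α) x ^ (-α)` and
adding them to an independent copy of `σ 1` (`IsStableSubordinator.lintegral_tsum_rankedJump`). It
is obtained without point processes. Increments over a grid are i.i.d., so the Laplace functional of
`k` distinct ones is explicit; as the mesh vanishes it becomes that of `k` distinct jumps
(`lintegral_exp_mul_injective`), and Laplace transforms determine measures (`ext_of_laplace`).

Inserting the size-biased weights into the Palm formula gives an integral over the positive orthant.
In the coordinates "jump divided by total mass" the variable `σ 1` separates as the factor `σ 1 ^
(-θ - k α)`, whose mean is a quotient of Gamma values, and what remains is the density of `GEM*`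
(`pickMeasure_pdStar`).

For the dislocation measure, `∑_{i ≠ j} s_i s_j = 1 - ∑ s_n ^ 2`. Given the first `k` picks `x`, the
squares of the unpicked entries add up to `1 - ∑ x_j` times the conditional mean of the next
size-biased pick. The density is thus the conditional mean of a function of `k + 1` picks
(`tsum_nextPickBias`), and the first `k` picks of `ν` come from the first `k + 1` picks of `PD*` by
integrating out the last one (`lintegral_pickMeasure_withDensity`). Under `GEM*` that last pick is a
beta proportion of the remaining mass, with mean `(1 - α) / (1 + (k - 1) α - γ)`, which gives the
stated factor.

The laws of the picks can be infinite. Since the first pick has a `σ`-finite law, a reweighting by a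
function of the first entry reduces existence to Kolmogorov extension of finite measures
(`exists_isSizeBiased`), and uniqueness to a π-system argument on a countable cover
(`IsSizeBiased.unique`). -/

open scoped BoundedContinuousFunction
open Filter Topology

/-! ### Regular grids of the time interval -/

/-- The point `i / (n + 1)` of the regular grid of mesh `1 / (n + 1)`. -/
noncomputable def gridPoint (n i : ℕ) : ℝ≥0 := (i : ℝ≥0) / ((n : ℝ≥0) + 1)

/-- The increment of a path over the `i`-th cell of the grid of mesh `1 / (n + 1)`. -/
noncomputable def gridIncrement (f : ℝ≥0 → ℝ) (n i : ℕ) : ℝ :=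
  f (gridPoint n (i + 1)) - f (gridPoint n i)

/-- The index of the cell of the grid of mesh `1 / (n + 1)` that contains `s ∈ (0, 1]`. -/
noncomputable def gridIndex (n : ℕ) (s : ℝ≥0) : Fin (n + 1) :=
  -- Cells are half-open on the left, hence the ceiling minus one; `min` only serves to land in `Fin
  -- (n + 1)` when `s > 1`.
  ⟨min n (⌈((n : ℝ≥0) + 1) * s⌉₊ - 1), by omega⟩

lemma gridPoint_mono (n : ℕ) : Monotone (gridPoint n) := fun i j h => by
  unfold gridPoint; gcongr

lemma gridPoint_zero (n : ℕ) : gridPoint n 0 = 0 := by simp [gridPoint]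

lemma gridPoint_last (n : ℕ) : gridPoint n (n + 1) = 1 := by
  unfold gridPoint
  push_cast
  exact div_self (by positivity)

lemma gridPoint_lt_iff {n i : ℕ} {s : ℝ≥0} :
    gridPoint n i < s ↔ (i : ℝ≥0) < ((n : ℝ≥0) + 1) * s := by
  rw [gridPoint, div_lt_iff₀ (by positivity), mul_comm]

lemma le_gridPoint_iff {n i : ℕ} {s : ℝ≥0} :
    s ≤ gridPoint n i ↔ ((n : ℝ≥0) + 1) * s ≤ i := by
  rw [gridPoint, le_div_iff₀ (by positivity), mul_comm]

lemma gridIndex_eq_iff {n : ℕ} {s : ℝ≥0} (hs : s ∈ Set.Ioc (0 : ℝ≥0) 1) (i : Fin (n + 1)) :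
    gridIndex n s = i ↔ s ∈ Set.Ioc (gridPoint n i) (gridPoint n (i + 1)) := by
  have hc1 : ⌈((n : ℝ≥0) + 1) * s⌉₊ ≤ n + 1 := by
    rw [Nat.ceil_le]; push_cast
    calc ((n : ℝ≥0) + 1) * s ≤ ((n : ℝ≥0) + 1) * 1 := by gcongr; exact hs.2
      _ = _ := mul_one _
  have hc0 : 0 < ⌈((n : ℝ≥0) + 1) * s⌉₊ := by
    rw [Nat.ceil_pos]; have := hs.1; positivity
  rw [Set.mem_Ioc, gridPoint_lt_iff, le_gridPoint_iff, ← Nat.lt_ceil, ← Nat.ceil_le, Fin.ext_iff]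
  simp only [gridIndex]
  omega

lemma mem_cell_gridIndex {n : ℕ} {s : ℝ≥0} (hs : s ∈ Set.Ioc (0 : ℝ≥0) 1) :
    s ∈ Set.Ioc (gridPoint n (gridIndex n s)) (gridPoint n (gridIndex n s + 1)) :=
  (gridIndex_eq_iff hs _).1 rfl

lemma measurable_gridIndex (n : ℕ) : Measurable (gridIndex n) := by
  have h : Measurable fun s : ℝ≥0 => ⌈((n : ℝ≥0) + 1) * s⌉₊ :=
    Nat.measurable_ceil.comp (measurable_id.const_mul _)
  exact (measurable_from_top (f := fun m : ℕ => (⟨min n (m - 1), by omega⟩ : Fin (n + 1)))).comp h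

/-- Cells contain their right but not their left endpoint. So the endpoints approach `s` within the
one-sided neighbourhoods that left limits and right continuity require, and increments over the
cells around `s` tend to the jump at `s`. -/
lemma tendsto_gridPoint_gridIndex {s : ℝ≥0} (hs : s ∈ Set.Ioc (0 : ℝ≥0) 1) :
    Tendsto (fun n => gridPoint n (gridIndex n s)) atTop (𝓝[<] s) ∧
    Tendsto (fun n => gridPoint n (gridIndex n s + 1)) atTop (𝓝[≥] s) := by
  have hstep : ∀ n i, gridPoint n (i + 1) = gridPoint n i + 1 / ((n : ℝ≥0) + 1) := fun n i => by
    simp only [gridPoint]; push_cast; rw [add_div]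
  have h0 : Tendsto (fun n : ℕ => 1 / ((n : ℝ≥0) + 1)) atTop (𝓝 0) :=
    tendsto_one_div_add_atTop_nhds_zero_nat
  have hu : Tendsto (fun n => gridPoint n (gridIndex n s + 1)) atTop (𝓝 s) := by
    refine tendsto_of_tendsto_of_tendsto_of_le_of_le (g := fun _ => s)
      (h := fun n : ℕ => s + 1 / ((n : ℝ≥0) + 1)) tendsto_const_nhds
      (by simpa using h0.const_add s) (fun n => (mem_cell_gridIndex hs).2) (fun n => ?_)
    rw [hstep]
    exact add_le_add_left (mem_cell_gridIndex hs).1.le _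
  have hl : Tendsto (fun n => gridPoint n (gridIndex n s)) atTop (𝓝 s) := by
    have := (NNReal.tendsto_coe.2 hu).sub (NNReal.tendsto_coe.2 h0)
    refine NNReal.tendsto_coe.1 ?_
    simp only [NNReal.coe_zero, sub_zero] at this
    refine this.congr fun n => ?_
    rw [hstep]; push_cast; ring
  exact ⟨tendsto_nhdsWithin_iff.2 ⟨hl, .of_forall fun n => (mem_cell_gridIndex hs).1⟩,
    tendsto_nhdsWithin_iff.2 ⟨hu, .of_forall fun n => (mem_cell_gridIndex hs).2⟩⟩

/-! ### Stieltjes sums over distinct cells -/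

namespace StieltjesFunction

variable (f : StieltjesFunction ℝ≥0)

lemma tendsto_gridIncrement {s : ℝ≥0} (hs : s ∈ Set.Ioc (0 : ℝ≥0) 1) :
    Tendsto (fun n => gridIncrement f n (gridIndex n s)) atTop (𝓝 (jump f s)) :=
  (((f.right_continuous s).tendsto).comp (tendsto_gridPoint_gridIndex hs).2).sub
    ((f.mono.tendsto_leftLim s).comp (tendsto_gridPoint_gridIndex hs).1)

/-- The Stieltjes measure of a path, on the time interval `(0, 1]`. -/
noncomputable def unitMeasure : Measure ℝ≥0 := f.measure.restrict (Set.Ioc 0 1)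

instance : IsFiniteMeasure f.unitMeasure :=
  ⟨by simp [unitMeasure, StieltjesFunction.measure_Ioc]⟩

lemma unitMeasure_map_gridIndex (n : ℕ) (i : Fin (n + 1)) :
    (f.unitMeasure.map (gridIndex n)) {i} = ENNReal.ofReal (gridIncrement f n i) := by
  rw [Measure.map_apply (measurable_gridIndex n) (measurableSet_singleton i), unitMeasure,
    Measure.restrict_apply (measurable_gridIndex n (measurableSet_singleton i)), gridIncrement,
    ← f.measure_Ioc]
  congr 1
  ext s
  simp only [Set.mem_inter_iff, Set.mem_preimage, Set.mem_singleton_iff]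
  refine ⟨fun h => (gridIndex_eq_iff h.2 i).1 h.1, fun h => ?_⟩
  have hs : s ∈ Set.Ioc (0 : ℝ≥0) 1 := by
    refine ⟨zero_le.trans_lt h.1, h.2.trans ?_⟩
    rw [← gridPoint_last n]
    exact gridPoint_mono n (by omega)
  exact ⟨(gridIndex_eq_iff hs i).2 h, hs⟩

lemma measurableSet_injective {k : ℕ} {β : Type*} [MeasurableSpace β] [MeasurableEq β] :
    MeasurableSet {s : Fin k → β | Function.Injective s} := by
  have : {s : Fin k → β | Function.Injective s} =
      ⋂ i, ⋂ j, {s | s i = s j → i = j} := by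
    ext s; simp [Function.Injective]
  rw [this]
  refine .iInter fun i => .iInter fun j => ?_
  by_cases h : i = j
  · simp [h]
  · simp only [h, imp_false]
    exact (measurableSet_eq_fun (measurable_pi_apply i) (measurable_pi_apply j)).compl

/-- The Stieltjes measure of a cell is the increment over it, so sums weighted by increments are
integrals of step functions; tuples of distinct cells become tuples of times lying in distinct
cells. -/
lemma sum_gridIncrement_eq_lintegral (n k : ℕ) (h : Fin k → ℝ → ℝ≥0) :
    ∑ i : Fin k ↪ Fin (n + 1), ∏ j, (ENNReal.ofReal (gridIncrement f n (i j)) *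
        h j (gridIncrement f n (i j))) =
      ∫⁻ s, {s : Fin k → ℝ≥0 | Function.Injective fun j => gridIndex n (s j)}.indicator
        (fun s => ((∏ j, h j (gridIncrement f n (gridIndex n (s j))) : ℝ≥0) : ℝ≥0∞)) s
        ∂Measure.pi fun _ => f.unitMeasure := by
  classical
  set G : (Fin k → Fin (n + 1)) → ℝ≥0∞ := {a | Function.Injective a}.indicator
    fun a => ((∏ j, h j (gridIncrement f n (a j)) : ℝ≥0) : ℝ≥0∞) with hG
  have hmap : (Measure.pi fun _ : Fin k => f.unitMeasure).map (fun s j => gridIndex n (s j)) =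
      Measure.pi fun _ : Fin k => f.unitMeasure.map (gridIndex n) :=
    Measure.pi_map_pi fun _ => (measurable_gridIndex n).aemeasurable
  have hmeas : Measurable fun (s : Fin k → ℝ≥0) (j : Fin k) => gridIndex n (s j) :=
    measurable_pi_lambda _ fun j => (measurable_gridIndex n).comp (measurable_pi_apply j)
  have : ∀ s : Fin k → ℝ≥0, {s : Fin k → ℝ≥0 | Function.Injective fun j => gridIndex n (s j)}.indicator
      (fun s => ((∏ j, h j (gridIncrement f n (gridIndex n (s j))) : ℝ≥0) : ℝ≥0∞)) s =
      G (fun j => gridIndex n (s j)) := fun s => by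
    simp only [hG, Set.indicator_apply, Set.mem_ofPred_eq]
  simp_rw [this]
  rw [← lintegral_map (f := G) (measurable_of_finite G) hmeas, hmap, lintegral_fintype]
  simp_rw [Measure.pi_singleton, unitMeasure_map_gridIndex, hG, Set.indicator_apply,
    Set.mem_ofPred_eq, ite_mul, zero_mul]
  rw [← Finset.sum_filter, Finset.sum_subtype (p := Function.Injective) _ (by simp),
    ← (Equiv.subtypeInjectiveEquivEmbedding (Fin k) (Fin (n + 1))).sum_comp]
  refine Finset.sum_congr rfl fun a _ => ?_
  rw [Finset.prod_mul_distrib, mul_comm, ENNReal.ofNNReal_finsetProd]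
  rfl

/-- Discretized sums over distinct cells converge to integrals over distinct times. -/
theorem tendsto_sum_gridIncrement {k : ℕ} (h : Fin k → ℝ → ℝ≥0) (hc : ∀ j, Continuous (h j))
    (C : ℝ≥0) (hC : ∀ j x, h j x ≤ C) :
    Tendsto (fun n => ∑ i : Fin k ↪ Fin (n + 1), ∏ j,
      (ENNReal.ofReal (gridIncrement f n (i j)) * h j (gridIncrement f n (i j)))) atTop
      (𝓝 (∫⁻ s in {s | Function.Injective s}, ((∏ j, h j (jump f (s j)) : ℝ≥0) : ℝ≥0∞)
        ∂Measure.pi fun _ => f.unitMeasure)) := by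
  simp_rw [sum_gridIncrement_eq_lintegral]
  rw [← lintegral_indicator measurableSet_injective]
  refine tendsto_lintegral_of_dominated_convergence (fun _ => (C : ℝ≥0∞) ^ k) (fun n => ?_)
    (fun n => .of_forall fun s => ?_) ?_ ?_
  · have hmeas : Measurable fun (s : Fin k → ℝ≥0) (j : Fin k) => gridIndex n (s j) :=
      measurable_pi_lambda _ fun j => (measurable_gridIndex n).comp (measurable_pi_apply j)
    exact (measurable_of_finite (({a | Function.Injective a}.indicator
      fun a => ((∏ j, h j (gridIncrement f n (a j)) : ℝ≥0) : ℝ≥0∞)) :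
        (Fin k → Fin (n + 1)) → ℝ≥0∞)).comp hmeas
  · refine Set.indicator_le' (fun s _ => ?_) (fun s _ => zero_le (a := (C : ℝ≥0∞) ^ k)) s
    refine (ENNReal.coe_le_coe.2 (Finset.prod_le_pow_card _ _ C fun j _ => hC _ _)).trans ?_
    simp
  · rw [lintegral_const]
    exact ENNReal.mul_ne_top (ENNReal.pow_ne_top ENNReal.coe_ne_top) (measure_ne_top _ _)
  · have hmem : ∀ᵐ s ∂Measure.pi fun _ : Fin k => f.unitMeasure, ∀ j, s j ∈ Set.Ioc (0 : ℝ≥0) 1 :=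
      ae_all_iff.2 fun j => Measure.tendsto_eval_ae_ae.eventually
        (ae_restrict_mem measurableSet_Ioc)
    filter_upwards [hmem] with s hs
    have hlim : ∀ j, Tendsto (fun n => gridIncrement f n (gridIndex n (s j))) atTop
        (𝓝 (jump f (s j))) := fun j => f.tendsto_gridIncrement (hs j)
    by_cases hinj : Function.Injective s
    · rw [Set.indicator_of_mem (by exact hinj)]
      -- The grid eventually separates distinct times: the left endpoint of the cell of the later
      -- time tends to that time, hence passes the earlier one.
      have hev : ∀ᶠ n in atTop, Function.Injective fun j => gridIndex n (s j) := by
        have hlt : ∀ i j, s i < s j → ∀ᶠ n in atTop, gridIndex n (s i) ≠ gridIndex n (s j) := by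
          intro i j hij
          have := (tendsto_nhdsWithin_iff.1 (tendsto_gridPoint_gridIndex (hs j)).1).1
          filter_upwards [this.eventually (lt_mem_nhds hij)] with n hn heq
          rw [← heq] at hn
          exact lt_asymm hn (mem_cell_gridIndex (hs i)).1
        have : ∀ i j, i ≠ j → ∀ᶠ n in atTop, gridIndex n (s i) ≠ gridIndex n (s j) := by
          intro i j hij
          rcases lt_or_gt_of_ne (hinj.ne hij) with h1 | h1
          · exact hlt i j h1
          · exact (hlt j i h1).mono fun n hn => hn.symm
        simp only [Function.Injective]
        rw [Filter.eventually_all]; intro i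
        rw [Filter.eventually_all]; intro j
        by_cases hij : i = j
        · simp [hij]
        · filter_upwards [this i j hij] with n hn h using absurd h hn
      refine Tendsto.congr' (f₁ := fun n =>
        ((∏ j, h j (gridIncrement f n (gridIndex n (s j))) : ℝ≥0) : ℝ≥0∞)) ?_ ?_
      · filter_upwards [hev] with n hn
        rw [Set.indicator_of_mem (by exact hn)]
      · exact ENNReal.tendsto_coe.2
          (tendsto_finsetProd _ fun j _ => ((hc j).tendsto _).comp (hlim j))
    · rw [Set.indicator_of_notMem (by exact hinj)]
      refine tendsto_const_nhds.congr fun n => ?_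
      rw [Set.indicator_of_notMem]
      exact fun hn => hinj fun i j hij => hn (by simp only [hij])

end StieltjesFunction

/-! ### Ranked jumps as an enumeration of the jump times -/

namespace StieltjesFunction

variable (f : StieltjesFunction ℝ≥0)

lemma jump_nonneg (t : ℝ≥0) : 0 ≤ jump f t := sub_nonneg.2 (f.mono.leftLim_le le_rfl)

lemma jump_zero : jump f 0 = 0 := by
  rw [jump, leftLim_eq_of_isBot (fun _ => zero_le), sub_self]

lemma measurable_jump : Measurable (jump f) :=
  f.mono.measurable.sub f.mono.leftLim.measurable

lemma unitMeasure_singleton {t : ℝ≥0} (ht : t ≤ 1) :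
    f.unitMeasure {t} = ENNReal.ofReal (jump f t) := by
  rcases eq_or_lt_of_le (zero_le (a := t)) with rfl | h0
  · rw [unitMeasure, Measure.restrict_apply (measurableSet_singleton _), jump_zero]
    have : ({0} ∩ Set.Ioc 0 1 : Set ℝ≥0) = ∅ := by ext; simp +contextual
    simp [this]
  · rw [unitMeasure, Measure.restrict_apply (measurableSet_singleton _),
      Set.inter_eq_self_of_subset_left (Set.singleton_subset_iff.2 (show t ∈ Set.Ioc 0 1 from ⟨h0, ht⟩))]
    exact f.measure_singleton t

/-- Jump times are atoms of a finite measure, and only finitely many disjoint sets can have mass at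
least `x`. -/
lemma finite_le_jump {x : ℝ} (hx : 0 < x) : {t : ℝ≥0 | t ≤ 1 ∧ x ≤ jump f t}.Finite := by
  have h := Measure.finite_const_le_meas_of_disjoint_iUnion f.unitMeasure
    (ε := ENNReal.ofReal x) (by simpa using hx) (As := fun t : ℝ≥0 => {t})
    (fun t => measurableSet_singleton t) (fun s t hst => by simpa using hst) (measure_ne_top _ _)
  refine h.subset fun t ht => ?_
  simp only [Set.mem_ofPred_eq]
  rw [f.unitMeasure_singleton ht.1]
  exact ENNReal.ofReal_le_ofReal ht.2

/-- The supremum in `rankedJump` is attained: jumps of size at least `x / 2` are finite in number,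
so those below `x` stay below some `y < x`, and every jump exceeding `y` is at least `x`. -/
lemma le_rankedJump_iff {x : ℝ} (hx : 0 < x) (n : ℕ) :
    x ≤ rankedJump f n ↔
      ((n + 1 : ℕ) : ℕ∞) ≤ Set.encard {t : ℝ≥0 | t ≤ 1 ∧ x ≤ jump f t} := by
  set S := {x : ℝ | 0 < x ∧ ((n + 1 : ℕ) : ℕ∞) ≤ Set.encard {t : ℝ≥0 | t ≤ 1 ∧ x ≤ jump f t}}
  have hS : rankedJump f n = sSup S := rfl
  have hbdd : BddAbove S := by
    refine ⟨f 1 - f 0, fun y hy => ?_⟩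
    have hne : Set.Nonempty {t : ℝ≥0 | t ≤ 1 ∧ y ≤ jump f t} := by
      rw [← Set.encard_pos]
      exact lt_of_lt_of_le (by simp) hy.2
    obtain ⟨t, ht1, hty⟩ := hne
    have h0 : 0 < t := by
      rcases eq_or_lt_of_le (zero_le (a := t)) with rfl | h0
      · rw [jump_zero] at hty; exact absurd hy.1 hty.not_gt
      · exact h0
    exact hty.trans (sub_le_sub (f.mono ht1) (f.mono.le_leftLim h0))
  rw [hS]
  refine ⟨fun h => ?_, fun h => le_csSup hbdd ⟨hx, h⟩⟩
  have hne : S.Nonempty := by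
    by_contra hne
    rw [Set.not_nonempty_iff_eq_empty.1 hne, Real.sSup_empty] at h
    exact absurd hx h.not_gt
  have hfin : {t : ℝ≥0 | (t ≤ 1 ∧ x / 2 ≤ jump f t) ∧ jump f t < x}.Finite :=
    (f.finite_le_jump (half_pos hx)).subset fun t ht => ht.1
  have hev : ∀ᶠ y in 𝓝[<] x, ∀ t ∈ {t : ℝ≥0 | (t ≤ 1 ∧ x / 2 ≤ jump f t) ∧ jump f t < x},
      jump f t < y :=
    (eventually_all_finite hfin).2 fun t ht => eventually_nhdsWithin_of_eventually_nhds
      (lt_mem_nhds ht.2)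
  have hev2 : ∀ᶠ y in 𝓝[<] x, x / 2 < y :=
    eventually_nhdsWithin_of_eventually_nhds (lt_mem_nhds (half_lt_self hx))
  obtain ⟨y, ⟨hy1, hy2⟩, hyx⟩ := ((hev.and hev2).and self_mem_nhdsWithin).exists
  obtain ⟨z, hz, hyz⟩ := exists_lt_of_lt_csSup hne (lt_of_lt_of_le hyx h)
  refine hz.2.trans (Set.encard_le_encard fun t ht => ⟨ht.1, ?_⟩)
  by_contra hlt
  have := hy1 t ⟨⟨ht.1, (hy2.trans (hyz.trans_le ht.2)).le⟩, not_le.1 hlt⟩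
  linarith [ht.2]

lemma rankedJump_nonneg (g : ℝ≥0 → ℝ) (n : ℕ) : 0 ≤ rankedJump g n :=
  Real.sSup_nonneg fun _ hx => hx.1.le

lemma rankedJump_antitone : Antitone (rankedJump f) := fun n m hnm => by
  by_contra! h
  have hpos : 0 < rankedJump f m := (rankedJump_nonneg f n).trans_lt h
  have := (f.le_rankedJump_iff hpos m).1 le_rfl
  exact absurd ((f.le_rankedJump_iff hpos n).2 (le_trans (by gcongr) this)) h.not_ge

lemma encard_le_rankedJump {x : ℝ} (hx : 0 < x) :
    Set.encard {n | x ≤ rankedJump f n} = Set.encard {t : ℝ≥0 | t ≤ 1 ∧ x ≤ jump f t} := by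
  have h := f.finite_le_jump hx
  simp_rw [f.le_rankedJump_iff hx]
  rw [← h.cast_ncard_eq]
  have : {n : ℕ | ((n + 1 : ℕ) : ℕ∞) ≤ ({t : ℝ≥0 | t ≤ 1 ∧ x ≤ jump f t}.ncard : ℕ∞)} =
      Set.Iio {t : ℝ≥0 | t ≤ 1 ∧ x ≤ jump f t}.ncard := by
    ext n
    simp only [Set.mem_ofPred_eq, Nat.cast_le, Set.mem_Iio]
    omega
  rw [this, ← Finset.coe_Iio, Set.encard_coe_eq_coe_finsetCard, Nat.card_Iio]

lemma finite_le_rankedJump {x : ℝ} (hx : 0 < x) : {n | x ≤ rankedJump f n}.Finite := by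
  rw [← Set.encard_lt_top_iff, f.encard_le_rankedJump hx, Set.encard_lt_top_iff]
  exact f.finite_le_jump hx

/-- Only finitely many values exceed `x`, so "above `x`" can be replaced by "at least `y`" for some
`y > x`. Ranks and times then have equal counts both at and above `x`, and these finite counts can
be subtracted. -/
lemma encard_rankedJump_eq {x : ℝ} (hx : 0 < x) :
    Set.encard {n | rankedJump f n = x} = Set.encard {t : ℝ≥0 | t ≤ 1 ∧ jump f t = x} := by
  have h1 : {n | x < rankedJump f n}.Finite :=
    (f.finite_le_rankedJump hx).subset fun n (hn : x < _) => hn.le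
  have h2 : {t : ℝ≥0 | t ≤ 1 ∧ x < jump f t}.Finite :=
    (f.finite_le_jump hx).subset fun t ht => ⟨ht.1, ht.2.le⟩
  have e1 : ∀ᶠ y in 𝓝[>] x, ∀ n ∈ {n | x < rankedJump f n}, y < rankedJump f n :=
    (eventually_all_finite h1).2 fun n hn => eventually_nhdsWithin_of_eventually_nhds
      (gt_mem_nhds hn)
  have e2 : ∀ᶠ y in 𝓝[>] x, ∀ t ∈ {t : ℝ≥0 | t ≤ 1 ∧ x < jump f t}, y < jump f t :=
    (eventually_all_finite h2).2 fun t ht => eventually_nhdsWithin_of_eventually_nhds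
      (gt_mem_nhds ht.2)
  obtain ⟨y, ⟨hy1, hy2⟩, hyx⟩ := ((e1.and e2).and self_mem_nhdsWithin).exists
  have hyx : x < y := hyx
  have k1 : {n | x < rankedJump f n} = {n | y ≤ rankedJump f n} :=
    Set.ext fun n => ⟨fun h => (hy1 n h).le, fun h => hyx.trans_le h⟩
  have k2 : {t : ℝ≥0 | t ≤ 1 ∧ x < jump f t} = {t : ℝ≥0 | t ≤ 1 ∧ y ≤ jump f t} :=
    Set.ext fun t => ⟨fun h => ⟨h.1, (hy2 t h).le⟩, fun h => ⟨h.1, hyx.trans_le h.2⟩⟩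
  have k3 : Set.encard {n | x < rankedJump f n} =
      Set.encard {t : ℝ≥0 | t ≤ 1 ∧ x < jump f t} := by
    rw [k1, k2, f.encard_le_rankedJump (hx.trans hyx)]
  have s1 : {n | x ≤ rankedJump f n} = {n | x < rankedJump f n} ∪ {n | rankedJump f n = x} := by
    ext n; simp only [Set.mem_ofPred_eq, Set.mem_union, le_iff_lt_or_eq, eq_comm]
  have s2 : {t : ℝ≥0 | t ≤ 1 ∧ x ≤ jump f t} =
      {t : ℝ≥0 | t ≤ 1 ∧ x < jump f t} ∪ {t : ℝ≥0 | t ≤ 1 ∧ jump f t = x} := by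
    ext t; simp only [Set.mem_ofPred_eq, Set.mem_union, le_iff_lt_or_eq, eq_comm (a := x)]; tauto
  have h := f.encard_le_rankedJump hx
  rw [s1, s2, Set.encard_union_eq, Set.encard_union_eq, k3] at h
  · exact ENat.add_right_injective_of_ne_top (Set.encard_lt_top_iff.2 h2).ne h
  · exact Set.disjoint_left.2 fun t h1 h2 => h1.2.ne' h2.2
  · exact Set.disjoint_left.2 fun t (h1 : _ < _) (h2 : _ = _) => h1.ne' h2

/-- The positive ranked jumps enumerate the jump times in `[0, 1]`. -/
theorem exists_equiv_jump :
    ∃ e : {n : ℕ // 0 < rankedJump f n} ≃ {t : ℝ≥0 // t ≤ 1 ∧ 0 < jump f t},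
      ∀ n, jump f (e n) = rankedJump f n := by
  let p : {n : ℕ // 0 < rankedJump f n} → {x : ℝ // 0 < x} := fun n => ⟨_, n.2⟩
  let q : {t : ℝ≥0 // t ≤ 1 ∧ 0 < jump f t} → {x : ℝ // 0 < x} := fun t => ⟨_, t.2.2⟩
  -- The ranks and the times that carry a given value form finite sets of equal cardinality; the
  -- bijection is glued from these fibres.
  have key : ∀ x : {x : ℝ // 0 < x}, Nonempty ({n // p n = x} ≃ {t // q t = x}) := by
    rintro ⟨x, hx⟩
    have hn : {n | rankedJump f n = x}.Finite :=
      (f.finite_le_rankedJump hx).subset fun n hn => ge_of_eq hn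
    have ht : {t : ℝ≥0 | t ≤ 1 ∧ jump f t = x}.Finite :=
      (f.finite_le_jump hx).subset fun t ht => ⟨ht.1, ge_of_eq ht.2⟩
    let a : {n // p n = ⟨x, hx⟩} ≃ {n | rankedJump f n = x} :=
      { toFun := fun n => ⟨n.1.1, congrArg Subtype.val n.2⟩
        invFun := fun n => ⟨⟨n.1, by have : rankedJump f n.1 = x := n.2; rwa [this]⟩,
          Subtype.ext n.2⟩
        left_inv := fun _ => rfl
        right_inv := fun _ => rfl }
    let b : {t // q t = ⟨x, hx⟩} ≃ {t : ℝ≥0 | t ≤ 1 ∧ jump f t = x} :=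
      { toFun := fun t => ⟨t.1.1, t.1.2.1, congrArg Subtype.val t.2⟩
        invFun := fun t => ⟨⟨t.1, t.2.1, by rw [t.2.2]; exact hx⟩, Subtype.ext t.2.2⟩
        left_inv := fun _ => rfl
        right_inv := fun _ => rfl }
    have : Finite {n | rankedJump f n = x} := hn
    have : Finite {t : ℝ≥0 | t ≤ 1 ∧ jump f t = x} := ht
    have hc : Nat.card {n | rankedJump f n = x} = Nat.card {t : ℝ≥0 | t ≤ 1 ∧ jump f t = x} := by
      rw [Nat.card_coe_set_eq, Nat.card_coe_set_eq, Set.ncard, Set.ncard,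
        f.encard_rankedJump_eq hx]
    obtain ⟨c⟩ := (Finite.card_eq (α := {n | rankedJump f n = x})
      (β := {t : ℝ≥0 | t ≤ 1 ∧ jump f t = x})).1 hc
    exact ⟨a.trans (c.trans b.symm)⟩
  refine ⟨(Equiv.sigmaFiberEquiv p).symm.trans
    ((Equiv.sigmaCongrRight fun x => (key x).some).trans (Equiv.sigmaFiberEquiv q)), fun n => ?_⟩
  exact congrArg Subtype.val ((key (p n)).some ⟨n, rfl⟩).2

/-- For a path of pure jump type, integrals over distinct times are sums over distinct ranks. -/
theorem lintegral_injective_eq_tsum (hpure : f.unitMeasure {t | jump f t = 0} = 0) {k : ℕ}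
    (F : (Fin k → ℝ) → ℝ≥0∞) :
    ∫⁻ s in {s | Function.Injective s}, F (fun j => jump f (s j))
        ∂Measure.pi (fun _ : Fin k => f.unitMeasure) =
      ∑' i : Fin k ↪ ℕ, (∏ j, ENNReal.ofReal (rankedJump f (i j))) *
        F (fun j => rankedJump f (i j)) := by
  set J : Set ℝ≥0 := {t | t ≤ 1 ∧ 0 < jump f t} with hJ
  have hJc : J.Countable := by
    have : J = ⋃ n : ℕ, {t : ℝ≥0 | t ≤ 1 ∧ 1 / ((n : ℝ) + 1) ≤ jump f t} := by
      ext t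
      simp only [hJ, Set.mem_ofPred_eq, Set.mem_iUnion]
      refine ⟨fun h => ?_, fun ⟨n, h⟩ => ⟨h.1, lt_of_lt_of_le (by positivity) h.2⟩⟩
      obtain ⟨n, hn⟩ := exists_nat_one_div_lt h.2
      exact ⟨n, h.1, hn.le⟩
    rw [this]
    exact Set.countable_iUnion fun n => (f.finite_le_jump (by positivity)).countable
  -- Without mass off the jump times, almost every tuple of distinct times lies in the countable set
  -- `I`, where an integral is a sum over atoms.
  set I : Set (Fin k → ℝ≥0) := {s | Function.Injective s ∧ ∀ j, s j ∈ J} with hI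
  have hIc : I.Countable :=
    (Set.countable_pi fun _ : Fin k => hJc).mono fun _ hs => hs.2
  have hae : ∀ᵐ s ∂Measure.pi (fun _ : Fin k => f.unitMeasure), ∀ j, s j ∈ J := by
    refine ae_all_iff.2 fun j => Measure.tendsto_eval_ae_ae.eventually ?_
    have h1 : ∀ᵐ t ∂f.unitMeasure, t ∈ Set.Ioc (0 : ℝ≥0) 1 := ae_restrict_mem measurableSet_Ioc
    have h2 : ∀ᵐ t ∂f.unitMeasure, jump f t ≠ 0 := by
      rw [ae_iff]; simpa using hpure
    filter_upwards [h1, h2] with t ht1 ht2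
    exact ⟨ht1.2, (f.jump_nonneg t).lt_of_ne' ht2⟩
  have hset : ({s | Function.Injective s} : Set (Fin k → ℝ≥0))
      =ᵐ[Measure.pi (fun _ : Fin k => f.unitMeasure)] I := by
    filter_upwards [hae] with s hs
    refine propext ⟨fun h => ⟨h, hs⟩, fun h => h.1⟩
  rw [setLIntegral_congr hset, lintegral_countable _ hIc]
  obtain ⟨e, he⟩ := f.exists_equiv_jump
  let E : {i : Fin k ↪ ℕ // ∀ j, 0 < rankedJump f (i j)} ≃ I :=
    { toFun := fun i => ⟨fun j => e ⟨i.1 j, i.2 j⟩,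
        fun j j' h => i.1.injective (by simpa using congrArg Subtype.val (e.injective (Subtype.ext h))),
        fun j => (e ⟨i.1 j, i.2 j⟩).2⟩
      invFun := fun s => ⟨⟨fun j => e.symm ⟨s.1 j, s.2.2 j⟩, fun j j' h => s.2.1 (by
        simpa using congrArg Subtype.val (e.symm.injective (Subtype.ext h)))⟩,
        fun j => (e.symm ⟨s.1 j, s.2.2 j⟩).2⟩
      left_inv := fun i => by ext j; simp
      right_inv := fun s => by
        ext j
        exact congrArg (fun t => (t.1 : ℝ)) (e.apply_symm_apply ⟨s.1 j, s.2.2 j⟩) }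
  rw [← E.tsum_eq]
  have hval : ∀ i : {i : Fin k ↪ ℕ // ∀ j, 0 < rankedJump f (i j)}, ∀ j,
      jump f ((E i).1 j) = rankedJump f (i.1 j) := fun i j => he ⟨i.1 j, i.2 j⟩
  have hterm : ∀ i : {i : Fin k ↪ ℕ // ∀ j, 0 < rankedJump f (i j)},
      F (fun j => jump f ((E i).1 j)) * Measure.pi (fun _ : Fin k => f.unitMeasure) {(E i).1} =
      (∏ j, ENNReal.ofReal (rankedJump f (i.1 j))) * F (fun j => rankedJump f (i.1 j)) := by
    intro i
    rw [Measure.pi_singleton, mul_comm]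
    simp_rw [hval]
    congr 1
    refine Finset.prod_congr rfl fun j _ => ?_
    rw [f.unitMeasure_singleton ((E i).2.2 j).1, hval]
  simp_rw [hterm]
  -- Tuples with a vanishing ranked jump contribute zero, so the sum may run over all embeddings.
  refine tsum_subtype_eq_of_support_subset (f := fun i : Fin k ↪ ℕ =>
    (∏ j, ENNReal.ofReal (rankedJump f (i j))) * F (fun j => rankedJump f (i j))) fun i hi j => ?_
  by_contra hneg
  refine hi ?_
  simp only
  rw [Finset.prod_eq_zero (Finset.mem_univ j) (ENNReal.ofReal_eq_zero.2 (not_lt.1 hneg)), zero_mul]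

/-- The inverse jump turns each atom into unit mass. Written as an integral, the count can be
approximated by continuous functionals, which is how ranked jumps are shown to be measurable. -/
lemma encard_eq_lintegral {x : ℝ} (hx : 0 < x) :
    ((Set.encard {t : ℝ≥0 | t ≤ 1 ∧ x ≤ jump f t} : ℕ∞) : ℝ≥0∞) =
      ∫⁻ s, {s : ℝ≥0 | x ≤ jump f s}.indicator (fun s => ENNReal.ofReal (jump f s)⁻¹) s
        ∂f.unitMeasure := by
  have hm : MeasurableSet {s : ℝ≥0 | x ≤ jump f s} :=
    measurableSet_le measurable_const f.measurable_jump
  rw [lintegral_indicator hm]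
  have hset : {s : ℝ≥0 | x ≤ jump f s} =ᵐ[f.unitMeasure] {t : ℝ≥0 | t ≤ 1 ∧ x ≤ jump f t} := by
    have h1 : ∀ᵐ t ∂f.unitMeasure, t ∈ Set.Ioc (0 : ℝ≥0) 1 := ae_restrict_mem measurableSet_Ioc
    filter_upwards [h1] with t ht
    exact propext ⟨fun h => ⟨ht.2, h⟩, fun h => h.2⟩
  rw [setLIntegral_congr hset, lintegral_countable _ (f.finite_le_jump hx).countable,
    ← ENNReal.tsum_set_one]
  refine tsum_congr fun t => ?_
  have hpos : 0 < jump f t := hx.trans_le t.2.2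
  rw [f.unitMeasure_singleton t.2.1, ← ENNReal.ofReal_mul (by positivity),
    inv_mul_cancel₀ hpos.ne', ENNReal.ofReal_one]

end StieltjesFunction

/-! ### Laplace transforms and tilted means -/

section Laplace

variable {Ω : Type*} [MeasurableSpace Ω] {P : Measure Ω} [IsProbabilityMeasure P]

lemma integrable_exp_neg_mul {X : Ω → ℝ} (hX : AEMeasurable X P) (hX0 : 0 ≤ᵐ[P] X) {l : ℝ}
    (hl : 0 ≤ l) : Integrable (fun ω => Real.exp (-(l * X ω))) P := by
  refine Integrable.mono' (integrable_const (1 : ℝ))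
    (Real.measurable_exp.comp_aemeasurable (hX.const_mul l).neg).aestronglyMeasurable ?_
  filter_upwards [hX0] with ω hω
  rw [Real.norm_eq_abs, abs_of_pos (Real.exp_pos _), Real.exp_le_one_iff]
  have : 0 ≤ l * X ω := mul_nonneg hl hω
  linarith

lemma lintegral_exp_neg_mul_eq {X : Ω → ℝ} (hX : AEMeasurable X P) (hX0 : 0 ≤ᵐ[P] X) {l : ℝ}
    (hl : 0 ≤ l) : ∫⁻ ω, ENNReal.ofReal (Real.exp (-(l * X ω))) ∂P =
      ENNReal.ofReal (∫ ω, Real.exp (-(l * X ω)) ∂P) :=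
  (ofReal_integral_eq_lintegral_ofReal (integrable_exp_neg_mul hX hX0 hl)
    (.of_forall fun _ => (Real.exp_pos _).le)).symm

/-- A nonnegative random variable with Laplace transform `l ↦ exp (-c l ^ α)` has tilted mean
`E[X exp (-l X)] = c α l ^ (α - 1) exp (-c l ^ α)`. -/
lemma lintegral_mul_exp_of_laplace {X : Ω → ℝ} (hX : AEMeasurable X P) (hX0 : 0 ≤ᵐ[P] X)
    {c α : ℝ} (h : ∀ l : ℝ, 0 < l →
      ∫⁻ ω, ENNReal.ofReal (Real.exp (-(l * X ω))) ∂P = ENNReal.ofReal (Real.exp (-(c * l ^ α))))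
    {l : ℝ} (hl : 0 < l) :
    ∫⁻ ω, ENNReal.ofReal (X ω * Real.exp (-(l * X ω))) ∂P =
      ENNReal.ofReal (c * α * l ^ (α - 1) * Real.exp (-(c * l ^ α))) := by
  -- The moment generating function is finite around `-l`, so it can be differentiated under the
  -- expectation there.
  have hset : Set.Iic (0 : ℝ) ⊆ integrableExpSet X P := fun t ht => by
    have := integrable_exp_neg_mul (P := P) hX hX0 (l := -t) (by simpa using ht)
    simpa [integrableExpSet] using this
  have hint : -l ∈ interior (integrableExpSet X P) :=
    interior_mono hset (by rw [interior_Iic]; simpa using hl)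
  have hd := hasDerivAt_mgf hint
  have hmgf : ∀ t : ℝ, t < 0 → mgf X P t = Real.exp (-(c * (-t) ^ α)) := fun t ht => by
    have h1 := h (-t) (by linarith)
    rw [lintegral_exp_neg_mul_eq hX hX0 (by linarith)] at h1
    have := (ENNReal.ofReal_eq_ofReal_iff (integral_nonneg fun _ => (Real.exp_pos _).le)
      (Real.exp_pos _).le).1 h1
    rw [← this, mgf]
    simp
  have hd2 : HasDerivAt (fun t : ℝ => Real.exp (-(c * (-t) ^ α)))
      (Real.exp (-(c * (- -l) ^ α)) * (-(c * ((-1) * α * (- -l) ^ (α - 1))))) (-l) :=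
    ((((hasDerivAt_id (-l)).neg.rpow_const (Or.inl (by simpa using hl.ne'))).const_mul c).neg).exp
  have heq : mgf X P =ᶠ[𝓝 (-l)] fun t : ℝ => Real.exp (-(c * (-t) ^ α)) := by
    filter_upwards [gt_mem_nhds (show -l < 0 by linarith)] with t ht using hmgf t ht
  have hval := hd.unique (hd2.congr_of_eventuallyEq heq)
  have hi : Integrable (fun ω => X ω * Real.exp (-l * X ω)) P := by
    have := integrable_pow_mul_exp_of_mem_interior_integrableExpSet hint 1
    simpa using this
  simp only [← neg_mul l]
  rw [← ofReal_integral_eq_lintegral_ofReal hi]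
  · congr 1
    rw [show (∫ ω, X ω * Real.exp (-l * X ω) ∂P) = _ from hval, neg_neg]
    ring
  · filter_upwards [hX0] with ω hω using mul_nonneg hω (Real.exp_pos _).le

end Laplace

/-! ### Increments of the subordinator over a grid -/

namespace IsStableSubordinator

variable {Ω : Type*} [MeasurableSpace Ω] {P : Measure Ω} {σ : ℝ≥0 → Ω → ℝ} {α : ℝ}

lemma measurable_gridIncrement (hσ : IsStableSubordinator P σ α) (n i : ℕ) :
    Measurable fun ω => gridIncrement (fun t => σ t ω) n i :=
  (hσ.measurable _).sub (hσ.measurable _)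

lemma gridIncrement_nonneg (hσ : IsStableSubordinator P σ α) :
    ∀ᵐ ω ∂P, ∀ n i, 0 ≤ gridIncrement (fun t => σ t ω) n i := by
  filter_upwards [hσ.mono] with ω hω n i
  exact sub_nonneg.2 (hω (gridPoint_mono n (by omega)))

lemma sum_gridIncrement (hσ : IsStableSubordinator P σ α) :
    ∀ᵐ ω ∂P, ∀ n, ∑ i : Fin (n + 1), gridIncrement (fun t => σ t ω) n i = σ 1 ω := by
  filter_upwards [hσ.zero] with ω hω n
  rw [Fin.sum_univ_eq_sum_range (fun i => gridIncrement (fun t => σ t ω) n i) (n + 1)]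
  simp only [gridIncrement]
  rw [Finset.sum_range_sub (fun i => σ (gridPoint n i) ω), gridPoint_last, gridPoint_zero, hω,
    sub_zero]

lemma nonneg (hσ : IsStableSubordinator P σ α) : ∀ᵐ ω ∂P, ∀ t, 0 ≤ σ t ω := by
  filter_upwards [hσ.zero, hσ.mono] with ω h0 hm t
  rw [← h0]; exact hm zero_le

lemma iIndepFun_gridIncrement (hσ : IsStableSubordinator P σ α) (n : ℕ) :
    iIndepFun (fun (i : ℕ) ω => gridIncrement (fun t => σ t ω) n i) P :=
  hσ.indep.nat (gridPoint_mono n)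

lemma identDistrib_gridIncrement (hσ : IsStableSubordinator P σ α) (n i : ℕ) :
    IdentDistrib (fun ω => gridIncrement (fun t => σ t ω) n i) (σ (gridPoint n 1)) P P := by
  have : gridPoint n (i + 1) = gridPoint n i + gridPoint n 1 := by
    simp only [gridPoint]; push_cast; rw [add_div]
  simp only [gridIncrement, this]
  exact hσ.stationary _ _

lemma lintegral_comp_gridIncrement (hσ : IsStableSubordinator P σ α) (n i : ℕ)
    {g : ℝ → ℝ≥0∞} (hg : Measurable g) :
    ∫⁻ ω, g (gridIncrement (fun t => σ t ω) n i) ∂P = ∫⁻ ω, g (σ (gridPoint n 1) ω) ∂P :=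
  ((hσ.identDistrib_gridIncrement n i).comp hg).lintegral_eq

lemma lintegral_prod_gridIncrement (hσ : IsStableSubordinator P σ α) (n : ℕ)
    {g : Fin (n + 1) → ℝ → ℝ≥0∞} (hg : ∀ i, Measurable (g i)) :
    ∫⁻ ω, ∏ i, g i (gridIncrement (fun t => σ t ω) n i) ∂P =
      ∏ i, ∫⁻ ω, g i (σ (gridPoint n 1) ω) ∂P := by
  have hind := ((hσ.iIndepFun_gridIncrement n).precomp
    (g := fun i : Fin (n + 1) => (i : ℕ)) Fin.val_injective).comp g hg
  have := lintegral_prod_eq_prod_lintegral_of_indepFun Finset.univ _ hind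
    (fun i => (hg i).comp (hσ.measurable_gridIncrement n i))
  simp only [Function.comp_def] at this
  rw [this]
  exact Finset.prod_congr rfl fun i _ => hσ.lintegral_comp_gridIncrement n i (hg i)

variable [IsProbabilityMeasure P]

lemma laplace_one (hσ : IsStableSubordinator P σ α) {l : ℝ} (hl : 0 < l) :
    ∫⁻ ω, ENNReal.ofReal (Real.exp (-(l * σ 1 ω))) ∂P =
      ENNReal.ofReal (Real.exp (-(l ^ α))) := by
  rw [lintegral_exp_neg_mul_eq (hσ.measurable 1).aemeasurable
    (hσ.nonneg.mono fun ω h => h 1) hl.le, hσ.laplace l hl]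

/-- The `n + 1` increments are independent, equally distributed and sum to `σ 1`; taking the power
`n + 1` is injective on `ℝ≥0∞`. -/
lemma laplace_gridPoint (hσ : IsStableSubordinator P σ α) (n : ℕ) {l : ℝ} (hl : 0 < l) :
    ∫⁻ ω, ENNReal.ofReal (Real.exp (-(l * σ (gridPoint n 1) ω))) ∂P =
      ENNReal.ofReal (Real.exp (-(1 / ((n : ℝ) + 1) * l ^ α))) := by
  have h1 := hσ.lintegral_prod_gridIncrement n
    (g := fun _ x => ENNReal.ofReal (Real.exp (-(l * x)))) (fun i => by fun_prop)
  have h2 : ∫⁻ ω, ∏ i : Fin (n + 1), ENNReal.ofReal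
      (Real.exp (-(l * gridIncrement (fun t => σ t ω) n i))) ∂P =
      ∫⁻ ω, ENNReal.ofReal (Real.exp (-(l * σ 1 ω))) ∂P := by
    refine lintegral_congr_ae ?_
    filter_upwards [hσ.sum_gridIncrement] with ω hω
    rw [← ENNReal.ofReal_prod_of_nonneg fun i _ => (Real.exp_pos _).le, ← Real.exp_sum,
      Finset.sum_neg_distrib, ← Finset.mul_sum, hω]
  rw [h2, hσ.laplace_one hl, Finset.prod_const, Finset.card_univ, Fintype.card_fin] at h1
  have h3 : ENNReal.ofReal (Real.exp (-(l ^ α))) =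
      ENNReal.ofReal (Real.exp (-(1 / ((n : ℝ) + 1) * l ^ α))) ^ (n + 1) := by
    rw [← ENNReal.ofReal_pow (Real.exp_pos _).le, ← Real.exp_nat_mul]
    congr 2
    push_cast
    field_simp
  rw [h3] at h1
  exact ((ENNReal.pow_right_strictMono n.succ_ne_zero).injective h1).symm

lemma lintegral_mul_exp_gridPoint (hσ : IsStableSubordinator P σ α) (n : ℕ) {l : ℝ} (hl : 0 < l) :
    ∫⁻ ω, ENNReal.ofReal (σ (gridPoint n 1) ω * Real.exp (-(l * σ (gridPoint n 1) ω))) ∂P =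
      ENNReal.ofReal (1 / ((n : ℝ) + 1) * α * l ^ (α - 1) *
        Real.exp (-(1 / ((n : ℝ) + 1) * l ^ α))) :=
  lintegral_mul_exp_of_laplace (hσ.measurable _).aemeasurable (hσ.nonneg.mono fun _ h => h _)
    (fun _ h => hσ.laplace_gridPoint n h) hl

/-- The Laplace functional of finitely many distinct increments over a grid and of the value at
time `1`. -/
lemma lintegral_exp_mul_prod_gridIncrement (hσ : IsStableSubordinator P σ α) (n : ℕ) {k : ℕ}
    (i : Fin k ↪ Fin (n + 1)) {l : ℝ} (hl : 0 < l) (m : Fin k → ℝ) (hm : ∀ j, 0 ≤ m j) :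
    ∫⁻ ω, ENNReal.ofReal (Real.exp (-(l * σ 1 ω))) *
        ∏ j, (ENNReal.ofReal (gridIncrement (fun t => σ t ω) n (i j)) *
          ENNReal.ofReal (Real.exp (-(m j * gridIncrement (fun t => σ t ω) n (i j))))) ∂P =
      (∏ j, ENNReal.ofReal (1 / ((n : ℝ) + 1) * α * (l + m j) ^ (α - 1) *
        Real.exp (-(1 / ((n : ℝ) + 1) * (l + m j) ^ α)))) *
      ENNReal.ofReal (Real.exp (-(1 / ((n : ℝ) + 1) * l ^ α))) ^ (n + 1 - k) := by
  classical
  -- The product over `i j = a` has at most one factor since `i` is injective. The `k` chosen cells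
  -- yield tilted means at `l + m j`, the other `n + 1 - k` cells plain transforms at `l`.
  set g : Fin (n + 1) → ℝ → ℝ≥0∞ := fun a x => ENNReal.ofReal (Real.exp (-(l * x))) *
    ∏ j with i j = a, (ENNReal.ofReal x * ENNReal.ofReal (Real.exp (-(m j * x)))) with hgdef
  have hg : ∀ a, Measurable (g a) := fun a => by
    refine Measurable.mul (by fun_prop) (Finset.measurable_prod _ fun j _ => by fun_prop)
  have h1 := hσ.lintegral_prod_gridIncrement n hg
  have hL : ∫⁻ ω, ENNReal.ofReal (Real.exp (-(l * σ 1 ω))) *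
        ∏ j, (ENNReal.ofReal (gridIncrement (fun t => σ t ω) n (i j)) *
          ENNReal.ofReal (Real.exp (-(m j * gridIncrement (fun t => σ t ω) n (i j))))) ∂P =
      ∫⁻ ω, ∏ a, g a (gridIncrement (fun t => σ t ω) n a) ∂P := by
    refine lintegral_congr_ae ?_
    filter_upwards [hσ.sum_gridIncrement] with ω hω
    simp only [hgdef]
    symm
    rw [Finset.prod_mul_distrib, ← ENNReal.ofReal_prod_of_nonneg fun i _ => (Real.exp_pos _).le,
      ← Real.exp_sum, Finset.sum_neg_distrib, ← Finset.mul_sum, hω]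
    congr 1
    rw [← Finset.prod_fiberwise Finset.univ i (fun j =>
      ENNReal.ofReal (gridIncrement (fun t => σ t ω) n (i j)) *
          ENNReal.ofReal (Real.exp (-(m j * gridIncrement (fun t => σ t ω) n (i j)))))]
    refine Finset.prod_congr rfl fun a _ => Finset.prod_congr rfl fun j hj => ?_
    rw [(Finset.mem_filter.1 hj).2]
  rw [hL, h1, ← Finset.prod_mul_prod_compl (Finset.univ.map i), Finset.prod_map]
  congr 1
  · refine Finset.prod_congr rfl fun j _ => ?_
    rw [← hσ.lintegral_mul_exp_gridPoint n (by have := hm j; linarith)]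
    refine lintegral_congr_ae ?_
    filter_upwards [hσ.nonneg] with ω hω
    have : (Finset.univ.filter fun j' => i j' = i j) = {j} := by
      ext j'; simp
    simp only [hgdef]
    rw [this, Finset.prod_singleton, mul_left_comm, ← ENNReal.ofReal_mul (Real.exp_pos _).le,
      ← Real.exp_add, ENNReal.ofReal_mul (hω _)]
    congr 3
    ring
  · rw [Finset.prod_congr rfl (g := fun _ => ENNReal.ofReal
      (Real.exp (-(1 / ((n : ℝ) + 1) * l ^ α)))), Finset.prod_const, Finset.card_compl,
      Finset.card_map, Finset.card_univ, Fintype.card_fin, Fintype.card_fin]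
    intro a ha
    have : (Finset.univ.filter fun j' => i j' = a) = ∅ := by
      ext j'
      simp only [Finset.mem_compl, Finset.mem_map, Finset.mem_univ, true_and, not_exists] at ha
      simpa using ha j'
    simp only [hgdef, this, Finset.prod_empty, mul_one]
    exact hσ.laplace_gridPoint n hl

end IsStableSubordinator

/-! ### The limit of vanishing mesh -/

open Classical in
/-- The Stieltjes function of a nondecreasing right-continuous path (and `0` for other paths). -/
noncomputable def pathStieltjes (p : ℝ≥0 → ℝ) : StieltjesFunction ℝ≥0 :=
  if h : Monotone p ∧ ∀ t, ContinuousWithinAt p (Set.Ici t) t then ⟨p, h.1, h.2⟩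
  else StieltjesFunction.const ℝ≥0 0

namespace IsStableSubordinator

variable {Ω : Type*} [MeasurableSpace Ω] {P : Measure Ω} {σ : ℝ≥0 → Ω → ℝ} {α : ℝ}

lemma coe_pathStieltjes (hσ : IsStableSubordinator P σ α) :
    ∀ᵐ ω ∂P, (pathStieltjes fun t => σ t ω : ℝ≥0 → ℝ) = fun t => σ t ω := by
  filter_upwards [hσ.mono, hσ.rightCont] with ω h1 h2
  rw [pathStieltjes, dif_pos ⟨h1, fun t => continuousWithinAt_Ioi_iff_Ici.1 (h2 t)⟩]

lemma tendsto_sum_gridIncrement (hσ : IsStableSubordinator P σ α) {k : ℕ} (h : Fin k → ℝ → ℝ≥0)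
    (hc : ∀ j, Continuous (h j)) (C : ℝ≥0) (hC : ∀ j x, h j x ≤ C) :
    ∀ᵐ ω ∂P, Tendsto (fun n => ∑ i : Fin k ↪ Fin (n + 1), ∏ j,
      (ENNReal.ofReal (gridIncrement (fun t => σ t ω) n (i j)) *
        h j (gridIncrement (fun t => σ t ω) n (i j)))) atTop
      (𝓝 (∫⁻ s in {s | Function.Injective s},
        ((∏ j, h j (jump (pathStieltjes fun t => σ t ω) (s j)) : ℝ≥0) : ℝ≥0∞)
        ∂Measure.pi fun _ => (pathStieltjes fun t => σ t ω).unitMeasure)) := by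
  filter_upwards [hσ.coe_pathStieltjes] with ω hω
  have := (pathStieltjes fun t => σ t ω).tendsto_sum_gridIncrement h hc C hC
  rwa [hω] at this ⊢

lemma measurable_sum_gridIncrement (hσ : IsStableSubordinator P σ α) {k : ℕ} (h : Fin k → ℝ → ℝ≥0)
    (hc : ∀ j, Continuous (h j)) (n : ℕ) :
    Measurable fun ω => ∑ i : Fin k ↪ Fin (n + 1), ∏ j,
      (ENNReal.ofReal (gridIncrement (fun t => σ t ω) n (i j)) *
        (h j (gridIncrement (fun t => σ t ω) n (i j)) : ℝ≥0∞)) := by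
  refine Finset.measurable_sum _ fun i _ => Finset.measurable_prod _ fun j _ => ?_
  have := hσ.measurable_gridIncrement n (i j)
  exact this.ennreal_ofReal.mul ((hc j).measurable.comp this).coe_nnreal_ennreal

/-- The integrating measure depends on `ω`; measurability is inherited from the grid sums that
converge almost surely. -/
lemma aemeasurable_lintegral_injective (hσ : IsStableSubordinator P σ α) {k : ℕ}
    (h : Fin k → ℝ → ℝ≥0) (hc : ∀ j, Continuous (h j)) (C : ℝ≥0) (hC : ∀ j x, h j x ≤ C) :
    AEMeasurable (fun ω => ∫⁻ s in {s | Function.Injective s},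
        ((∏ j, h j (jump (pathStieltjes fun t => σ t ω) (s j)) : ℝ≥0) : ℝ≥0∞)
        ∂Measure.pi fun _ => (pathStieltjes fun t => σ t ω).unitMeasure) P :=
  aemeasurable_of_tendsto_metrizable_ae' (fun n => (hσ.measurable_sum_gridIncrement h hc n).aemeasurable)
    (hσ.tendsto_sum_gridIncrement h hc C hC)

/-- Tuples of distinct cells are among all tuples, and over all tuples the product of increments
sums to the `k`-th power of `σ 1`. -/
lemma sum_prod_gridIncrement_le (hσ : IsStableSubordinator P σ α) {k : ℕ} (h : Fin k → ℝ → ℝ≥0)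
    (hC : ∀ j x, h j x ≤ 1) :
    ∀ᵐ ω ∂P, ∀ n, ∑ i : Fin k ↪ Fin (n + 1), ∏ j,
      (ENNReal.ofReal (gridIncrement (fun t => σ t ω) n (i j)) *
        (h j (gridIncrement (fun t => σ t ω) n (i j)) : ℝ≥0∞)) ≤ ENNReal.ofReal (σ 1 ω) ^ k := by
  classical
  filter_upwards [hσ.sum_gridIncrement, hσ.gridIncrement_nonneg] with ω h1 h2 n
  rw [← h1 n, ENNReal.ofReal_sum_of_nonneg (fun (i : Fin (n + 1)) _ => h2 n i), Fintype.sum_pow]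
  calc _ ≤ ∑ i : Fin k ↪ Fin (n + 1), ∏ j,
        ENNReal.ofReal (gridIncrement (fun t => σ t ω) n (i j)) :=
        Finset.sum_le_sum fun i _ => Finset.prod_le_prod' fun j _ =>
          mul_le_of_le_one_right' (by exact_mod_cast hC j _)
    _ ≤ _ := by
        exact (Finset.sum_map Finset.univ ⟨fun i : Fin k ↪ Fin (n + 1) =>
          (i : Fin k → Fin (n + 1)), DFunLike.coe_injective⟩ (fun a : Fin k → Fin (n + 1) =>
            ∏ j, ENNReal.ofReal (gridIncrement (fun t => σ t ω) n (a j)))).symm.trans_le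
          (Finset.sum_le_sum_of_subset (Finset.subset_univ _))

/-- The dominating constant for the tilted grid sums; it comes from `y ^ k / k! ≤ exp y` at `y = l
x`. -/
lemma ofReal_exp_mul_pow_le {l x : ℝ} (hl : 0 < l) (hx : 0 ≤ x) (k : ℕ) :
    ENNReal.ofReal (Real.exp (-(l * x))) * ENNReal.ofReal x ^ k ≤
      ENNReal.ofReal (k.factorial / l ^ k) := by
  rw [← ENNReal.ofReal_pow hx, ← ENNReal.ofReal_mul (Real.exp_pos _).le]
  refine ENNReal.ofReal_le_ofReal ?_
  have := Real.pow_div_factorial_le_exp (l * x) (by positivity) k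
  rw [div_le_iff₀ (by positivity), mul_pow] at this
  rw [Real.exp_neg, le_div_iff₀ (by positivity), mul_assoc, inv_mul_le_iff₀ (Real.exp_pos _)]
  linarith

/-- The number of tuples of distinct cells is equivalent to `(n + 1) ^ k`, which cancels the factors
`1 / (n + 1)` of the `k` tilted means. Their exponentials tend to `1`, while those of the other
cells multiply to `exp (-l ^ α)` in the limit. -/
lemma tendsto_laplace_const (hα0 : 0 < α) {k : ℕ} (l : ℝ) (hl : 0 < l) (m : Fin k → ℝ)
    (hm : ∀ j, 0 ≤ m j) :
    Tendsto (fun n : ℕ => (((n + 1).descFactorial k : ℕ) : ℝ≥0∞) *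
      ((∏ j, ENNReal.ofReal (1 / ((n : ℝ) + 1) * α * (l + m j) ^ (α - 1) *
        Real.exp (-(1 / ((n : ℝ) + 1) * (l + m j) ^ α)))) *
      ENNReal.ofReal (Real.exp (-(1 / ((n : ℝ) + 1) * l ^ α))) ^ (n + 1 - k))) atTop
      (𝓝 ((∏ j, ENNReal.ofReal (α * (l + m j) ^ (α - 1))) * ENNReal.ofReal (Real.exp (-(l ^ α))))) := by
  have hpos : ∀ j, 0 < l + m j := fun j => by have := hm j; linarith
  have hreal : Tendsto (fun n : ℕ => (((n + 1).descFactorial k : ℝ) / ((n : ℝ) + 1) ^ k) *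
      (∏ j, (α * (l + m j) ^ (α - 1) * Real.exp (-(1 / ((n : ℝ) + 1) * (l + m j) ^ α)))) *
      Real.exp (-(((n + 1 - k : ℕ) : ℝ) / ((n : ℝ) + 1) * l ^ α))) atTop
      (𝓝 (1 * (∏ j, (α * (l + m j) ^ (α - 1) * Real.exp (-(0 * (l + m j) ^ α)))) *
        Real.exp (-(1 * l ^ α)))) := by
    have h0 : Tendsto (fun n : ℕ => 1 / ((n : ℝ) + 1)) atTop (𝓝 0) :=
      tendsto_one_div_add_atTop_nhds_zero_nat
    have h1 : Tendsto (fun n : ℕ => ((n + 1).descFactorial k : ℝ) / ((n : ℝ) + 1) ^ k) atTop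
        (𝓝 1) := by
      have h2 := (Asymptotics.isEquivalent_iff_tendsto_one ?_).1 (isEquivalent_descFactorial k)
      · have := h2.comp (tendsto_add_atTop_nat 1)
        refine this.congr fun n => ?_
        simp
      · filter_upwards [eventually_gt_atTop 0] with n hn
        positivity
    refine (h1.mul (tendsto_finsetProd _ fun j _ => ?_)).mul ?_
    · exact ((h0.mul_const _).neg.rexp).const_mul _
    · refine ((Tendsto.mul_const _ ?_).neg).rexp
      have h3 : Tendsto (fun n : ℕ => 1 - (k : ℝ) * (1 / ((n : ℝ) + 1))) atTop (𝓝 1) := by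
        simpa using (h0.const_mul (k : ℝ)).const_sub 1
      refine h3.congr' ?_
      filter_upwards [eventually_ge_atTop k] with n hn
      rw [Nat.cast_sub (by omega)]
      push_cast
      field_simp
  have h4 := ENNReal.tendsto_ofReal hreal
  have e1 : ENNReal.ofReal (1 * (∏ j, (α * (l + m j) ^ (α - 1) *
      Real.exp (-(0 * (l + m j) ^ α)))) * Real.exp (-(1 * l ^ α))) =
      (∏ j, ENNReal.ofReal (α * (l + m j) ^ (α - 1))) * ENNReal.ofReal (Real.exp (-(l ^ α))) := by
    rw [← ENNReal.ofReal_prod_of_nonneg fun j _ => by have := hpos j; positivity,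
      ← ENNReal.ofReal_mul (Finset.prod_nonneg fun j _ => by have := hpos j; positivity)]
    simp
  rw [e1] at h4
  refine h4.congr fun n => ?_
  rw [← ENNReal.ofReal_prod_of_nonneg fun j _ => by have := hpos j; positivity,
    ← ENNReal.ofReal_pow (by positivity), ← ENNReal.ofReal_natCast,
    ← ENNReal.ofReal_mul (Finset.prod_nonneg fun j _ => by have := hpos j; positivity),
    ← ENNReal.ofReal_mul (by positivity)]
  congr 1
  rw [← Real.exp_nat_mul, ← mul_assoc]
  congr 1
  · simp_rw [mul_assoc (1 / ((n : ℝ) + 1))]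
    rw [Finset.prod_mul_distrib (f := fun _ => 1 / ((n : ℝ) + 1)), Finset.prod_const, Finset.card_univ, Fintype.card_fin]
    rw [one_div, inv_pow, ← mul_assoc, div_eq_mul_inv]
  · congr 1
    ring

variable [IsProbabilityMeasure P]

/-- The Laplace functional of distinct jumps of a stable subordinator and of its value at time
`1`. -/
theorem lintegral_exp_mul_injective (hσ : IsStableSubordinator P σ α) (hα0 : 0 < α) {k : ℕ}
    {l : ℝ} (hl : 0 < l) (m : Fin k → ℝ) (hm : ∀ j, 0 ≤ m j) :
    ∫⁻ ω, ENNReal.ofReal (Real.exp (-(l * σ 1 ω))) *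
      ∫⁻ s in {s | Function.Injective s},
        ∏ j, ENNReal.ofReal (Real.exp (-(m j * jump (pathStieltjes fun t => σ t ω) (s j))))
        ∂Measure.pi (fun _ => (pathStieltjes fun t => σ t ω).unitMeasure) ∂P =
      (∏ j, ENNReal.ofReal (α * (l + m j) ^ (α - 1))) * ENNReal.ofReal (Real.exp (-(l ^ α))) := by
  -- The truncation `max x 0` makes `h j` bounded by `1` on all of `ℝ` without changing it on
  -- increments and jumps.
  set h : Fin k → ℝ → ℝ≥0 := fun j x => Real.toNNReal (Real.exp (-(m j * max x 0))) with hh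
  have hc : ∀ j, Continuous (h j) := fun j => by simp only [hh]; fun_prop
  have hC : ∀ j x, h j x ≤ 1 := fun j x => by
    simp only [hh]
    rw [← Real.toNNReal_one]
    refine Real.toNNReal_le_toNNReal (Real.exp_le_one_iff.2 ?_)
    have := mul_nonneg (hm j) (le_max_right x 0)
    linarith
  have hval : ∀ j x, 0 ≤ x → (h j x : ℝ≥0∞) = ENNReal.ofReal (Real.exp (-(m j * x))) :=
    fun j x hx => by simp only [hh]; rw [max_eq_left hx]; rfl
  have hlim := hσ.tendsto_sum_gridIncrement h hc 1 hC
  have hconv : Tendsto (fun n => ∫⁻ ω, ENNReal.ofReal (Real.exp (-(l * σ 1 ω))) *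
      ∑ i : Fin k ↪ Fin (n + 1), ∏ j,
      (ENNReal.ofReal (gridIncrement (fun t => σ t ω) n (i j)) *
        (h j (gridIncrement (fun t => σ t ω) n (i j)) : ℝ≥0∞)) ∂P) atTop
      (𝓝 (∫⁻ ω, ENNReal.ofReal (Real.exp (-(l * σ 1 ω))) * ∫⁻ s in {s | Function.Injective s},
        ((∏ j, h j (jump (pathStieltjes fun t => σ t ω) (s j)) : ℝ≥0) : ℝ≥0∞)
        ∂Measure.pi (fun _ => (pathStieltjes fun t => σ t ω).unitMeasure) ∂P)) := by
    refine tendsto_lintegral_of_dominated_convergence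
      (fun _ => ENNReal.ofReal (k.factorial / l ^ k)) (fun n => ?_) (fun n => ?_) ?_ ?_
    · have := hσ.measurable 1
      exact Measurable.mul (by fun_prop) (hσ.measurable_sum_gridIncrement h hc n)
    · filter_upwards [hσ.sum_prod_gridIncrement_le h hC, hσ.nonneg] with ω h1 h2
      exact (mul_le_mul_right (h1 n) _).trans (ofReal_exp_mul_pow_le hl (h2 1) k)
    · simp
    · filter_upwards [hlim] with ω hω
      exact ENNReal.Tendsto.const_mul hω (Or.inr ENNReal.ofReal_ne_top)
  have hL : ∀ n, ∫⁻ ω, ENNReal.ofReal (Real.exp (-(l * σ 1 ω))) *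
      ∑ i : Fin k ↪ Fin (n + 1), ∏ j,
      (ENNReal.ofReal (gridIncrement (fun t => σ t ω) n (i j)) *
        (h j (gridIncrement (fun t => σ t ω) n (i j)) : ℝ≥0∞)) ∂P =
      (((n + 1).descFactorial k : ℕ) : ℝ≥0∞) *
      ((∏ j, ENNReal.ofReal (1 / ((n : ℝ) + 1) * α * (l + m j) ^ (α - 1) *
        Real.exp (-(1 / ((n : ℝ) + 1) * (l + m j) ^ α)))) *
      ENNReal.ofReal (Real.exp (-(1 / ((n : ℝ) + 1) * l ^ α))) ^ (n + 1 - k)) := by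
    intro n
    simp_rw [Finset.mul_sum]
    rw [lintegral_finsetSum]
    · rw [Finset.sum_congr rfl (g := fun _ => (∏ j, ENNReal.ofReal (1 / ((n : ℝ) + 1) * α *
        (l + m j) ^ (α - 1) * Real.exp (-(1 / ((n : ℝ) + 1) * (l + m j) ^ α)))) *
        ENNReal.ofReal (Real.exp (-(1 / ((n : ℝ) + 1) * l ^ α))) ^ (n + 1 - k)),
        Finset.sum_const, Finset.card_univ, Fintype.card_embedding_eq, Fintype.card_fin,
        Fintype.card_fin, nsmul_eq_mul]
      intro i _
      rw [← hσ.lintegral_exp_mul_prod_gridIncrement n i hl m hm]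
      refine lintegral_congr_ae ?_
      filter_upwards [hσ.gridIncrement_nonneg] with ω hω
      simp_rw [hval _ _ (hω n _)]
    · intro i _
      have := hσ.measurable 1
      refine Measurable.mul (by fun_prop) (Finset.measurable_prod _ fun j _ => ?_)
      have := hσ.measurable_gridIncrement n (i j)
      exact this.ennreal_ofReal.mul ((hc j).measurable.comp this).coe_nnreal_ennreal
  simp_rw [hL] at hconv
  rw [← tendsto_nhds_unique hconv (tendsto_laplace_const hα0 l hl m hm)]
  refine lintegral_congr fun ω => ?_
  congr 1
  refine lintegral_congr fun s => ?_
  rw [ENNReal.ofNNReal_finsetProd]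
  exact Finset.prod_congr rfl fun j _ => (hval j _ (StieltjesFunction.jump_nonneg _ _)).symm

end IsStableSubordinator

/-! ### Measurability of ranked jumps and absence of a continuous part -/

namespace IsStableSubordinator

variable {Ω : Type*} [MeasurableSpace Ω] {P : Measure Ω} {σ : ℝ≥0 → Ω → ℝ} {α : ℝ}

lemma setLIntegral_injective_fin_one (m : Measure ℝ≥0) [IsFiniteMeasure m] {g : ℝ≥0 → ℝ≥0∞}
    (hg : Measurable g) :
    ∫⁻ s in {s : Fin 1 → ℝ≥0 | Function.Injective s}, g (s 0) ∂Measure.pi (fun _ => m) =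
      ∫⁻ t, g t ∂m := by
  have : {s : Fin 1 → ℝ≥0 | Function.Injective s} = Set.univ := by
    ext s; simpa using Function.injective_of_subsingleton s
  rw [this, Measure.restrict_univ]
  have hmp := measurePreserving_piUnique (fun _ : Fin 1 => m)
  exact hmp.lintegral_comp hg

lemma aemeasurable_lintegral_jump (hσ : IsStableSubordinator P σ α) (h : ℝ → ℝ≥0)
    (hc : Continuous h) (C : ℝ≥0) (hC : ∀ x, h x ≤ C) :
    AEMeasurable (fun ω => ∫⁻ t, (h (jump (pathStieltjes fun t => σ t ω) t) : ℝ≥0∞)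
      ∂(pathStieltjes fun t => σ t ω).unitMeasure) P := by
  have := hσ.aemeasurable_lintegral_injective (k := 1) (fun _ => h) (fun _ => hc) C (fun _ => hC)
  refine this.congr (.of_forall fun ω => ?_)
  simp only [Finset.univ_unique, Finset.prod_singleton]
  exact setLIntegral_injective_fin_one _
    (hc.measurable.comp (StieltjesFunction.measurable_jump _)).coe_nnreal_ennreal

lemma aemeasurable_encard_jump (hσ : IsStableSubordinator P σ α) {x : ℝ} (hx : 0 < x) :
    AEMeasurable (fun ω => ((Set.encard {t : ℝ≥0 | t ≤ 1 ∧
      x ≤ jump (pathStieltjes fun t => σ t ω) t} : ℕ∞) : ℝ≥0∞)) P := by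
  -- For `N > 0` this is a ramp rising from `0` at `x - 1 / N` to `1` at `x`, times an inverse kept
  -- bounded by `max y (x / 2)`. It tends to `y⁻¹` for `x ≤ y` and to `0` otherwise.
  set h : ℕ → ℝ → ℝ≥0 := fun N y => Real.toNNReal (min 1 (max 0 (1 + N * (y - x))) * (max y (x / 2))⁻¹)
    with hh
  have hmax : ∀ y : ℝ, 0 < max y (x / 2) := fun y => lt_max_of_lt_right (by positivity)
  have hc : ∀ N, Continuous (h N) := fun N => by
    simp only [hh]
    refine continuous_real_toNNReal.comp (Continuous.mul (by fun_prop) ?_)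
    exact Continuous.inv₀ (by fun_prop) fun y => (hmax y).ne'
  have hC : ∀ N y, h N y ≤ Real.toNNReal (x / 2)⁻¹ := fun N y => by
    simp only [hh]
    refine Real.toNNReal_le_toNNReal ?_
    calc _ ≤ 1 * (max y (x / 2))⁻¹ := by
          have := inv_pos.2 (hmax y)
          gcongr; exact min_le_left _ _
      _ ≤ _ := by rw [one_mul]; gcongr; exact le_max_right _ _
  have hlim : ∀ y, Tendsto (fun N => h N y) atTop
      (𝓝 (Real.toNNReal ({y : ℝ | x ≤ y}.indicator (fun y => y⁻¹) y))) := fun y => by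
    refine (continuous_real_toNNReal.tendsto _).comp ?_
    by_cases hy : x ≤ y
    · rw [Set.indicator_of_mem (by exact hy)]
      refine tendsto_const_nhds.congr fun N => ?_
      have h1 : (0 : ℝ) ≤ N * (y - x) := mul_nonneg (Nat.cast_nonneg _) (sub_nonneg.2 hy)
      rw [max_eq_right (by linarith), min_eq_left (by linarith), one_mul, max_eq_left (by linarith)]
    · rw [Set.indicator_of_notMem (by exact hy)]
      push Not at hy
      obtain ⟨N0, hN0⟩ := exists_nat_gt (1 / (x - y))
      refine tendsto_const_nhds.congr' ?_
      filter_upwards [eventually_ge_atTop N0] with N hN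
      have h2 : 1 < (N : ℝ) * (x - y) := by
        rw [div_lt_iff₀ (by linarith)] at hN0
        exact hN0.trans_le (mul_le_mul_of_nonneg_right (by exact_mod_cast hN) (by linarith))
      rw [max_eq_left (by nlinarith), min_eq_right zero_le_one, zero_mul]
  refine aemeasurable_of_tendsto_metrizable_ae' (fun N => hσ.aemeasurable_lintegral_jump (h N)
    (hc N) _ (hC N)) (.of_forall fun ω => ?_)
  rw [StieltjesFunction.encard_eq_lintegral _ hx]
  refine tendsto_lintegral_of_dominated_convergence (fun _ => (Real.toNNReal (x / 2)⁻¹ : ℝ≥0∞))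
    (fun N => ((hc N).measurable.comp (StieltjesFunction.measurable_jump _)).coe_nnreal_ennreal)
    (fun N => .of_forall fun t => ENNReal.coe_le_coe.2 (hC N _)) ?_ (.of_forall fun t => ?_)
  · rw [lintegral_const]
    exact ENNReal.mul_ne_top ENNReal.coe_ne_top (measure_ne_top _ _)
  · have := ENNReal.tendsto_coe.2 (hlim (jump (pathStieltjes fun t => σ t ω) t))
    convert this using 2
    by_cases hy : x ≤ jump (pathStieltjes fun t => σ t ω) t
    · rw [Set.indicator_of_mem (by exact hy), Set.indicator_of_mem (by exact hy)]; rfl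
    · rw [Set.indicator_of_notMem (by exact hy), Set.indicator_of_notMem (by exact hy)]; simp

/-- The ranked jumps of a stable subordinator are random variables. -/
theorem aemeasurable_rankedJump (hσ : IsStableSubordinator P σ α) (n : ℕ) :
    AEMeasurable (fun ω => rankedJump (fun t => σ t ω) n) P := by
  have h : AEMeasurable (fun ω => rankedJump (pathStieltjes fun t => σ t ω) n) P := by
    refine NullMeasurable.aemeasurable ?_
    refine measurable_of_Ici (δ := NullMeasurableSpace Ω P) fun x => ?_
    rcases le_or_gt x 0 with hx | hx
    · convert MeasurableSet.univ
      exact Set.eq_univ_of_forall fun ω => hx.trans (StieltjesFunction.rankedJump_nonneg _ n)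
    · have : (fun ω => rankedJump (pathStieltjes fun t => σ t ω) n) ⁻¹' Set.Ici x =
        (fun ω => ((Set.encard {t : ℝ≥0 | t ≤ 1 ∧
          x ≤ jump (pathStieltjes fun t => σ t ω) t} : ℕ∞) : ℝ≥0∞)) ⁻¹'
          Set.Ici (((n + 1 : ℕ) : ℕ∞) : ℝ≥0∞) := by
        ext ω
        simp only [Set.mem_preimage, Set.mem_Ici, StieltjesFunction.le_rankedJump_iff _ hx,
          ENat.toENNReal_le]
      have h1 : NullMeasurableSet ((fun ω => rankedJump (pathStieltjes fun t => σ t ω) n) ⁻¹'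
          Set.Ici x) P := by
        rw [this]
        exact (hσ.aemeasurable_encard_jump hx).nullMeasurable measurableSet_Ici
      exact h1
  refine h.congr ?_
  filter_upwards [hσ.coe_pathStieltjes] with ω hω
  rw [hω]

variable [IsProbabilityMeasure P]

/-- A stable subordinator has no continuous part. -/
theorem unitMeasure_jump_eq_zero (hσ : IsStableSubordinator P σ α) (hα0 : 0 < α) (hα1 : α < 1) :
    ∀ᵐ ω ∂P, (pathStieltjes fun t => σ t ω).unitMeasure
      {t | jump (pathStieltjes fun t => σ t ω) t = 0} = 0 := by
  -- As `N` grows, the exponential kills all jumps but leaves the mass carried by continuity points,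
  -- so `⨅ N, Z N` bounds that mass up to `exp (-σ 1)`. The mean of `Z N` is a multiple of `(1 + N)
  -- ^ (α - 1)` and vanishes because `α < 1`.
  set Z : ℕ → Ω → ℝ≥0∞ := fun N ω => ENNReal.ofReal (Real.exp (-(1 * σ 1 ω))) *
      ∫⁻ t, ENNReal.ofReal (Real.exp (-((N : ℝ) * jump (pathStieltjes fun t => σ t ω) t)))
        ∂(pathStieltjes fun t => σ t ω).unitMeasure with hZ
  have hZint : ∀ N, ∫⁻ ω, Z N ω ∂P =
      ENNReal.ofReal (α * (1 + (N : ℝ)) ^ (α - 1)) * ENNReal.ofReal (Real.exp (-((1 : ℝ) ^ α))) := by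
    intro N
    have := hσ.lintegral_exp_mul_injective hα0 (k := 1) one_pos (fun _ => (N : ℝ))
      (fun _ => Nat.cast_nonneg _)
    simp only [Finset.univ_unique, Finset.prod_singleton] at this
    rw [← this]
    refine lintegral_congr fun ω => ?_
    simp only [hZ]
    congr 1
    refine (setLIntegral_injective_fin_one _ (g := fun t => ENNReal.ofReal (Real.exp
      (-((N : ℝ) * jump (pathStieltjes fun t => σ t ω) t)))) ?_).symm
    have := StieltjesFunction.measurable_jump (pathStieltjes fun t => σ t ω)
    fun_prop
  have hZm : ∀ N, AEMeasurable (Z N) P := by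
    intro N
    have h1 := hσ.aemeasurable_lintegral_jump
      (fun x => Real.toNNReal (Real.exp (-((N : ℝ) * max x 0)))) (by fun_prop) 1 (fun x => by
        rw [← Real.toNNReal_one]
        refine Real.toNNReal_le_toNNReal (Real.exp_le_one_iff.2 ?_)
        have := mul_nonneg (Nat.cast_nonneg (α := ℝ) N) (le_max_right x 0)
        linarith)
    have h2 := hσ.measurable 1
    refine AEMeasurable.mul (by fun_prop) (h1.congr (.of_forall fun ω => ?_))
    refine lintegral_congr fun t => ?_
    rw [max_eq_left (StieltjesFunction.jump_nonneg _ _)]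
    rfl
  have hinf : ∫⁻ ω, ⨅ N, Z N ω ∂P = 0 := by
    have hle : ∀ N : ℕ, ∫⁻ ω, ⨅ N, Z N ω ∂P ≤ ENNReal.ofReal (α * (1 + (N : ℝ)) ^ (α - 1)) *
        ENNReal.ofReal (Real.exp (-((1 : ℝ) ^ α))) := fun N =>
      (lintegral_mono fun ω => iInf_le _ N).trans (hZint N).le
    have hlim : Tendsto (fun N : ℕ => ENNReal.ofReal (α * (1 + (N : ℝ)) ^ (α - 1)) *
        ENNReal.ofReal (Real.exp (-((1 : ℝ) ^ α)))) atTop (𝓝 0) := by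
      have h1 : Tendsto (fun N : ℕ => (1 + (N : ℝ)) ^ (α - 1)) atTop (𝓝 0) := by
        have h2 := tendsto_rpow_neg_atTop (show 0 < 1 - α by linarith)
        rw [neg_sub] at h2
        exact h2.comp (tendsto_atTop_add_const_left _ _ tendsto_natCast_atTop_atTop)
      have h3 := ENNReal.tendsto_ofReal (h1.const_mul α)
      have h4 := ENNReal.Tendsto.mul_const (b := ENNReal.ofReal (Real.exp (-((1 : ℝ) ^ α)))) h3
        (Or.inr ENNReal.ofReal_ne_top)
      simpa using h4
    exact le_antisymm (ge_of_tendsto' hlim hle) zero_le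
  rw [lintegral_eq_zero_iff' (AEMeasurable.iInf hZm)] at hinf
  filter_upwards [hinf] with ω hω
  have hle : ENNReal.ofReal (Real.exp (-(1 * σ 1 ω))) * (pathStieltjes fun t => σ t ω).unitMeasure
      {t | jump (pathStieltjes fun t => σ t ω) t = 0} ≤ 0 := by
    rw [Pi.zero_apply] at hω
    rw [← hω]
    refine le_iInf fun N => mul_le_mul_right ?_ _
    have hm : MeasurableSet {t | jump (pathStieltjes fun t => σ t ω) t = 0} :=
      StieltjesFunction.measurable_jump _ (measurableSet_singleton (0 : ℝ))
    rw [← lintegral_indicator_one hm]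
    refine lintegral_mono fun t => ?_
    rw [Set.indicator_apply]
    split_ifs with ht
    · have ht : jump (pathStieltjes fun t => σ t ω) t = 0 := ht
      simp [ht]
    · exact zero_le
  simpa [(Real.exp_pos _).not_ge] using hle

/-- The Laplace functional of distinct ranked jumps of a stable subordinator and of its value at
time `1`. -/
theorem lintegral_exp_mul_tsum (hσ : IsStableSubordinator P σ α) (hα0 : 0 < α) (hα1 : α < 1) {k : ℕ}
    {l : ℝ} (hl : 0 < l) (m : Fin k → ℝ) (hm : ∀ j, 0 ≤ m j) :
    ∫⁻ ω, ENNReal.ofReal (Real.exp (-(l * σ 1 ω))) * ∑' i : Fin k ↪ ℕ,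
      (∏ j, ENNReal.ofReal (rankedJump (fun t => σ t ω) (i j))) *
        ∏ j, ENNReal.ofReal (Real.exp (-(m j * rankedJump (fun t => σ t ω) (i j)))) ∂P =
      (∏ j, ENNReal.ofReal (α * (l + m j) ^ (α - 1))) * ENNReal.ofReal (Real.exp (-(l ^ α))) := by
  rw [← hσ.lintegral_exp_mul_injective hα0 hl m hm]
  refine lintegral_congr_ae ?_
  filter_upwards [hσ.unitMeasure_jump_eq_zero hα0 hα1, hσ.coe_pathStieltjes] with ω h1 h2
  rw [StieltjesFunction.lintegral_injective_eq_tsum _ h1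
    (fun x => ∏ j, ENNReal.ofReal (Real.exp (-(m j * x j)))), h2]

/-- The ranked jumps of a stable subordinator on `[0, 1]` sum up to its value at time `1`. -/
theorem tsum_rankedJump (hσ : IsStableSubordinator P σ α) (hα0 : 0 < α) (hα1 : α < 1) :
    ∀ᵐ ω ∂P, ∑' n, ENNReal.ofReal (rankedJump (fun t => σ t ω) n) = ENNReal.ofReal (σ 1 ω) := by
  filter_upwards [hσ.unitMeasure_jump_eq_zero hα0 hα1, hσ.coe_pathStieltjes, hσ.zero]
    with ω h1 h2 h3
  -- For `k = 1` and the constant `1`, the integral is the total Stieltjes mass and the sum is that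
  -- of all ranked jumps.
  have h4 := StieltjesFunction.lintegral_injective_eq_tsum _ h1 (k := 1) (fun _ => 1)
  have h5 := setLIntegral_injective_fin_one (pathStieltjes fun t => σ t ω).unitMeasure
    (g := fun _ => 1) measurable_const
  rw [h5] at h4
  have h6 : (pathStieltjes fun t => σ t ω).unitMeasure Set.univ = ENNReal.ofReal (σ 1 ω) := by
    rw [StieltjesFunction.unitMeasure, Measure.restrict_apply_univ, StieltjesFunction.measure_Ioc,
      h2]
    simp only [h3, sub_zero]
  rw [lintegral_one, h6, h2] at h4
  rw [h4, ← (Equiv.uniqueEmbeddingEquivResult : (Fin 1 ↪ ℕ) ≃ ℕ).tsum_eq]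
  refine tsum_congr fun i => ?_
  simp
  rfl

end IsStableSubordinator

/-! ### Uniqueness for Laplace transforms on the orthant -/

/-- The exponential `(x, u) ↦ exp (-(a u + ∑ n_j x_j))` on the nonnegative orthant. -/
noncomputable def expOrthant {k : ℕ} (n : (Fin k → ℕ) × ℕ) : ((Fin k → ℝ≥0) × ℝ≥0) →ᵇ ℝ :=
  BoundedContinuousFunction.ofNormedAddCommGroup
    (fun z => Real.exp (-(n.2 * (z.2 : ℝ) + ∑ j, n.1 j * (z.1 j : ℝ)))) (by fun_prop) 1 (fun z => by
      rw [Real.norm_eq_abs, abs_of_pos (Real.exp_pos _), Real.exp_le_one_iff]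
      have : 0 ≤ ∑ j, (n.1 j : ℝ) * (z.1 j : ℝ) := Finset.sum_nonneg fun j _ => by positivity
      have : 0 ≤ (n.2 : ℝ) * (z.2 : ℝ) := by positivity
      linarith)

lemma expOrthant_apply {k : ℕ} (n : (Fin k → ℕ) × ℕ) (z : (Fin k → ℝ≥0) × ℝ≥0) :
    expOrthant n z = Real.exp (-(n.2 * (z.2 : ℝ) + ∑ j, n.1 j * (z.1 j : ℝ))) := rfl

lemma expOrthant_mul {k : ℕ} (n m : (Fin k → ℕ) × ℕ) :
    expOrthant n * expOrthant m = expOrthant (n + m) := by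
  ext z
  simp only [BoundedContinuousFunction.mul_apply, expOrthant_apply, ← Real.exp_add]
  congr 1
  simp only [Prod.snd_add, Prod.fst_add, Pi.add_apply, Nat.cast_add, add_mul, Finset.sum_add_distrib]
  ring

lemma expOrthant_zero {k : ℕ} : expOrthant (0 : (Fin k → ℕ) × ℕ) = 1 := by
  ext z; simp [expOrthant_apply]

/-- The algebra generated by exponentials on the nonnegative orthant. -/
noncomputable def expOrthantAlgebra (k : ℕ) :
    StarSubalgebra ℝ (((Fin k → ℝ≥0) × ℝ≥0) →ᵇ ℝ) :=
  { Algebra.adjoin ℝ (Set.range (expOrthant (k := k))) with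
    star_mem' := fun {a} ha => by
      have : star a = a := by ext z; simp
      rw [this]; exact ha }

/-- Products of exponentials are exponentials, so the generated algebra is just their linear span.
-/
lemma integral_eq_of_mem_expOrthantAlgebra {k : ℕ} {μ ν : Measure ((Fin k → ℝ≥0) × ℝ≥0)}
    [IsFiniteMeasure μ] [IsFiniteMeasure ν]
    (h : ∀ n, ∫ z, expOrthant n z ∂μ = ∫ z, expOrthant n z ∂ν) :
    ∀ g ∈ expOrthantAlgebra k, ∫ z, g z ∂μ = ∫ z, g z ∂ν := by
  intro g hg
  replace hg : g ∈ Algebra.adjoin ℝ (Set.range (expOrthant (k := k))) := hg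
  let M : Submonoid (((Fin k → ℝ≥0) × ℝ≥0) →ᵇ ℝ) :=
    { carrier := Set.range expOrthant
      mul_mem' := by
        rintro _ _ ⟨n, rfl⟩ ⟨m, rfl⟩
        exact ⟨n + m, (expOrthant_mul n m).symm⟩
      one_mem' := ⟨0, expOrthant_zero⟩ }
  have hM : (Set.range (expOrthant (k := k))) = M := rfl
  rw [hM, ← Subalgebra.mem_toSubmodule, Algebra.adjoin_eq_span, Submonoid.closure_eq] at hg
  induction hg using Submodule.span_induction with
  | mem x hx => obtain ⟨n, rfl⟩ := hx; exact h n
  | zero => simp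
  | add x y _ _ hx hy =>
    simp only [BoundedContinuousFunction.add_apply]
    rw [integral_add (x.integrable μ) (y.integrable μ), integral_add (x.integrable ν)
      (y.integrable ν), hx, hy]
  | smul a x _ hx =>
    simp only [BoundedContinuousFunction.smul_apply]
    rw [integral_smul, integral_smul, hx]

/-- A point-separating algebra of bounded continuous functions determines finite measures on a
Polish space; exponentials of a single coordinate already separate points. -/
lemma ext_of_expOrthant {k : ℕ} {μ ν : Measure ((Fin k → ℝ≥0) × ℝ≥0)}
    [IsFiniteMeasure μ] [IsFiniteMeasure ν]
    (h : ∀ n, ∫ z, expOrthant n z ∂μ = ∫ z, expOrthant n z ∂ν) : μ = ν := by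
  refine ext_of_forall_mem_subalgebra_integral_eq_of_polish (𝕜 := ℝ) (A := expOrthantAlgebra k) ?_
    (integral_eq_of_mem_expOrthantAlgebra h)
  intro x y hxy
  have hmem : ∀ n, expOrthant n ∈ expOrthantAlgebra k := fun n =>
    Algebra.subset_adjoin ⟨n, rfl⟩
  by_contra hcon
  have key : ∀ n, expOrthant n x = expOrthant n y := fun n => by
    by_contra hne
    exact hcon ⟨expOrthant n, ⟨_, ⟨expOrthant n, hmem n, rfl⟩, rfl⟩, hne⟩
  refine hxy (Prod.ext (funext fun j => ?_) ?_)
  · have := key (Pi.single j 1, 0)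
    simpa [expOrthant_apply, Pi.single_apply] using this
  · have := key (0, 1)
    simpa [expOrthant_apply] using this

/-- Finite measures on the nonnegative orthant are determined by their Laplace transforms at
integer points. -/
theorem ext_of_laplace {k : ℕ} {μ ν : Measure ((Fin k → ℝ) × ℝ)} [IsFiniteMeasure μ]
    [IsFiniteMeasure ν] (hμ : ∀ᵐ z ∂μ, (∀ j, 0 ≤ z.1 j) ∧ 0 ≤ z.2)
    (hν : ∀ᵐ z ∂ν, (∀ j, 0 ≤ z.1 j) ∧ 0 ≤ z.2)
    (h : ∀ (n : Fin k → ℕ) (a : ℕ),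
      ∫⁻ z, ENNReal.ofReal (Real.exp (-(a * z.2 + ∑ j, n j * z.1 j))) ∂μ =
      ∫⁻ z, ENNReal.ofReal (Real.exp (-(a * z.2 + ∑ j, n j * z.1 j))) ∂ν) : μ = ν := by
  -- The exponentials are bounded only on the orthant, so the measures are transported there by
  -- truncation at zero, which changes nothing almost everywhere.
  let T : (Fin k → ℝ) × ℝ → (Fin k → ℝ≥0) × ℝ≥0 := fun z => (fun j => (z.1 j).toNNReal, z.2.toNNReal)
  let S : (Fin k → ℝ≥0) × ℝ≥0 → (Fin k → ℝ) × ℝ := fun z => (fun j => (z.1 j : ℝ), (z.2 : ℝ))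
  have hT : Measurable T := by fun_prop
  have hS : Measurable S := by fun_prop
  have hST : ∀ z : (Fin k → ℝ) × ℝ, (∀ j, 0 ≤ z.1 j) ∧ 0 ≤ z.2 → S (T z) = z := fun z hz =>
    Prod.ext (funext fun j => Real.coe_toNNReal _ (hz.1 j)) (Real.coe_toNNReal _ hz.2)
  have hmap : ∀ ρ : Measure ((Fin k → ℝ) × ℝ), (∀ᵐ z ∂ρ, (∀ j, 0 ≤ z.1 j) ∧ 0 ≤ z.2) →
      (ρ.map T).map S = ρ := fun ρ hρ => by
    rw [Measure.map_map hS hT]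
    have : S ∘ T =ᵐ[ρ] id := hρ.mono fun z hz => hST z hz
    rw [Measure.map_congr this, Measure.map_id]
  have hint : ∀ ρ : Measure ((Fin k → ℝ) × ℝ), (∀ᵐ z ∂ρ, (∀ j, 0 ≤ z.1 j) ∧ 0 ≤ z.2) →
      ∀ n, ∫ z, expOrthant n z ∂(ρ.map T) =
        (∫⁻ z, ENNReal.ofReal (Real.exp (-(n.2 * z.2 + ∑ j, n.1 j * z.1 j))) ∂ρ).toReal := by
    intro ρ hρ n
    rw [integral_map hT.aemeasurable (expOrthant n).continuous.aestronglyMeasurable,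
      ← integral_eq_lintegral_of_nonneg_ae (.of_forall fun _ => (Real.exp_pos _).le)
        (Continuous.aestronglyMeasurable (by fun_prop))]
    refine integral_congr_ae ?_
    filter_upwards [hρ] with z hz
    have := hST z hz
    rw [expOrthant_apply]
    have h1 : ((T z).2 : ℝ) = z.2 := congrArg Prod.snd this
    have h2 : ∀ j, ((T z).1 j : ℝ) = z.1 j := fun j => congrFun (congrArg Prod.fst this) j
    simp only [h1, h2]
  rw [← hmap μ hμ, ← hmap ν hν]
  congr 1
  refine ext_of_expOrthant fun n => ?_
  rw [hint μ hμ, hint ν hν, h n.1 n.2]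

/-! ### Product measures and the size-weighted Lévy measure -/

/-- **Tonelli's theorem** for products of functions of one variable. -/
theorem lintegral_fin_prod_eq_prod {k : ℕ} {X : Type*} [MeasurableSpace X] (μ : Fin k → Measure X)
    [∀ i, SigmaFinite (μ i)] {f : Fin k → X → ℝ≥0∞} (hf : ∀ i, Measurable (f i)) :
    ∫⁻ x, ∏ i, f i (x i) ∂Measure.pi μ = ∏ i, ∫⁻ x, f i x ∂μ i := by
  induction k with
  | zero => simp
  | succ k ih =>
    have hmp := (measurePreserving_piFinSuccAbove μ 0).symm
    have hm : Measurable fun x : Fin k → X => ∏ i : Fin k, f i.succ (x i) :=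
      Finset.measurable_prod _ fun i _ => (hf _).comp (measurable_pi_apply i)
    rw [← hmp.lintegral_comp_emb (MeasurableEquiv.measurableEmbedding _), Fin.prod_univ_succ,
      ← ih (fun i => μ i.succ) fun i => hf i.succ]
    simp only [Fin.prod_univ_succ]
    simp only [MeasurableEquiv.piFinSuccAbove_symm_apply, Fin.insertNthEquiv_apply,
      Fin.insertNth_zero', Fin.cons_zero, Fin.cons_succ]
    exact lintegral_prod_mul (hf 0).aemeasurable hm.aemeasurable

theorem pi_withDensity {k : ℕ} {X : Type*} [MeasurableSpace X] (μ : Measure X) [SigmaFinite μ]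
    {f : X → ℝ≥0∞} (hf : Measurable f) [SigmaFinite (μ.withDensity f)] :
    Measure.pi (fun _ : Fin k => μ.withDensity f) =
      (Measure.pi fun _ : Fin k => μ).withDensity fun x => ∏ i, f (x i) := by
  refine Measure.pi_eq fun s hs => ?_
  rw [withDensity_apply _ (MeasurableSet.univ_pi hs), ← lintegral_indicator (MeasurableSet.univ_pi hs)]
  simp_rw [withDensity_apply _ (hs _), ← lintegral_indicator (hs _)]
  rw [← lintegral_fin_prod_eq_prod (fun _ => μ) fun i => hf.indicator (hs i)]
  refine lintegral_congr fun x => ?_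
  by_cases hx : ∀ i, x i ∈ s i
  · rw [Set.indicator_of_mem (show x ∈ Set.univ.pi s from fun i _ => hx i)]
    exact Finset.prod_congr rfl fun i _ => (Set.indicator_of_mem (hx i) _).symm
  · rw [Set.indicator_of_notMem fun h : x ∈ Set.univ.pi s => hx fun i => h i trivial]
    push Not at hx
    obtain ⟨i, hi⟩ := hx
    exact (Finset.prod_eq_zero (Finset.mem_univ i) (Set.indicator_of_notMem hi _)).symm

lemma lintegral_rpow_mul_exp {a r : ℝ} (ha : 0 < a) (hr : 0 < r) :
    ∫⁻ t in Set.Ioi (0 : ℝ), ENNReal.ofReal (t ^ (a - 1) * Real.exp (-(r * t))) =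
      ENNReal.ofReal ((1 / r) ^ a * Real.Gamma a) := by
  have h := Real.integral_rpow_mul_exp_neg_mul_Ioi ha hr
  have hpos : 0 < (1 / r) ^ a * Real.Gamma a := by
    have := Real.Gamma_pos_of_pos ha
    positivity
  rw [← h, ofReal_integral_eq_lintegral_ofReal]
  -- A non-integrable function has integral `0` by convention, which the positive value excludes.
  · by_contra hi
    rw [integral_undef hi] at h
    exact hpos.ne h
  · filter_upwards [ae_restrict_mem measurableSet_Ioi] with t ht
    have : (0 : ℝ) < t := ht
    positivity

/-- The density of the size-weighted Lévy measure of the `α`-stable subordinator with Laplace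
exponent `λ ^ α`. -/
noncomputable def stableDensity (α x : ℝ) : ℝ≥0∞ :=
  (Set.Ioi (0 : ℝ)).indicator (fun x => ENNReal.ofReal (α / Real.Gamma (1 - α) * x ^ (-α))) x

lemma measurable_stableDensity (α : ℝ) : Measurable (stableDensity α) := by
  unfold stableDensity
  exact Measurable.indicator (by fun_prop) measurableSet_Ioi

/-- The size-weighted Lévy measure of the `α`-stable subordinator. -/
noncomputable def stableMeasure (α : ℝ) : Measure ℝ := volume.withDensity (stableDensity α)

instance (α : ℝ) : SigmaFinite (stableMeasure α) :=
  SigmaFinite.withDensity_of_ne_top (.of_forall fun x => by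
    unfold stableDensity
    rw [Set.indicator_apply]
    split_ifs
    · exact ENNReal.ofReal_ne_top
    · exact ENNReal.zero_ne_top)

lemma ae_stableMeasure_nonneg (α : ℝ) : ∀ᵐ x ∂stableMeasure α, 0 ≤ x := by
  rw [stableMeasure, ae_withDensity_iff (measurable_stableDensity α)]
  refine .of_forall fun x hx => ?_
  by_contra hneg
  refine hx ?_
  unfold stableDensity
  exact Set.indicator_of_notMem (fun h => hneg (le_of_lt h)) _

/-- The constant `α / Γ(1 - α)` is chosen so that the transform is the derivative of the Laplace
exponent `l ^ α`; it then matches each factor in the Laplace functional of distinct jumps. -/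
lemma lintegral_stableMeasure_exp {α l : ℝ} (hα0 : 0 < α) (hα1 : α < 1) (hl : 0 < l) :
    ∫⁻ x, ENNReal.ofReal (Real.exp (-(l * x))) ∂stableMeasure α =
      ENNReal.ofReal (α * l ^ (α - 1)) := by
  have hG := Real.Gamma_pos_of_pos (show 0 < 1 - α by linarith)
  have hc : 0 ≤ α / Real.Gamma (1 - α) := by positivity
  rw [stableMeasure, lintegral_withDensity_eq_lintegral_mul _ (measurable_stableDensity α)
    (by fun_prop)]
  have : ∀ x, (stableDensity α * fun x => ENNReal.ofReal (Real.exp (-(l * x)))) x =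
      (Set.Ioi (0 : ℝ)).indicator (fun x => ENNReal.ofReal (α / Real.Gamma (1 - α)) *
        ENNReal.ofReal (x ^ ((1 - α) - 1) * Real.exp (-(l * x)))) x := fun x => by
    simp only [Pi.mul_apply, stableDensity]
    by_cases hx : x ∈ Set.Ioi (0 : ℝ)
    · have hx' : (0 : ℝ) < x := hx
      rw [Set.indicator_of_mem hx, Set.indicator_of_mem hx, ← ENNReal.ofReal_mul (by positivity),
        ← ENNReal.ofReal_mul (by positivity)]
      congr 1
      rw [show 1 - α - 1 = -α by ring]
      ring
    · rw [Set.indicator_of_notMem hx, Set.indicator_of_notMem hx, zero_mul]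
  simp_rw [this]
  rw [lintegral_indicator measurableSet_Ioi, lintegral_const_mul _ (by fun_prop),
    lintegral_rpow_mul_exp (by linarith) hl, ← ENNReal.ofReal_mul hc]
  congr 1
  rw [one_div, Real.inv_rpow hl.le, ← Real.rpow_neg hl.le, neg_sub]
  field_simp

/-! ### The Palm formula -/

instance (k : ℕ) : Countable (Fin k ↪ ℕ) := DFunLike.coe_injective.countable

namespace IsStableSubordinator

variable {Ω : Type*} [MeasurableSpace Ω] {P : Measure Ω} [IsProbabilityMeasure P]
  {σ : ℝ≥0 → Ω → ℝ} {α : ℝ}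

/-- **Palm formula** for the ranked jumps of a stable subordinator. -/
theorem lintegral_tsum_rankedJump (hσ : IsStableSubordinator P σ α) (hα0 : 0 < α) (hα1 : α < 1)
    {k : ℕ} {F : (Fin k → ℝ) × ℝ → ℝ≥0∞} (hF : Measurable F) :
    ∑' i : Fin k ↪ ℕ, ∫⁻ ω, (∏ j, ENNReal.ofReal (rankedJump (fun t => σ t ω) (i j))) *
        F (fun j => rankedJump (fun t => σ t ω) (i j), σ 1 ω) ∂P =
      ∫⁻ ω, ∫⁻ x, F (x, σ 1 ω + ∑ j, x j) ∂Measure.pi (fun _ : Fin k => stableMeasure α) ∂P := by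
  have hr := hσ.aemeasurable_rankedJump
  have hs := hσ.measurable 1
  set D : (Fin k ↪ ℕ) → Ω → ℝ≥0∞ := fun i ω =>
    ∏ j, ENNReal.ofReal (rankedJump (fun t => σ t ω) (i j)) with hD
  have hDm : ∀ i, AEMeasurable (D i) P := fun i =>
    Finset.aemeasurable_fun_prod _ fun j _ => (hr _).ennreal_ofReal
  have hmapm : ∀ i : Fin k ↪ ℕ,
      AEMeasurable (fun ω => (fun j => rankedJump (fun t => σ t ω) (i j), σ 1 ω)) P := fun i =>
    (aemeasurable_pi_lambda _ fun j => hr (i j)).prodMk hs.aemeasurable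
  -- `A` and `B` are the joint measures of jumps and total mass behind the two sides; the formula
  -- says `A = B`.
  set A : Measure ((Fin k → ℝ) × ℝ) := Measure.sum fun i : Fin k ↪ ℕ =>
    (P.withDensity (D i)).map (fun ω => (fun j => rankedJump (fun t => σ t ω) (i j), σ 1 ω)) with hA
  set T : (Fin k → ℝ) × ℝ → (Fin k → ℝ) × ℝ := fun z => (z.1, z.2 + ∑ j, z.1 j) with hT
  have hTm : Measurable T := by fun_prop
  set B : Measure ((Fin k → ℝ) × ℝ) :=
    ((Measure.pi fun _ : Fin k => stableMeasure α).prod (P.map (σ 1))).map T with hB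
  have hAint : ∀ G : (Fin k → ℝ) × ℝ → ℝ≥0∞, Measurable G → ∫⁻ z, G z ∂A =
      ∑' i : Fin k ↪ ℕ, ∫⁻ ω, D i ω * G (fun j => rankedJump (fun t => σ t ω) (i j), σ 1 ω) ∂P := by
    intro G hG
    rw [hA, lintegral_sum_measure]
    refine tsum_congr fun i => ?_
    have hac := (hmapm i).mono_ac (withDensity_absolutelyContinuous P (D i))
    rw [lintegral_map' hG.aemeasurable hac, lintegral_withDensity_eq_lintegral_mul₀ (hDm i)
      (g := fun ω => G (fun j => rankedJump (fun t => σ t ω) (i j), σ 1 ω))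
      (hG.comp_aemeasurable (hmapm i))]
    rfl
  have : IsProbabilityMeasure (P.map (σ 1)) := Measure.isProbabilityMeasure_map hs.aemeasurable
  have hBint : ∀ G : (Fin k → ℝ) × ℝ → ℝ≥0∞, Measurable G → ∫⁻ z, G z ∂B =
      ∫⁻ ω, ∫⁻ x, G (x, σ 1 ω + ∑ j, x j) ∂Measure.pi (fun _ : Fin k => stableMeasure α) ∂P := by
    intro G hG
    rw [hB, lintegral_map hG hTm, lintegral_prod_symm (fun z => G (T z)) (hG.comp hTm).aemeasurable,
      lintegral_map (f := fun t => ∫⁻ x, G (T (x, t)) ∂Measure.pi (fun _ : Fin k => stableMeasure α))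
        (hG.comp hTm).lintegral_prod_left' hs]
  rw [← hAint F hF, ← hBint F hF]
  suffices hAB : A = B by rw [hAB]
  -- The measures may be infinite. The density `exp (-z.2)` makes them finite, shifts the exponent
  -- of the total mass by one (hence `1 + a` below), and can be divided out at the end.
  set w : (Fin k → ℝ) × ℝ → ℝ≥0∞ := fun z => ENNReal.ofReal (Real.exp (-z.2)) with hw
  have hwm : Measurable w := by fun_prop
  set G : (Fin k → ℕ) → ℕ → (Fin k → ℝ) × ℝ → ℝ≥0∞ := fun n a z =>
    ENNReal.ofReal (Real.exp (-((1 + a : ℝ) * z.2 + ∑ j, n j * z.1 j))) with hG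
  have hGm : ∀ n a, Measurable (G n a) := fun n a => by simp only [hG]; fun_prop
  have hwG : ∀ (M : Measure ((Fin k → ℝ) × ℝ)) (n : Fin k → ℕ) (a : ℕ),
      ∫⁻ z, ENNReal.ofReal (Real.exp (-(a * z.2 + ∑ j, n j * z.1 j))) ∂(M.withDensity w) =
      ∫⁻ z, G n a z ∂M := by
    intro M n a
    rw [lintegral_withDensity_eq_lintegral_mul _ hwm (by fun_prop)]
    refine lintegral_congr fun z => ?_
    simp only [Pi.mul_apply, hw, hG]
    rw [← ENNReal.ofReal_mul (Real.exp_pos _).le, ← Real.exp_add]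
    congr 2
    ring
  have hAL : ∀ (n : Fin k → ℕ) (a : ℕ), ∫⁻ z, G n a z ∂A =
      (∏ j, ENNReal.ofReal (α * ((1 + a : ℝ) + n j) ^ (α - 1))) *
        ENNReal.ofReal (Real.exp (-((1 + a : ℝ) ^ α))) := by
    intro n a
    rw [hAint _ (hGm n a), ← hσ.lintegral_exp_mul_tsum hα0 hα1 (by positivity) (fun j => (n j : ℝ))
        fun j => Nat.cast_nonneg _, ← lintegral_tsum
        (f := fun i ω => D i ω * G n a (fun j => rankedJump (fun t => σ t ω) (i j), σ 1 ω)) fun i =>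
          (hDm i).mul ((hGm n a).comp_aemeasurable (hmapm i))]
    refine lintegral_congr fun ω => ?_
    rw [← ENNReal.tsum_mul_left]
    refine tsum_congr fun i => ?_
    simp only [hD, hG]
    rw [mul_left_comm, ← ENNReal.ofReal_prod_of_nonneg (f := fun j => Real.exp _)
      fun j _ => (Real.exp_pos _).le, ← ENNReal.ofReal_mul (Real.exp_pos _).le, ← Real.exp_sum,
      ← Real.exp_add, Finset.sum_neg_distrib, neg_add]
  have hBL : ∀ (n : Fin k → ℕ) (a : ℕ), ∫⁻ z, G n a z ∂B =
      (∏ j, ENNReal.ofReal (α * ((1 + a : ℝ) + n j) ^ (α - 1))) *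
        ENNReal.ofReal (Real.exp (-((1 + a : ℝ) ^ α))) := by
    intro n a
    rw [hBint _ (hGm n a), ← hσ.laplace_one (by positivity), ← lintegral_const_mul _ (by fun_prop)]
    refine lintegral_congr fun ω => ?_
    have : ∀ j, ENNReal.ofReal (α * ((1 + a : ℝ) + n j) ^ (α - 1)) =
        ∫⁻ x, ENNReal.ofReal (Real.exp (-(((1 + a : ℝ) + n j) * x))) ∂stableMeasure α :=
      fun j => (lintegral_stableMeasure_exp hα0 hα1 (by positivity)).symm
    simp_rw [this]
    rw [← lintegral_fin_prod_eq_prod (fun _ => stableMeasure α) (f := fun j x =>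
      ENNReal.ofReal (Real.exp (-(((1 + a : ℝ) + n j) * x)))) (fun j => by fun_prop),
      ← lintegral_mul_const _ (Finset.measurable_prod _ fun j _ => by fun_prop)]
    refine lintegral_congr fun x => ?_
    simp only [hG]
    rw [← ENNReal.ofReal_prod_of_nonneg (f := fun j => Real.exp _) fun j _ => (Real.exp_pos _).le,
      ← ENNReal.ofReal_mul (Finset.prod_nonneg fun j _ => (Real.exp_pos _).le), ← Real.exp_sum,
      ← Real.exp_add, Finset.sum_neg_distrib]
    congr 2
    simp_rw [add_mul (1 + (a : ℝ)), Finset.sum_add_distrib, ← Finset.mul_sum]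
    ring
  have hfin : ∀ M : Measure ((Fin k → ℝ) × ℝ), (∀ (n : Fin k → ℕ) (a : ℕ),
      ∫⁻ z, G n a z ∂M = (∏ j, ENNReal.ofReal (α * ((1 + a : ℝ) + n j) ^ (α - 1))) *
        ENNReal.ofReal (Real.exp (-((1 + a : ℝ) ^ α)))) → IsFiniteMeasure (M.withDensity w) := by
    intro M hM
    have := (hwG M 0 0).trans (hM 0 0)
    simp only [Nat.cast_zero, zero_mul, Pi.zero_apply, Finset.sum_const_zero, add_zero, neg_zero,
      Real.exp_zero, ENNReal.ofReal_one, lintegral_one] at this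
    refine ⟨?_⟩
    rw [this]
    exact ENNReal.mul_lt_top (ENNReal.prod_lt_top fun _ _ => ENNReal.ofReal_lt_top)
      ENNReal.ofReal_lt_top
  have := hfin A hAL
  have := hfin B hBL
  have hAw : A.withDensity w = B.withDensity w := by
    refine ext_of_laplace ?_ ?_ fun n a => by
      rw [hwG, hwG, hAL, hBL]
    · refine (withDensity_absolutelyContinuous A w).ae_le ?_
      have hset : MeasurableSet {z : (Fin k → ℝ) × ℝ | ((∀ j, 0 ≤ z.1 j) ∧ 0 ≤ z.2)} := by
        measurability
      rw [hA]
      refine Measure.ae_sum_iff.2 fun i => ?_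
      have hac := (hmapm i).mono_ac (withDensity_absolutelyContinuous P (D i))
      refine (ae_map_iff hac hset).2 ((withDensity_absolutelyContinuous P (D i)).ae_le ?_)
      filter_upwards [hσ.nonneg] with ω hω
      exact ⟨fun j => StieltjesFunction.rankedJump_nonneg _ _, hω 1⟩
    · refine (withDensity_absolutelyContinuous B w).ae_le ?_
      have hset : MeasurableSet {z : (Fin k → ℝ) × ℝ | ((∀ j, 0 ≤ z.1 j) ∧ 0 ≤ z.2)} := by
        measurability
      rw [hB]
      refine (ae_map_iff hTm.aemeasurable hset).2 ?_
      have h1 : ∀ᵐ x ∂(Measure.pi fun _ : Fin k => stableMeasure α), ∀ j, 0 ≤ x j :=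
        ae_all_iff.2 fun j => Measure.tendsto_eval_ae_ae.eventually (ae_stableMeasure_nonneg α)
      have h2 : ∀ᵐ t ∂(P.map (σ 1)), 0 ≤ t :=
        (ae_map_iff hs.aemeasurable measurableSet_Ici).2 (hσ.nonneg.mono fun ω h => h 1)
      have h3 := Measure.quasiMeasurePreserving_fst (μ := Measure.pi fun _ : Fin k => stableMeasure α)
        (ν := P.map (σ 1)) |>.ae h1
      have h4 := Measure.quasiMeasurePreserving_snd (μ := Measure.pi fun _ : Fin k => stableMeasure α)
        (ν := P.map (σ 1)) |>.ae h2
      filter_upwards [h3, h4] with z hz1 hz2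
      exact ⟨hz1, add_nonneg hz2 (Finset.sum_nonneg fun j _ => hz1 j)⟩
  have hback : ∀ M : Measure ((Fin k → ℝ) × ℝ), (M.withDensity w).withDensity (fun z => (w z)⁻¹) = M :=
    fun M => withDensity_inv_same hwm (.of_forall fun z => by simp [hw, Real.exp_pos])
      (.of_forall fun z => ENNReal.ofReal_ne_top)
  rw [← hback A, hAw, hback B]

end IsStableSubordinator

/-! ### Proper mass sequences and size-biased picks -/

/-- The set of nonincreasing sequences of positive numbers with sum `1`. -/
def ProperMassSeq : Set (ℕ → ℝ) :=
  {s | Antitone s ∧ (∀ n, 0 < s n) ∧ ∑' n, ENNReal.ofReal (s n) = 1}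

lemma measurableSet_properMassSeq : MeasurableSet ProperMassSeq := by
  have h1 : MeasurableSet {s : ℕ → ℝ | Antitone s} := by
    have : {s : ℕ → ℝ | Antitone s} = ⋂ i, ⋂ j, {s | i ≤ j → s j ≤ s i} := by
      ext s; simp [Antitone]
    rw [this]
    refine .iInter fun i => .iInter fun j => ?_
    by_cases hij : i ≤ j
    · simp only [hij, true_imp_iff]
      exact measurableSet_le (measurable_pi_apply j) (measurable_pi_apply i)
    · simp [hij]
  have h2 : MeasurableSet {s : ℕ → ℝ | ∀ n, 0 < s n} := by
    simp only [Set.ofPred_forall]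
    exact .iInter fun n => measurableSet_lt measurable_const (measurable_pi_apply n)
  have h3 : MeasurableSet {s : ℕ → ℝ | ∑' n, ENNReal.ofReal (s n) = 1} := by
    have : Measurable fun s : ℕ → ℝ => ∑' n, ENNReal.ofReal (s n) :=
      Measurable.tsum fun n => (measurable_pi_apply n).ennreal_ofReal
    exact this (measurableSet_singleton 1)
  exact h1.inter (h2.inter h3)

namespace ProperMassSeq

variable {s : ℕ → ℝ}

lemma hasSum (hs : s ∈ ProperMassSeq) : HasSum s 1 := by
  have h : ∑' n, ENNReal.ofReal (s n) ≠ ∞ := by rw [hs.2.2]; exact ENNReal.one_ne_top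
  have h1 := ENNReal.summable_toReal h
  have h2 := ENNReal.tsum_toReal_eq (f := fun n => ENNReal.ofReal (s n))
    (fun n => ENNReal.ofReal_ne_top)
  rw [hs.2.2] at h2
  simp only [ENNReal.toReal_ofReal (hs.2.1 _).le, ENNReal.toReal_one] at h1 h2
  rw [h2]
  exact h1.hasSum

lemma mem_rankedMassSeq (hs : s ∈ ProperMassSeq) : s ∈ RankedMassSeq :=
  ⟨hs.1, fun i => (hs.2.1 i).le, (hasSum hs).summable, (hasSum hs).tsum_eq.le⟩

/-- All entries are positive, so a finite set never exhausts the mass; this keeps the denominators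
of size-biased weights positive. -/
lemma sum_lt_one (hs : s ∈ ProperMassSeq) (t : Finset ℕ) : ∑ n ∈ t, s n < 1 := by
  obtain ⟨m, hm⟩ := t.exists_notMem
  have h := sum_le_hasSum (insert m t) (fun n _ => (hs.2.1 n).le) (hasSum hs)
  rw [Finset.sum_insert hm] at h
  have := hs.2.1 m
  linarith

lemma sum_comp_lt_one (hs : s ∈ ProperMassSeq) {k : ℕ} (i : Fin k ↪ ℕ) (t : Finset (Fin k)) :
    ∑ l ∈ t, s (i l) < 1 := by
  have := sum_lt_one hs (t.map i)
  rwa [Finset.sum_map] at this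

lemma sizeBiasedWeight_nonneg (hs : s ∈ ProperMassSeq) {k : ℕ} (i : Fin k ↪ ℕ) :
    0 ≤ sizeBiasedWeight i s :=
  Finset.prod_nonneg fun _ _ => div_nonneg (hs.2.1 _).le
    (sub_nonneg.2 (sum_comp_lt_one hs i _).le)

/-- This normalises the next pick: after the picks `i`, rank `n` follows with probability `s n / (1
- ∑ l, s (i l))`. -/
lemma tsum_compl_range (hs : s ∈ ProperMassSeq) {k : ℕ} (i : Fin k ↪ ℕ) :
    ∑' n : ↑(Set.range i)ᶜ, ENNReal.ofReal (s n) = ENNReal.ofReal (1 - ∑ l, s (i l)) := by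
  have h1 : ∑' n : Set.range i, ENNReal.ofReal (s n) = ENNReal.ofReal (∑ l, s (i l)) := by
    rw [tsum_range (fun n => ENNReal.ofReal (s n)) i.injective, tsum_fintype,
      ENNReal.ofReal_sum_of_nonneg fun l _ => (hs.2.1 _).le]
  have h2 := ENNReal.summable.tsum_add_tsum_compl (f := fun n => ENNReal.ofReal (s n))
    (s := Set.range i) ENNReal.summable
  rw [h1, hs.2.2] at h2
  rw [ENNReal.ofReal_sub _ (Finset.sum_nonneg fun l _ => (hs.2.1 _).le), ENNReal.ofReal_one]
  exact ENNReal.eq_sub_of_add_eq' ENNReal.one_ne_top (by rw [add_comm]; exact h2)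

end ProperMassSeq

lemma measurable_sizeBiasedWeight {k : ℕ} (i : Fin k ↪ ℕ) : Measurable (sizeBiasedWeight i) := by
  unfold sizeBiasedWeight
  fun_prop

/-- The embedding `(i, n)` that extends `i` by a new last value `n`. -/
def snocEmbedding {k : ℕ} (i : Fin k ↪ ℕ) (n : ↑(Set.range i)ᶜ) : Fin (k + 1) ↪ ℕ :=
  ⟨Fin.snoc (α := fun _ => ℕ) i n, Fin.snoc_injective_of_injective i.injective n.2⟩

lemma snocEmbedding_castSucc {k : ℕ} (i : Fin k ↪ ℕ) (n : ↑(Set.range i)ᶜ) (j : Fin k) :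
    snocEmbedding i n j.castSucc = i j :=
  Fin.snoc_castSucc (α := fun _ => ℕ) _ _ _

lemma snocEmbedding_last {k : ℕ} (i : Fin k ↪ ℕ) (n : ↑(Set.range i)ᶜ) :
    snocEmbedding i n (Fin.last k) = n :=
  Fin.snoc_last (α := fun _ => ℕ) _ _

/-- Tuples of `k + 1` distinct ranks are tuples of `k` distinct ranks followed by a new rank. -/
noncomputable def snocEmbeddingEquiv (k : ℕ) :
    (Σ i : Fin k ↪ ℕ, ↑(Set.range i)ᶜ) ≃ (Fin (k + 1) ↪ ℕ) := by
  refine Equiv.ofBijective (fun p => snocEmbedding p.1 p.2) ⟨?_, fun e => ?_⟩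
  · rintro ⟨i, n⟩ ⟨i', n'⟩ (h : snocEmbedding i n = snocEmbedding i' n')
    obtain rfl : i = i' := by
      ext j
      rw [← snocEmbedding_castSucc i n, ← snocEmbedding_castSucc i' n', h]
    obtain rfl : n = n' := by
      apply Subtype.ext
      rw [← snocEmbedding_last i n, ← snocEmbedding_last i n', h]
    rfl
  · refine ⟨⟨⟨fun j => e j.castSucc, fun a b h => by simpa using e.injective h⟩,
      ⟨e (Fin.last k), ?_⟩⟩, ?_⟩
    · rintro ⟨j, hj⟩
      exact (Fin.castSucc_lt_last j).ne (e.injective hj)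
    · ext j
      induction j using Fin.lastCases with
      | last => exact snocEmbedding_last _ _
      | cast j => exact snocEmbedding_castSucc _ _ _

lemma tsum_embedding_succ {k : ℕ} (G : (Fin (k + 1) ↪ ℕ) → ℝ≥0∞) :
    ∑' i, G i = ∑' (i : Fin k ↪ ℕ) (n : ↑(Set.range i)ᶜ), G (snocEmbedding i n) := by
  rw [← (snocEmbeddingEquiv k).tsum_eq, ENNReal.tsum_sigma']
  rfl

lemma sizeBiasedWeight_snoc {k : ℕ} (i : Fin k ↪ ℕ) (n : ↑(Set.range i)ᶜ) (s : ℕ → ℝ) :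
    sizeBiasedWeight (snocEmbedding i n) s =
      sizeBiasedWeight i s * (s n / (1 - ∑ l, s (i l))) := by
  simp only [sizeBiasedWeight]
  rw [Fin.prod_univ_castSucc]
  congr 1
  · refine Finset.prod_congr rfl fun j _ => ?_
    rw [snocEmbedding_castSucc, Fin.Iio_castSucc, Finset.sum_map]
    simp only [Fin.coe_castSuccEmb, snocEmbedding_castSucc]
  · rw [snocEmbedding_last, Fin.Iio_last_eq_map, Finset.sum_map]
    simp only [Fin.coe_castSuccEmb, snocEmbedding_castSucc]

/-- The law of the first `k` entries of a size-biased reordering of a sequence with law `ν`. -/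
noncomputable def pickMeasure (ν : Measure (ℕ → ℝ)) (k : ℕ) : Measure (Fin k → ℝ) :=
  Measure.sum fun i : Fin k ↪ ℕ => ((ν.restrict RankedMassSeq).withDensity
    fun s => ENNReal.ofReal (sizeBiasedWeight i s)).map fun s j => s (i j)

lemma isSizeBiased_iff {ν : Measure (ℕ → ℝ)} {μ : Measure (ℕ → unitInterval)} :
    IsSizeBiased ν μ ↔ ∀ k : ℕ, 1 ≤ k → ∀ A : Fin k → Set ℝ, (∀ j, MeasurableSet (A j)) →
      μ {x | ∀ j : Fin k, (x j : ℝ) ∈ A j} = pickMeasure ν k (Set.univ.pi A) := by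
  refine forall₄_congr fun k hk A hA => ?_
  have hm : MeasurableSet (Set.univ.pi A) := .univ_pi hA
  rw [pickMeasure, Measure.sum_apply _ hm]
  have : ∀ i : Fin k ↪ ℕ, (((ν.restrict RankedMassSeq).withDensity
      fun s => ENNReal.ofReal (sizeBiasedWeight i s)).map fun s j => s (i j)) (Set.univ.pi A) =
      ∫⁻ s in {s | s ∈ RankedMassSeq ∧ ∀ j, s (i j) ∈ A j},
        ENNReal.ofReal (sizeBiasedWeight i s) ∂ν := by
    intro i
    have hmi : Measurable fun (s : ℕ → ℝ) (j : Fin k) => s (i j) := by fun_prop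
    rw [Measure.map_apply hmi hm, withDensity_apply _ (hmi hm),
      Measure.restrict_restrict (hmi hm)]
    congr 2
    ext s
    simp only [Set.mem_inter_iff, Set.mem_preimage, Set.mem_univ_pi, Set.mem_ofPred_eq, and_comm]
  simp_rw [this]

lemma lintegral_pickMeasure {ν : Measure (ℕ → ℝ)} (hν : ∀ᵐ s ∂ν, s ∈ ProperMassSeq) {k : ℕ}
    {F : (Fin k → ℝ) → ℝ≥0∞} (hF : Measurable F) :
    ∫⁻ x, F x ∂pickMeasure ν k = ∑' i : Fin k ↪ ℕ,
      ∫⁻ s, ENNReal.ofReal (sizeBiasedWeight i s) * F (fun j => s (i j)) ∂ν := by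
  have hres : ν.restrict RankedMassSeq = ν := Measure.restrict_eq_self_of_ae_mem
    (hν.mono fun s hs => ProperMassSeq.mem_rankedMassSeq hs)
  rw [pickMeasure, lintegral_sum_measure, hres]
  refine tsum_congr fun i => ?_
  have hmi : Measurable fun (s : ℕ → ℝ) (j : Fin k) => s (i j) := by fun_prop
  rw [lintegral_map hF hmi, lintegral_withDensity_eq_lintegral_mul _
    (measurable_sizeBiasedWeight i).ennreal_ofReal (g := fun s => F fun j => s (i j)) (hF.comp hmi)]
  rfl

/-- If `φ` is, given any `k` entries, the mean of `H` over the next size-biased pick, then the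
`k` first picks under `φ ν` are obtained from the `k + 1` first picks under `ν`. -/
theorem lintegral_pickMeasure_withDensity {ν : Measure (ℕ → ℝ)} (hν : ∀ᵐ s ∂ν, s ∈ ProperMassSeq)
    {k : ℕ} {φ : (ℕ → ℝ) → ℝ≥0∞} (hφ : Measurable φ) {H : (Fin (k + 1) → ℝ) → ℝ≥0∞}
    (hH : Measurable H)
    (h : ∀ s ∈ ProperMassSeq, ∀ i : Fin k ↪ ℕ, ∑' n : ↑(Set.range i)ᶜ,
      ENNReal.ofReal (s n / (1 - ∑ l, s (i l))) * H (Fin.snoc (fun j => s (i j)) (s n)) = φ s)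
    {F : (Fin k → ℝ) → ℝ≥0∞} (hF : Measurable F) :
    ∫⁻ x, F x ∂pickMeasure (ν.withDensity φ) k =
      ∫⁻ x, F (fun j => x j.castSucc) * H x ∂pickMeasure ν (k + 1) := by
  have hinit : Measurable fun (x : Fin (k + 1) → ℝ) (j : Fin k) => x j.castSucc := by fun_prop
  rw [lintegral_pickMeasure ((withDensity_absolutelyContinuous ν φ).ae_le hν) hF,
    lintegral_pickMeasure hν (F := fun x => F (fun j => x j.castSucc) * H x)
      ((hF.comp hinit).mul hH), tsum_embedding_succ]
  refine tsum_congr fun i => ?_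
  have hmi : Measurable fun (s : ℕ → ℝ) (j : Fin k) => s (i j) := by fun_prop
  have hwm := (measurable_sizeBiasedWeight i).ennreal_ofReal
  rw [lintegral_withDensity_eq_lintegral_mul _ hφ
    (g := fun s => ENNReal.ofReal (sizeBiasedWeight i s) * F fun j => s (i j))
    (hwm.mul (hF.comp hmi)), ← lintegral_tsum (f := fun n s =>
      ENNReal.ofReal (sizeBiasedWeight (snocEmbedding i n) s) *
        (F (fun j => s (snocEmbedding i n j.castSucc)) * H fun j => s (snocEmbedding i n j)))]
  · refine lintegral_congr_ae ?_
    filter_upwards [hν] with s hs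
    simp only [Pi.mul_apply]
    -- The value of `φ` is expanded as a mean over the next pick, whose probability turns the weight
    -- of `i` into that of the extended tuple.
    rw [← h s hs i, ← ENNReal.tsum_mul_right]
    refine tsum_congr fun n => ?_
    rw [sizeBiasedWeight_snoc, ENNReal.ofReal_mul (ProperMassSeq.sizeBiasedWeight_nonneg hs i)]
    simp only [snocEmbedding_castSucc]
    have : (fun j => s (snocEmbedding i n j)) = Fin.snoc (fun j => s (i j)) (s n) := by
      ext j
      induction j using Fin.lastCases with
      | last => rw [snocEmbedding_last, Fin.snoc_last]
      | cast j => rw [snocEmbedding_castSucc, Fin.snoc_castSucc]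
    rw [this]
    ring
  · intro n
    have hms : Measurable fun (s : ℕ → ℝ) (j : Fin (k + 1)) => s (snocEmbedding i n j) := by fun_prop
    exact ((measurable_sizeBiasedWeight _).ennreal_ofReal.mul
      (((hF.comp hinit).mul hH).comp hms)).aemeasurable

/-- The probabilities of the next pick add up to one; this is `lintegral_pickMeasure_withDensity`
with `φ` and `H` constantly `1`. -/
theorem pickMeasure_map_castSucc {ν : Measure (ℕ → ℝ)} (hν : ∀ᵐ s ∂ν, s ∈ ProperMassSeq) (k : ℕ) :
    (pickMeasure ν (k + 1)).map (fun x (j : Fin k) => x j.castSucc) = pickMeasure ν k := by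
  refine Measure.ext_of_lintegral _ fun F hF => ?_
  have := lintegral_pickMeasure_withDensity hν (k := k) (φ := 1) measurable_const
    (H := fun _ => 1) measurable_const (fun s hs i => ?_) hF
  · rw [withDensity_one] at this
    rw [this, lintegral_map hF (by fun_prop)]
    simp
  · have hR : 0 < 1 - ∑ l, s (i l) := sub_pos.2 (ProperMassSeq.sum_comp_lt_one hs i _)
    simp_rw [mul_one, ENNReal.ofReal_div_of_pos hR, div_eq_mul_inv, Pi.one_apply]
    rw [ENNReal.tsum_mul_right, ProperMassSeq.tsum_compl_range hs i, ENNReal.mul_inv_cancel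
      (by simpa using hR) ENNReal.ofReal_ne_top]

/-! ### Kolmogorov extension on the infinite cube -/

/-- **Kolmogorov extension** on `[0, 1]^ℕ`: a consistent family of finite measures on the finite
powers of `[0, 1]` has a projective limit. -/
theorem exists_measure_of_consistent (m : ∀ k : ℕ, Measure (Fin (k + 1) → unitInterval))
    [∀ k, IsFiniteMeasure (m k)]
    (hm : ∀ k, (m (k + 1)).map (fun x (j : Fin (k + 1)) => x j.castSucc) = m k) :
    ∃ M : Measure (ℕ → unitInterval), ∀ k, M.map (fun x (j : Fin (k + 1)) => x j) = m k := by
  -- Padding by zeros lifts `m k` to the infinite cube with the right marginals up to level `k`. The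
  -- cube is compact and the lifts have equal mass, so they converge along an ultrafilter;
  -- projections are continuous and the marginals eventually constant.
  let pad : ∀ k, (Fin (k + 1) → unitInterval) → ℕ → unitInterval := fun k x n =>
    if h : n < k + 1 then x ⟨n, h⟩ else 0
  have hpad : ∀ k, Measurable (pad k) := fun k => measurable_pi_lambda _ fun n => by
    by_cases h : n < k + 1
    · simp only [pad, dif_pos h]; exact measurable_pi_apply _
    · simp only [pad, dif_neg h]; exact measurable_const
  have hproj : ∀ k, Measurable fun (x : ℕ → unitInterval) (j : Fin (k + 1)) => x j := fun k =>
    measurable_pi_lambda _ fun j => measurable_pi_apply _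
  let μ : ℕ → FiniteMeasure (ℕ → unitInterval) := fun k => ⟨(m k).map (pad k), inferInstance⟩
  have hrestr : ∀ k d, (m (k + d)).map (fun x (j : Fin (k + 1)) => x (j.castLE (by omega))) = m k := by
    intro k d
    induction d with
    | zero => exact Measure.map_id
    | succ d ih =>
      rw [← ih, ← hm (k + d), Measure.map_map (by fun_prop) (by fun_prop)]
      rfl
  have hmarg : ∀ k n, k ≤ n → ((m n).map (pad n)).map (fun x (j : Fin (k + 1)) => x j) = m k := by
    intro k n hkn
    obtain ⟨d, rfl⟩ := Nat.exists_eq_add_of_le hkn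
    rw [Measure.map_map (hproj k) (hpad _), ← hrestr k d]
    congr 1
    ext x j
    have : (j : ℕ) < k + d + 1 := by omega
    simp only [Function.comp_apply, pad, dif_pos this]
    rfl
  have hmass : ∀ k, (μ k).mass = (μ 0).mass := by
    intro k
    have h1 : (m k).map (pad k) Set.univ = m 0 Set.univ := by
      rw [← hmarg 0 k (Nat.zero_le _), Measure.map_apply (hproj 0) .univ, Set.preimage_univ]
    have h2 : (m 0).map (pad 0) Set.univ = m 0 Set.univ := by
      rw [Measure.map_apply (hpad 0) .univ, Set.preimage_univ]
    rw [← ENNReal.coe_inj, FiniteMeasure.ennreal_mass, FiniteMeasure.ennreal_mass]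
    exact h1.trans h2.symm
  obtain ⟨M, -, hM⟩ := (isCompact_setOfPred_finiteMeasure_le_of_compactSpace (ℕ → unitInterval)
    (μ 0).mass).ultrafilter_le_nhds ((hyperfilter ℕ).map μ) (by
      rw [le_principal_iff]
      exact Filter.mem_map.2 (Filter.univ_mem' fun k => (hmass k).le))
  have hM : Tendsto μ (hyperfilter ℕ) (𝓝 M) := hM
  refine ⟨M, fun k => ?_⟩
  have hc : Continuous fun (x : ℕ → unitInterval) (j : Fin (k + 1)) => x j :=
    continuous_pi fun j => continuous_apply _
  have h1 := FiniteMeasure.tendsto_map_of_tendsto_of_continuous μ M hM hc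
  have h2 : ∀ᶠ n in (hyperfilter ℕ : Filter ℕ), (μ n).map (fun x (j : Fin (k + 1)) => x j) =
      ⟨m k, inferInstance⟩ := by
    have : ∀ᶠ n in (atTop : Filter ℕ), k ≤ n := eventually_ge_atTop k
    rw [← Nat.cofinite_eq_atTop] at this
    filter_upwards [hyperfilter_le_cofinite this] with n hn
    apply Subtype.ext
    rw [FiniteMeasure.val_eq_toMeasure, FiniteMeasure.toMeasure_map]
    exact hmarg k n hn
  have h3 := tendsto_nhds_unique h1 (tendsto_const_nhds.congr' (h2.mono fun n hn => hn.symm))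
  have h4 := congrArg (fun x : FiniteMeasure (Fin (k + 1) → unitInterval) =>
    (x : Measure (Fin (k + 1) → unitInterval))) h3
  simpa [FiniteMeasure.toMeasure_map] using h4

/-! ### Uniqueness and existence of size-biased measures -/

lemma IsSizeBiased.apply_cylinder {ν : Measure (ℕ → ℝ)} {μ : Measure (ℕ → unitInterval)}
    (h : IsSizeBiased ν μ) (k : ℕ) {A : ℕ → Set ℝ} (hA : ∀ n, MeasurableSet (A n)) :
    μ {x | ∀ j : Fin (k + 1), (x j : ℝ) ∈ A j} =
      pickMeasure ν (k + 1) (Set.univ.pi fun j : Fin (k + 1) => A j) :=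
  isSizeBiased_iff.1 h (k + 1) (by omega) (fun j => A j) fun j => hA j

/-- A size-biased measure is unique as soon as the law of its first entry is `σ`-finite. -/
theorem IsSizeBiased.unique {ν : Measure (ℕ → ℝ)} [SigmaFinite (pickMeasure ν 1)]
    {μ₁ μ₂ : Measure (ℕ → unitInterval)} (h₁ : IsSizeBiased ν μ₁) (h₂ : IsSizeBiased ν μ₂) :
    μ₁ = μ₂ := by
  classical
  have hcyl : ∀ (k : ℕ) (A : ℕ → Set ℝ), (∀ n, MeasurableSet (A n)) →
      μ₁ {x | ∀ j : Fin (k + 1), (x j : ℝ) ∈ A j} = μ₂ {x | ∀ j : Fin (k + 1), (x j : ℝ) ∈ A j} :=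
    fun k A hA => by rw [h₁.apply_cylinder k hA, h₂.apply_cylinder k hA]
  -- The measures may be infinite, so the π-system argument runs on the cover by the cylinders `T
  -- N`, which have finite mass.
  set C : ℕ → Set ℝ := fun N => {y | (fun _ : Fin 1 => y) ∈ spanningSets (pickMeasure ν 1) N} with hC
  have hCm : ∀ N, MeasurableSet (C N) := fun N =>
    (measurable_pi_lambda (fun (y : ℝ) (_ : Fin 1) => y) fun _ => measurable_id)
      (measurableSet_spanningSets (pickMeasure ν 1) N)
  set T : ℕ → Set (ℕ → unitInterval) := fun N => {x | (x 0 : ℝ) ∈ C N} with hT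
  have hTcyl : ∀ N, T N = {x | ∀ j : Fin (0 + 1), (x j : ℝ) ∈ (fun _ : ℕ => C N) j} := fun N => by
    ext x; simp [hT]
  refine Measure.ext_of_generateFrom_of_cover
    (S := squareCylinders fun _ : ℕ => {s : Set unitInterval | MeasurableSet s})
    (T := Set.range T) generateFrom_squareCylinders.symm (Set.countable_range T)
    (isPiSystem_squareCylinders (fun _ => MeasurableSpace.isPiSystem_measurableSet) fun _ =>
      (MeasurableSet.univ : MeasurableSet (Set.univ : Set unitInterval))) ?_ ?_ ?_ ?_
  · refine Set.eq_univ_of_forall fun x => ?_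
    have : (fun _ : Fin 1 => (x 0 : ℝ)) ∈ ⋃ N, spanningSets (pickMeasure ν 1) N := by
      rw [iUnion_spanningSets]; trivial
    obtain ⟨N, hN⟩ := Set.mem_iUnion.1 this
    exact ⟨T N, ⟨N, rfl⟩, hN⟩
  · rintro _ ⟨N, rfl⟩
    rw [hTcyl, h₁.apply_cylinder 0 fun _ => hCm N]
    have : (Set.univ.pi fun j : Fin (0 + 1) => (fun _ : ℕ => C N) j) =
        spanningSets (pickMeasure ν 1) N := by
      ext x
      have hx : (fun _ : Fin 1 => x 0) = x := by ext j; rw [Subsingleton.elim j 0]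
      constructor
      · intro h; have h0 := h 0 trivial; rwa [hC, Set.mem_ofPred_eq, hx] at h0
      · intro h j _
        obtain rfl : j = 0 := Fin.ext (by omega)
        rw [hC]
        simpa only [Set.mem_ofPred_eq, hx] using h
    rw [this]
    exact (measure_spanningSets_lt_top _ N).ne
  · rintro _ ⟨N, rfl⟩ _ ⟨S, t, ht, rfl⟩
    -- Such an intersection is a box in the coordinates up to the largest element of `S`, with
    -- `univ` where nothing is imposed.
    have hset : (S : Set ℕ).pi t ∩ T N = {x | ∀ j : Fin (S.sup id + 1), (x j : ℝ) ∈
        (fun n => (if n ∈ S then Subtype.val '' t n else Set.univ) ∩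
          (if n = 0 then C N else Set.univ)) (j : ℕ)} := by
      ext x
      simp only [Set.mem_inter_iff, Set.mem_pi, Finset.mem_coe, Set.mem_ofPred_eq, hT]
      constructor
      · rintro ⟨h1, h2⟩ j
        constructor
        · split_ifs with hj
          · exact ⟨x j, h1 j hj, rfl⟩
          · trivial
        · split_ifs with hj
          · rwa [hj]
          · trivial
      · intro h
        constructor
        · intro n hn
          have hlt : n < S.sup id + 1 := Nat.lt_succ_of_le (Finset.le_sup (f := id) hn)
          have := (h ⟨n, hlt⟩).1
          simp only [hn, if_true] at this
          obtain ⟨y, hy, hyx⟩ := this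
          rwa [← Subtype.ext hyx]
        · simpa using (h 0).2
    rw [hset]
    refine hcyl _ (fun n => (if n ∈ S then Subtype.val '' t n else Set.univ) ∩
      (if n = 0 then C N else Set.univ)) fun n => MeasurableSet.inter ?_ ?_
    · split_ifs
      · exact (MeasurableEmbedding.subtype_coe measurableSet_Icc).measurableSet_image.2
          (ht n trivial)
      · exact .univ
    · split_ifs
      · exact hCm N
      · exact .univ
  · rintro _ ⟨N, rfl⟩
    rw [hTcyl]
    exact hcyl 0 _ fun _ => hCm N

lemma ae_pickMeasure_mem_Icc {ν : Measure (ℕ → ℝ)} (hν : ∀ᵐ s ∂ν, s ∈ ProperMassSeq) (k : ℕ) :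
    ∀ᵐ x ∂pickMeasure ν k, ∀ j, x j ∈ Set.Icc (0 : ℝ) 1 := by
  have hres : ν.restrict RankedMassSeq = ν := Measure.restrict_eq_self_of_ae_mem
    (hν.mono fun s hs => ProperMassSeq.mem_rankedMassSeq hs)
  rw [pickMeasure, hres]
  refine Measure.ae_sum_iff.2 fun i => ?_
  have hset : MeasurableSet {x : Fin k → ℝ | ∀ j, x j ∈ Set.Icc (0 : ℝ) 1} := by measurability
  have hmi : Measurable fun (s : ℕ → ℝ) (j : Fin k) => s (i j) := by fun_prop
  refine (ae_map_iff hmi.aemeasurable hset).2 ((withDensity_absolutelyContinuous _ _).ae_le ?_)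
  filter_upwards [hν] with s hs j
  refine ⟨(hs.2.1 _).le, ?_⟩
  have := ProperMassSeq.sum_lt_one hs {i j}
  rw [Finset.sum_singleton] at this
  exact this.le

/-- Existence of size-biased measures of measures on proper mass partitions, together with their
finite-dimensional marginals. -/
theorem exists_isSizeBiased {ν : Measure (ℕ → ℝ)} (hν : ∀ᵐ s ∂ν, s ∈ ProperMassSeq)
    [SigmaFinite (pickMeasure ν 1)] :
    ∃ μ, IsSizeBiased ν μ ∧ ∀ k, 1 ≤ k → firstMarginals k μ = pickMeasure ν k := by
  -- The positive finite weight `g` makes the law of the first pick finite. As a function of the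
  -- first entry alone it preserves consistency, so the weighted laws `Λ k` can be extended, and
  -- dividing by it restores the picks.
  obtain ⟨g, hg0, hgm, hg1⟩ := exists_pos_lintegral_lt_of_sigmaFinite (pickMeasure ν 1) one_ne_zero
  set G : ℝ → ℝ≥0∞ := fun y => (g fun _ => y : ℝ≥0∞) with hG
  have hGm : Measurable G := by
    have : Measurable fun (y : ℝ) (_ : Fin 1) => y := measurable_pi_lambda _ fun _ => measurable_id
    exact (hgm.comp this).coe_nnreal_ennreal
  have hG0 : ∀ y, G y ≠ 0 := fun y => by simpa [hG] using (hg0 fun _ => y).ne'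
  have hGt : ∀ y, G y ≠ ∞ := fun y => ENNReal.coe_ne_top
  set Λ : ∀ k : ℕ, Measure (Fin (k + 1) → ℝ) := fun k =>
    (pickMeasure ν (k + 1)).withDensity fun x => G (x 0) with hΛ
  have hGm0 : ∀ k : ℕ, Measurable fun x : Fin (k + 1) → ℝ => G (x 0) := fun k =>
    hGm.comp (measurable_pi_apply 0)
  have hcons : ∀ k, (Λ (k + 1)).map (fun x (j : Fin (k + 1)) => x j.castSucc) = Λ k := by
    intro k
    have hcm : Measurable fun (x : Fin (k + 1 + 1) → ℝ) (j : Fin (k + 1)) => x j.castSucc := by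
      fun_prop
    refine Measure.ext_of_lintegral _ fun F hF => ?_
    rw [lintegral_map hF hcm, hΛ, lintegral_withDensity_eq_lintegral_mul _ (hGm0 _)
      (g := fun x => F fun j => x j.castSucc) (hF.comp hcm),
      lintegral_withDensity_eq_lintegral_mul _ (hGm0 _) hF, ← pickMeasure_map_castSucc hν (k + 1),
      lintegral_map ((hGm0 k).mul hF) hcm]
    rfl
  have hfin : ∀ k, IsFiniteMeasure (Λ k) := by
    intro k
    induction k with
    | zero =>
      refine ⟨?_⟩
      rw [hΛ, withDensity_apply _ .univ, Measure.restrict_univ]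
      refine (lintegral_congr fun x => ?_).trans_lt (hg1.trans ENNReal.one_lt_top)
      simp only [hG]
      congr 2
      ext j; rw [Subsingleton.elim j 0]
    | succ k ih =>
      refine ⟨?_⟩
      have := ih.measure_univ_lt_top
      rwa [← hcons k, Measure.map_apply (by fun_prop) .univ, Set.preimage_univ] at this
  have hpos : (0 : ℝ) ≤ 1 := zero_le_one
  -- Picks lie in `[0, 1]` almost everywhere, so this projection only changes the type.
  let pr : ∀ k : ℕ, (Fin (k + 1) → ℝ) → Fin (k + 1) → unitInterval := fun k x j =>
    Set.projIcc 0 1 hpos (x j)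
  have hpr : ∀ k, Measurable (pr k) := fun k => measurable_pi_lambda _ fun j =>
    continuous_projIcc.measurable.comp (measurable_pi_apply j)
  obtain ⟨M, hM⟩ := exists_measure_of_consistent (fun k => (Λ k).map (pr k)) (fun k => by
    rw [← hcons k, Measure.map_map (by fun_prop) (hpr _), Measure.map_map (hpr _) (by fun_prop)]
    rfl)
  have hGI : Measurable fun x : ℕ → unitInterval => (G (x 0 : ℝ))⁻¹ := by
    have : Measurable fun x : ℕ → unitInterval => (x 0 : ℝ) :=
      measurable_subtype_coe.comp (measurable_pi_apply 0)
    exact (hGm.comp this).inv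
  have hmarg : ∀ k, 1 ≤ k → firstMarginals k (M.withDensity fun x => (G (x 0 : ℝ))⁻¹) =
      pickMeasure ν k := by
    intro k hk
    obtain ⟨k, rfl⟩ := Nat.exists_eq_add_of_le' hk
    have hval : Measurable fun (x : Fin (k + 1) → unitInterval) (j : Fin (k + 1)) => (x j : ℝ) :=
      measurable_pi_lambda _ fun j => measurable_subtype_coe.comp (measurable_pi_apply j)
    have hproj : Measurable fun (x : ℕ → unitInterval) (j : Fin (k + 1)) => x j :=
      measurable_pi_lambda _ fun j => measurable_pi_apply _
    have hfm : Measurable fun (x : ℕ → unitInterval) (j : Fin (k + 1)) => (x j : ℝ) :=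
      hval.comp hproj
    refine Measure.ext_of_lintegral _ fun F hF => ?_
    rw [firstMarginals, lintegral_map hF hfm,
      lintegral_withDensity_eq_lintegral_mul _ hGI (g := fun x => F fun j => (x j : ℝ)) (hF.comp hfm)]
    have hK : Measurable fun x : Fin (k + 1) → unitInterval => (G (x 0 : ℝ))⁻¹ * F fun j => (x j : ℝ) := by
      have : Measurable fun x : Fin (k + 1) → unitInterval => (x 0 : ℝ) :=
        measurable_subtype_coe.comp (measurable_pi_apply 0)
      exact ((hGm.comp this).inv).mul (hF.comp hval)
    have h1 := lintegral_map (μ := M) hK hproj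
    rw [hM k, lintegral_map hK (hpr k)] at h1
    refine h1.symm.trans ?_
    simp only [hΛ]
    rw [lintegral_withDensity_eq_lintegral_mul _ (hGm0 k)
      (g := fun x => (G (pr k x 0 : ℝ))⁻¹ * F fun j => (pr k x j : ℝ)) (hK.comp (hpr k))]
    refine lintegral_congr_ae ?_
    filter_upwards [ae_pickMeasure_mem_Icc hν (k + 1)] with x hx
    have hxe : ∀ j, (pr k x j : ℝ) = x j := fun j => by
      simp only [pr]; rw [Set.projIcc_of_mem hpos (hx j)]
    simp only [Pi.mul_apply, hxe]
    rw [← mul_assoc, ENNReal.mul_inv_cancel (hG0 _) (hGt _), one_mul]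
  refine ⟨_, isSizeBiased_iff.2 fun k hk A hA => ?_, hmarg⟩
  rw [← hmarg k hk, firstMarginals, Measure.map_apply _ (.univ_pi hA)]
  · congr 1
    ext x; simp
  · exact measurable_pi_lambda _ fun j => measurable_subtype_coe.comp (measurable_pi_apply _)

/-! ### Poisson-Dirichlet measures and moments of the stable law -/

namespace IsStableSubordinator

variable {Ω : Type*} [MeasurableSpace Ω] {P : Measure Ω} {σ : ℝ≥0 → Ω → ℝ} {α : ℝ}

lemma aemeasurable_rankedJump_div (hσ : IsStableSubordinator P σ α) :
    AEMeasurable (fun ω n => rankedJump (fun t => σ t ω) n / σ 1 ω) P :=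
  aemeasurable_pi_lambda _ fun n =>
    (hσ.aemeasurable_rankedJump n).div (hσ.measurable 1).aemeasurable

lemma lintegral_pdStar (hσ : IsStableSubordinator P σ α) (θ : ℝ) {G : (ℕ → ℝ) → ℝ≥0∞}
    (hG : Measurable G) :
    ∫⁻ s, G s ∂PDStar P σ θ = ∫⁻ ω, ENNReal.ofReal (σ 1 ω ^ (-θ)) *
      G (fun n => rankedJump (fun t => σ t ω) n / σ 1 ω) ∂P := by
  have hm : AEMeasurable (fun ω n => rankedJump (fun t => σ t ω) n / σ 1 ω)
      (P.withDensity fun ω => ENNReal.ofReal (σ 1 ω ^ (-θ))) :=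
    hσ.aemeasurable_rankedJump_div.mono_ac (withDensity_absolutelyContinuous _ _)
  have hs := hσ.measurable 1
  rw [PDStar, lintegral_map' hG.aemeasurable hm, lintegral_withDensity_eq_lintegral_mul₀
    (Measurable.aemeasurable (by fun_prop))
    (g := fun ω => G fun n => rankedJump (fun t => σ t ω) n / σ 1 ω)
    (hG.comp_aemeasurable hσ.aemeasurable_rankedJump_div)]
  rfl

variable [IsProbabilityMeasure P]

/-- Where `σ 1 ≤ 0`, `exp (-l σ 1)` is at least `1`, but its mean `exp (-l ^ α)` vanishes as `l →
∞`. -/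
lemma ae_pos_one (hσ : IsStableSubordinator P σ α) (hα0 : 0 < α) : ∀ᵐ ω ∂P, 0 < σ 1 ω := by
  have hbound : ∀ l : ℝ, 0 < l →
      P {ω | σ 1 ω ≤ 0} ≤ ENNReal.ofReal (Real.exp (-(l ^ α))) := by
    intro l hl
    have hm : MeasurableSet {ω | σ 1 ω ≤ 0} := measurableSet_le (hσ.measurable 1) measurable_const
    rw [← hσ.laplace_one hl, ← setLIntegral_one]
    refine (setLIntegral_mono_ae ?_ ?_).trans (setLIntegral_le_lintegral _ _)
    · have := hσ.measurable 1
      exact Measurable.aemeasurable (by fun_prop)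
    · refine .of_forall fun ω hω => ?_
      rw [← ENNReal.ofReal_one]
      refine ENNReal.ofReal_le_ofReal (Real.one_le_exp ?_)
      have : l * σ 1 ω ≤ 0 := mul_nonpos_of_nonneg_of_nonpos hl.le hω
      linarith
  have hlim : Tendsto (fun l : ℝ => ENNReal.ofReal (Real.exp (-(l ^ α)))) atTop (𝓝 0) := by
    rw [← ENNReal.ofReal_zero]
    exact ENNReal.tendsto_ofReal
      (Real.tendsto_exp_neg_atTop_nhds_zero.comp (tendsto_rpow_atTop hα0))
  have h0 : P {ω | σ 1 ω ≤ 0} ≤ 0 :=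
    ge_of_tendsto hlim ((eventually_gt_atTop 0).mono hbound)
  rw [ae_iff]
  simpa only [not_lt] using le_antisymm h0 bot_le

/-- A stable subordinator has infinitely many jumps on `[0, 1]`. -/
theorem ae_rankedJump_pos (hσ : IsStableSubordinator P σ α) (hα0 : 0 < α) (hα1 : α < 1) :
    ∀ᵐ ω ∂P, ∀ n, 0 < rankedJump (fun t => σ t ω) n := by
  have hr := hσ.aemeasurable_rankedJump
  -- The `k` largest jumps, if positive, never exhaust `σ 1`: on the other side of the Palm formula
  -- the total is `σ 1 + ∑ x_j`, which exceeds `∑ x_j`.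
  have hstrict : ∀ k : ℕ, ∀ᵐ ω ∂P,
      (∏ j : Fin k, ENNReal.ofReal (rankedJump (fun t => σ t ω) j)) = 0 ∨
        ∑ j : Fin k, rankedJump (fun t => σ t ω) j < σ 1 ω := by
    intro k
    have hset : MeasurableSet {z : (Fin k → ℝ) × ℝ | z.2 ≤ ∑ j, z.1 j} :=
      measurableSet_le (by fun_prop) (by fun_prop)
    have hF : Measurable ({z : (Fin k → ℝ) × ℝ | z.2 ≤ ∑ j, z.1 j}.indicator
        (1 : (Fin k → ℝ) × ℝ → ℝ≥0∞)) := measurable_one.indicator hset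
    have h := hσ.lintegral_tsum_rankedJump hα0 hα1 hF
    have hrhs : ∫⁻ ω, ∫⁻ x, {z : (Fin k → ℝ) × ℝ | z.2 ≤ ∑ j, z.1 j}.indicator
        (1 : (Fin k → ℝ) × ℝ → ℝ≥0∞) (x, σ 1 ω + ∑ j, x j)
          ∂Measure.pi (fun _ : Fin k => stableMeasure α) ∂P = 0 := by
      refine (lintegral_congr_ae ?_).trans lintegral_zero
      filter_upwards [hσ.ae_pos_one hα0] with ω hω
      refine (lintegral_congr fun x => ?_).trans lintegral_zero
      refine Set.indicator_of_notMem ?_ _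
      simpa using hω
    rw [hrhs, ENNReal.tsum_eq_zero] at h
    have h1 := h Fin.valEmbedding
    rw [lintegral_eq_zero_iff'] at h1
    · filter_upwards [h1] with ω hω
      rcases mul_eq_zero.1 hω with h2 | h2
      · exact Or.inl h2
      · right
        by_contra! hle
        rw [Set.indicator_of_mem (by exact hle)] at h2
        exact one_ne_zero h2
    · refine AEMeasurable.mul (Finset.aemeasurable_fun_prod _ fun j _ => (hr _).ennreal_ofReal) ?_
      exact hF.comp_aemeasurable
        ((aemeasurable_pi_lambda _ fun j => hr _).prodMk (hσ.measurable 1).aemeasurable)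
  filter_upwards [ae_all_iff.2 hstrict, hσ.tsum_rankedJump hα0 hα1, hσ.coe_pathStieltjes,
    hσ.ae_pos_one hα0] with ω h1 h2 h3 h4
  have hanti : Antitone (rankedJump fun t => σ t ω) := by
    rw [← h3]; exact StieltjesFunction.rankedJump_antitone _
  have hnn := StieltjesFunction.rankedJump_nonneg fun t => σ t ω
  by_contra! hex
  classical
  -- If `n` were the first rank without a positive jump, the jumps before it would already sum to `σ
  -- 1`.
  set n := Nat.find hex with hn
  have hn0 : rankedJump (fun t => σ t ω) n ≤ 0 := Nat.find_spec hex
  have hlt : ∀ j < n, 0 < rankedJump (fun t => σ t ω) j := fun j hj =>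
    not_le.1 (Nat.find_min hex hj)
  rcases h1 n with h | h
  · obtain ⟨j, -, hj⟩ := Finset.prod_eq_zero_iff.1 h
    exact absurd (ENNReal.ofReal_eq_zero.1 hj) (hlt j j.2).not_ge
  · rw [tsum_eq_sum (s := Finset.range n), ← ENNReal.ofReal_sum_of_nonneg fun i _ => hnn i,
      ENNReal.ofReal_eq_ofReal_iff (Finset.sum_nonneg fun i _ => hnn i) h4.le,
      ← Fin.sum_univ_eq_sum_range] at h2
    · exact h.ne h2
    · intro m hm
      exact ENNReal.ofReal_eq_zero.2 ((hanti (by simpa using hm)).trans hn0)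

lemma ae_properMassSeq (hσ : IsStableSubordinator P σ α) (hα0 : 0 < α) (hα1 : α < 1) :
    ∀ᵐ ω ∂P, (fun n => rankedJump (fun t => σ t ω) n / σ 1 ω) ∈ ProperMassSeq := by
  filter_upwards [hσ.ae_rankedJump_pos hα0 hα1, hσ.tsum_rankedJump hα0 hα1, hσ.coe_pathStieltjes,
    hσ.ae_pos_one hα0] with ω h1 h2 h3 h4
  refine ⟨fun n m hnm => ?_, fun n => div_pos (h1 n) h4, ?_⟩
  · have hanti : Antitone (rankedJump fun t => σ t ω) := by
      rw [← h3]; exact StieltjesFunction.rankedJump_antitone _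
    exact div_le_div_of_nonneg_right (hanti hnm) h4.le
  · simp_rw [ENNReal.ofReal_div_of_pos h4, div_eq_mul_inv]
    rw [ENNReal.tsum_mul_right, h2, ENNReal.mul_inv_cancel (by simpa using h4) ENNReal.ofReal_ne_top]

/-- Under `PD*`, almost every sequence has infinitely many positive entries and sum `1`. -/
theorem ae_pdStar_properMassSeq (hσ : IsStableSubordinator P σ α) (hα0 : 0 < α) (hα1 : α < 1)
    (θ : ℝ) : ∀ᵐ s ∂PDStar P σ θ, s ∈ ProperMassSeq := by
  have hm : AEMeasurable (fun ω n => rankedJump (fun t => σ t ω) n / σ 1 ω)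
      (P.withDensity fun ω => ENNReal.ofReal (σ 1 ω ^ (-θ))) :=
    hσ.aemeasurable_rankedJump_div.mono_ac (withDensity_absolutelyContinuous _ _)
  exact (ae_map_iff hm measurableSet_properMassSeq).2
    ((withDensity_absolutelyContinuous _ _).ae_le (hσ.ae_properMassSeq hα0 hα1))

/-- The moments of a stable random variable. -/
theorem lintegral_rpow_one (hσ : IsStableSubordinator P σ α) (hα0 : 0 < α) (hα1 : α < 1) {q : ℝ}
    (hq : q < α) :
    ∫⁻ ω, ENNReal.ofReal (σ 1 ω ^ q) ∂P =
      ENNReal.ofReal (Real.Gamma (1 - q / α) / Real.Gamma (1 - q)) := by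
  have hs := hσ.measurable 1
  have hΓ : 0 < Real.Gamma (1 - q) := Real.Gamma_pos_of_pos (by linarith)
  -- `Γ(1 - q) σ ^ q` is the integral of `l ^ (-q) σ exp (-l σ)` over `l > 0`. Exchanged with the
  -- expectation, it involves only the tilted mean of `σ 1` and becomes a Gamma integral in `l ^ α`.
  have h1 : ENNReal.ofReal (Real.Gamma (1 - q)) * ∫⁻ ω, ENNReal.ofReal (σ 1 ω ^ q) ∂P =
      ∫⁻ ω, (∫⁻ l in Set.Ioi (0 : ℝ),
        ENNReal.ofReal (l ^ (-q)) * ENNReal.ofReal (σ 1 ω * Real.exp (-(l * σ 1 ω)))) ∂P := by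
    rw [← lintegral_const_mul _ (by fun_prop)]
    refine lintegral_congr_ae ?_
    filter_upwards [hσ.ae_pos_one hα0] with ω hω
    have h := lintegral_rpow_mul_exp (a := 1 - q) (by linarith) hω
    have h2 : ∫⁻ l in Set.Ioi (0 : ℝ),
        ENNReal.ofReal (l ^ (-q)) * ENNReal.ofReal (σ 1 ω * Real.exp (-(l * σ 1 ω))) =
        ENNReal.ofReal (σ 1 ω) * ∫⁻ l in Set.Ioi (0 : ℝ),
          ENNReal.ofReal (l ^ (1 - q - 1) * Real.exp (-(σ 1 ω * l))) := by
      rw [← lintegral_const_mul _ (by fun_prop)]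
      refine setLIntegral_congr_fun measurableSet_Ioi fun l hl => ?_
      have hl : (0 : ℝ) < l := hl
      rw [← ENNReal.ofReal_mul (by positivity), ← ENNReal.ofReal_mul hω.le]
      congr 1
      rw [show 1 - q - 1 = -q by ring, mul_comm (σ 1 ω) l]
      ring
    rw [h2, h, ← ENNReal.ofReal_mul hΓ.le, ← ENNReal.ofReal_mul hω.le]
    congr 1
    rw [one_div, Real.inv_rpow hω.le, ← Real.rpow_neg hω.le, ← mul_assoc,
      show -(1 - q) = q - 1 by ring, show σ 1 ω * σ 1 ω ^ (q - 1) = σ 1 ω ^ q by rw [Real.rpow_sub_one hω.ne']; field_simp, mul_comm]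
  have h2 : ∫⁻ ω, (∫⁻ l in Set.Ioi (0 : ℝ),
        ENNReal.ofReal (l ^ (-q)) * ENNReal.ofReal (σ 1 ω * Real.exp (-(l * σ 1 ω)))) ∂P =
      ENNReal.ofReal (Real.Gamma (1 - q / α)) := by
    rw [lintegral_lintegral_swap (Measurable.aemeasurable (by fun_prop))]
    have hval := integral_rpow_mul_exp_neg_rpow (p := α) (q := α - q - 1) hα0 (by linarith)
    have hΓ' : 0 < Real.Gamma ((α - q - 1 + 1) / α) :=
      Real.Gamma_pos_of_pos (div_pos (by linarith) hα0)
    have hpos : 0 < 1 / α * Real.Gamma ((α - q - 1 + 1) / α) := by positivity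
    have hΓe : Real.Gamma (1 - q / α) =
        α * ∫ x in Set.Ioi (0 : ℝ), x ^ (α - q - 1) * Real.exp (-x ^ α) := by
      rw [hval, show (α - q - 1 + 1) / α = 1 - q / α by field_simp; ring]
      field_simp
    rw [hΓe, ENNReal.ofReal_mul hα0.le, ofReal_integral_eq_lintegral_ofReal,
      ← lintegral_const_mul _ (by fun_prop)]
    · refine setLIntegral_congr_fun measurableSet_Ioi fun l hl => ?_
      have hl : (0 : ℝ) < l := hl
      rw [lintegral_const_mul _ (by fun_prop), lintegral_mul_exp_of_laplace (c := 1) (α := α)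
        hs.aemeasurable (hσ.nonneg.mono fun ω h => h 1)
        (fun l hl => by rw [one_mul]; exact hσ.laplace_one hl) hl,
        ← ENNReal.ofReal_mul (by positivity), ← ENNReal.ofReal_mul hα0.le]
      congr 1
      rw [show α - q - 1 = -q + (α - 1) by ring, Real.rpow_add hl]
      ring_nf
    · by_contra hi
      rw [integral_undef hi] at hval
      exact hpos.ne hval
    · filter_upwards [ae_restrict_mem measurableSet_Ioi] with t ht
      have : (0 : ℝ) < t := ht
      positivity
  rw [h2] at h1
  rw [ENNReal.ofReal_div_of_pos hΓ, ← h1, mul_comm, ENNReal.mul_div_cancel_right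
    (by simpa using hΓ) ENNReal.ofReal_ne_top]

end IsStableSubordinator

/-! ### Change of variables from the orthant to the simplex -/

/-- The open simplex `{x | x_1, …, x_k > 0, x_1 + … + x_k < 1}`. -/
def openSimplex (k : ℕ) : Set (Fin k → ℝ) := {x | (∀ j, 0 < x j) ∧ ∑ j, x j < 1}

lemma measurableSet_openSimplex (k : ℕ) : MeasurableSet (openSimplex k) := by
  refine MeasurableSet.inter (s₁ := {x : Fin k → ℝ | ∀ j, 0 < x j})
    (s₂ := {x : Fin k → ℝ | ∑ j, x j < 1}) ?_ (measurableSet_lt (by fun_prop) measurable_const)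
  simp only [Set.ofPred_forall]
  exact .iInter fun n => measurableSet_lt measurable_const (measurable_pi_apply n)

/-- Change of variables between the positive orthant and the open simplex. -/
theorem lintegral_orthant_eq_lintegral_openSimplex {k : ℕ} {t : ℝ} (ht : 0 < t)
    (g : (Fin k → ℝ) → ℝ≥0∞) :
    ∫⁻ x in {x : Fin k → ℝ | ∀ j, 0 < x j}, g x = ∫⁻ u in openSimplex k,
      ENNReal.ofReal (t ^ k / (1 - ∑ j, u j) ^ (k + 1)) *
        g ((t / (1 - ∑ j, u j)) • u) := by
  set L : (Fin k → ℝ) →L[ℝ] ℝ := ∑ j, ContinuousLinearMap.proj j with hL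
  have hLa : ∀ u : Fin k → ℝ, L u = ∑ j, u j := fun u => by simp [hL]
  -- `φ` inverts `x ↦ x / (t + ∑ x_j)`: if `t` is the mass besides the jumps `x`, the total is `t /
  -- (1 - ∑ u_j)`.
  set φ : (Fin k → ℝ) → Fin k → ℝ := fun u => (t / (1 - ∑ j, u j)) • u with hφ
  set φ' : (Fin k → ℝ) → (Fin k → ℝ) →L[ℝ] (Fin k → ℝ) := fun u =>
    (t / (1 - ∑ j, u j)) • (ContinuousLinearMap.id ℝ (Fin k → ℝ)) +
      ((t / (1 - ∑ j, u j) ^ 2) • L).smulRight u with hφ'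
  have hsimp : ∀ u ∈ openSimplex k, 0 < 1 - ∑ j, u j := fun u hu => sub_pos.2 hu.2
  have hsum : ∀ u, ∑ j, φ u j = t / (1 - ∑ j, u j) * ∑ j, u j := fun u => by
    simp [hφ, Finset.mul_sum]
  have hinv : ∀ u ∈ openSimplex k, (t + ∑ j, φ u j)⁻¹ • φ u = u := by
    intro u hu
    have h := hsimp u hu
    rw [hsum, hφ, smul_smul]
    have : (t + t / (1 - ∑ j, u j) * ∑ j, u j)⁻¹ * (t / (1 - ∑ j, u j)) = 1 := by
      have : t + t / (1 - ∑ j, u j) * ∑ j, u j = t / (1 - ∑ j, u j) := by field_simp; ring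
      rw [this, inv_mul_cancel₀ (by positivity)]
    rw [this, one_smul]
  have himage : φ '' openSimplex k = {x : Fin k → ℝ | ∀ j, 0 < x j} := by
    ext x
    constructor
    · rintro ⟨u, hu, rfl⟩ j
      exact mul_pos (div_pos ht (hsimp u hu)) (hu.1 j)
    · intro hx
      have hS : 0 ≤ ∑ j, x j := Finset.sum_nonneg fun j _ => (hx j).le
      have hpos : 0 < t + ∑ j, x j := by positivity
      have hs : ∑ j, ((t + ∑ j, x j)⁻¹ • x) j = (∑ j, x j) / (t + ∑ j, x j) := by
        simp only [Pi.smul_apply, smul_eq_mul, ← Finset.mul_sum]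
        field_simp
      refine ⟨(t + ∑ j, x j)⁻¹ • x, ⟨fun j => mul_pos (inv_pos.2 hpos) (hx j), ?_⟩, ?_⟩
      · rw [hs, div_lt_one hpos]; linarith
      · simp only [hφ]
        rw [hs, smul_smul]
        have : t / (1 - (∑ j, x j) / (t + ∑ j, x j)) * (t + ∑ j, x j)⁻¹ = 1 := by
          have : 1 - (∑ j, x j) / (t + ∑ j, x j) = t / (t + ∑ j, x j) := by field_simp; ring
          rw [this]; field_simp
        rw [this, one_smul]
  have hderiv : ∀ u ∈ openSimplex k, HasFDerivWithinAt φ (φ' u) (openSimplex k) u := by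
    intro u hu
    have h := hsimp u hu
    have h1 : HasFDerivAt (fun u : Fin k → ℝ => t / (1 - ∑ j, u j))
        ((t / (1 - ∑ j, u j) ^ 2) • L) u := by
      have h2 : HasDerivAt (fun y : ℝ => t / (1 - y)) (t / (1 - ∑ j, u j) ^ 2) (∑ j, u j) := by
        have := ((hasDerivAt_id (∑ j, u j)).const_sub 1).inv h.ne' |>.const_mul t
        simpa [div_eq_mul_inv] using this
      have h3 : HasFDerivAt (fun u : Fin k → ℝ => ∑ j, u j) L u := by
        have := L.hasFDerivAt (x := u)
        rwa [show (L : (Fin k → ℝ) → ℝ) = fun u => ∑ j, u j from funext hLa] at this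
      exact h2.comp_hasFDerivAt u h3
    exact (h1.smul (hasFDerivAt_id u)).hasFDerivWithinAt
  have hdet : ∀ u ∈ openSimplex k, (φ' u).det = t ^ k / (1 - ∑ j, u j) ^ (k + 1) := by
    intro u hu
    have h := hsimp u hu
    -- The derivative is a multiple of a rank-one perturbation `v ↦ v + f v • u` of the identity, of
    -- determinant `1 + f u = 1 / (1 - ∑ u_j)`.
    have h1 : ((φ' u : (Fin k → ℝ) →L[ℝ] (Fin k → ℝ)) : (Fin k → ℝ) →ₗ[ℝ] (Fin k → ℝ)) =
        (t / (1 - ∑ j, u j)) • LinearMap.transvection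
          ((1 / (1 - ∑ j, u j)) • (L : (Fin k → ℝ) →ₗ[ℝ] ℝ)) u := by
      refine LinearMap.ext fun v => funext fun j => ?_
      simp only [hφ', ContinuousLinearMap.toLinearMap_add, ContinuousLinearMap.toLinearMap_smul,
        LinearMap.add_apply, LinearMap.smul_apply, LinearMap.transvection.apply,
        ContinuousLinearMap.coe_coe, ContinuousLinearMap.smulRight_apply, Pi.add_apply,
        Pi.smul_apply, smul_eq_mul, smul_apply,
        ContinuousLinearMap.coe_id, LinearMap.id_apply]
      field_simp
    rw [ContinuousLinearMap.det, h1, LinearMap.det_smul, LinearMap.transvection.det]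
    simp only [Module.finrank_fin_fun, LinearMap.smul_apply, ContinuousLinearMap.coe_coe, hLa,
      smul_eq_mul]
    have : 1 + 1 / (1 - ∑ j, u j) * ∑ j, u j = 1 / (1 - ∑ j, u j) := by field_simp; ring
    rw [this, div_pow, pow_succ]
    field_simp
  have hinj : Set.InjOn φ (openSimplex k) := fun u hu v hv huv => by
    rw [← hinv u hu, ← hinv v hv, huv]
  rw [← himage, lintegral_image_eq_lintegral_abs_det_fderiv_mul volume
    (measurableSet_openSimplex k) hderiv hinj]
  refine setLIntegral_congr_fun (measurableSet_openSimplex k) fun u hu => ?_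
  have h := hsimp u hu
  rw [hdet u hu, abs_of_pos (by positivity)]

/-! ### Constant and shape of the `GEM*` density -/

/-- The normalising constant of `gemStarDensity`. -/
theorem gemStar_const {α θ : ℝ} (hα0 : 0 < α) (hα1 : α < 1) (hθ : -(2 * α) < θ) {k : ℕ}
    (hk : 1 ≤ k) :
    (α / Real.Gamma (1 - α)) ^ k *
      (Real.Gamma (1 - (-θ - k * α) / α) / Real.Gamma (1 - (-θ - k * α))) =
      α * Real.Gamma (2 + θ / α) /
        (Real.Gamma (1 - α) * Real.Gamma (θ + α + 1) *
          ∏ j ∈ Finset.Icc 2 k, ProbabilityTheory.beta (1 - α) (θ + j * α)) := by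
  have hΓ : Real.Gamma (1 - α) ≠ 0 := (Real.Gamma_pos_of_pos (by linarith)).ne'
  have hgen : ∀ k : ℕ, 1 ≤ k → 0 < θ + ((k + 1 : ℕ) : ℝ) * α := fun k hk => by
    have : (1 : ℝ) ≤ k := by exact_mod_cast hk
    push_cast; nlinarith
  induction k, hk using Nat.le_induction with
  | base =>
    have h1 : 1 - (-θ - ((1 : ℕ) : ℝ) * α) / α = 2 + θ / α := by push_cast; field_simp; ring
    have h2 : 1 - (-θ - ((1 : ℕ) : ℝ) * α) = θ + α + 1 := by push_cast; ring
    rw [h1, h2]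
    simp
    field_simp
  | succ k hk ih =>
    have hz := hgen k hk
    have h1 : 1 - (-θ - ((k + 1 : ℕ) : ℝ) * α) / α = (1 - (-θ - (k : ℝ) * α) / α) + 1 := by
      push_cast; field_simp; ring
    have h1' : 1 - (-θ - (k : ℝ) * α) / α = (θ + ((k + 1 : ℕ) : ℝ) * α) / α := by
      push_cast; field_simp; ring
    have h2 : 1 - (-θ - ((k + 1 : ℕ) : ℝ) * α) = (θ + ((k + 1 : ℕ) : ℝ) * α) + 1 := by ring
    have h3 : 1 - α + (θ + ((k + 1 : ℕ) : ℝ) * α) = 1 - (-θ - (k : ℝ) * α) := by push_cast; ring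
    have hpos : 0 < 1 - (-θ - (k : ℝ) * α) := by rw [← h3]; linarith
    -- By `Γ(z + 1) = z Γ(z)`, passing from `k` to `k + 1` multiplies the left side by `1 / B(1 - α,
    -- θ + (k + 1) α)`.
    rw [Finset.prod_Icc_succ_top (by omega), ← mul_assoc _ _ (ProbabilityTheory.beta _ _),
      ← div_div, ← ih, ProbabilityTheory.beta, h3, h1, h2,
      Real.Gamma_add_one hz.ne', Real.Gamma_add_one (s := 1 - (-θ - (k : ℝ) * α) / α) (by
        rw [h1']; positivity), h1']
    have g1 := (Real.Gamma_pos_of_pos hz).ne'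
    have g2 := (Real.Gamma_pos_of_pos hpos).ne'
    rw [pow_succ]
    generalize θ + ((k + 1 : ℕ) : ℝ) * α = z at *
    generalize Real.Gamma (1 - (-θ - (k : ℝ) * α)) = w at *
    field_simp

/-- Size-biased weights involve strict initial segments and the density full ones; an index shift
trades the factor `1` of the empty segment for that of the full sum. -/
lemma prod_one_sub_sum_Iic {k : ℕ} (x : Fin k → ℝ) :
    ∏ j, (1 - ∑ l ∈ Finset.Iic j, x l) =
      (∏ j, (1 - ∑ l ∈ Finset.Iio j, x l)) * (1 - ∑ j, x j) := by
  induction k with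
  | zero => simp
  | succ k ih =>
    have h1 := ih fun j => x j.castSucc
    rw [Fin.prod_univ_castSucc, Fin.prod_univ_castSucc (f := fun j => 1 - ∑ l ∈ Finset.Iio j, x l)]
    have h2 : ∀ j : Fin k, ∑ l ∈ Finset.Iic j.castSucc, x l = ∑ l ∈ Finset.Iic j, x l.castSucc :=
      fun j => by rw [← Fin.map_castSuccEmb_Iic, Finset.sum_map]; rfl
    have h3 : ∀ j : Fin k, ∑ l ∈ Finset.Iio j.castSucc, x l = ∑ l ∈ Finset.Iio j, x l.castSucc :=
      fun j => by rw [Fin.Iio_castSucc, Finset.sum_map]; rfl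
    have h4 : ∑ l ∈ Finset.Iio (Fin.last k), x l = ∑ l : Fin k, x l.castSucc := by
      rw [Fin.Iio_last_eq_map, Finset.sum_map]; rfl
    have h5 : Finset.Iic (Fin.last k) = Finset.univ := by
      ext j; simp [Fin.le_last]
    simp only [h2, h3, h4, h5]
    rw [h1]

/-- The unnormalised density of `gemStarDensity` on the simplex. -/
noncomputable def gemStarShape (α θ : ℝ) (k : ℕ) (x : Fin k → ℝ) : ℝ :=
  (1 - ∑ j, x j) ^ (θ + k * α) * (∏ j, x j ^ (-α)) / ∏ j, (1 - ∑ l ∈ Finset.Iic j, x l)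

lemma measurable_gemStarShape (α θ : ℝ) (k : ℕ) : Measurable (gemStarShape α θ k) := by
  unfold gemStarShape
  fun_prop

lemma sum_Iic_lt_one_of_mem_openSimplex {k : ℕ} {u : Fin k → ℝ} (hu : u ∈ openSimplex k)
    (s : Finset (Fin k)) : 0 < 1 - ∑ l ∈ s, u l := by
  have h := Finset.sum_le_sum_of_subset_of_nonneg (Finset.subset_univ s)
    (fun j _ _ => (hu.1 j).le)
  have := hu.2
  linarith

lemma gemStarShape_nonneg {α θ : ℝ} {k : ℕ} {u : Fin k → ℝ} (hu : u ∈ openSimplex k) :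
    0 ≤ gemStarShape α θ k u := by
  have h0 : 0 < 1 - ∑ j, u j := sub_pos.2 hu.2
  exact div_nonneg (mul_nonneg (by positivity) (Finset.prod_nonneg fun j _ =>
    Real.rpow_nonneg (hu.1 j).le _))
    (Finset.prod_nonneg fun j _ => (sum_Iic_lt_one_of_mem_openSimplex hu _).le)

/-- The constant is split by origin: a moment of `σ 1` of order `-θ - k α`, and one factor `α / Γ(1
- α)` from each Lévy density. -/
lemma gemStarDensity_eq_indicator {α θ : ℝ} (hα0 : 0 < α) (hα1 : α < 1) (hθ : -(2 * α) < θ) {k : ℕ}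
    (hk : 1 ≤ k) (x : Fin k → ℝ) :
    ENNReal.ofReal (gemStarDensity α θ k x) = (openSimplex k).indicator (fun x =>
      ENNReal.ofReal (Real.Gamma (1 - (-θ - k * α) / α) / Real.Gamma (1 - (-θ - k * α))) *
        ENNReal.ofReal ((α / Real.Gamma (1 - α)) ^ k * gemStarShape α θ k x)) x := by
  have hΓ : 0 < Real.Gamma (1 - α) := Real.Gamma_pos_of_pos (by linarith)
  have hk1 : (1 : ℝ) ≤ k := by exact_mod_cast hk
  have h1 : 0 < 1 - (-θ - k * α) / α := by
    rw [sub_pos, div_lt_one hα0]; nlinarith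
  have h2 : 0 < 1 - (-θ - k * α) := by nlinarith
  have hM : 0 < Real.Gamma (1 - (-θ - k * α) / α) / Real.Gamma (1 - (-θ - k * α)) :=
    div_pos (Real.Gamma_pos_of_pos h1) (Real.Gamma_pos_of_pos h2)
  by_cases hx : x ∈ openSimplex k
  · rw [Set.indicator_of_mem hx, gemStarDensity, if_pos (show (∀ j, 0 < x j) ∧ ∑ j, x j < 1 from hx), ← gemStar_const hα0 hα1 hθ hk,
      ← ENNReal.ofReal_mul hM.le, gemStarShape]
    congr 1
    ring
  · rw [Set.indicator_of_notMem hx, gemStarDensity, if_neg (show ¬((∀ j, 0 < x j) ∧ ∑ j, x j < 1) from hx), ENNReal.ofReal_zero]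

/-- The Jacobian cancels the powers of `t` in the size-biased weights, and the Lévy densities with
the factor `total ^ (-θ)` leave `t ^ (-θ - k α)`; everything else depends on `u` alone. -/
lemma stable_shape_identity {α θ : ℝ} {k : ℕ} {u : Fin k → ℝ} (hu : u ∈ openSimplex k) {t : ℝ}
    (ht : 0 < t) (c : ℝ) :
    t ^ k / (1 - ∑ j, u j) ^ (k + 1) * ((∏ j, c * (t / (1 - ∑ j, u j) * u j) ^ (-α)) *
      ((t / (1 - ∑ j, u j)) ^ (-θ) *
        ∏ j, ((t / (1 - ∑ j, u j))⁻¹ / (1 - ∑ l ∈ Finset.Iio j, u l)))) =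
      t ^ (-θ - k * α) * (c ^ k * gemStarShape α θ k u) := by
  have hR : 0 < 1 - ∑ j, u j := sub_pos.2 hu.2
  rw [gemStarShape, prod_one_sub_sum_Iic]
  have hprod : 0 < ∏ j, (1 - ∑ l ∈ Finset.Iio j, u l) :=
    Finset.prod_pos fun j _ => sum_Iic_lt_one_of_mem_openSimplex hu _
  set R := 1 - ∑ j, u j with hRd
  set τ := t / R with hτ
  have hτ0 : 0 < τ := div_pos ht hR
  have h1 : ∏ j, c * (τ * u j) ^ (-α) = c ^ k * (τ ^ (-α)) ^ k * ∏ j, u j ^ (-α) := by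
    rw [← mul_pow, ← Fin.prod_const, ← Finset.prod_mul_distrib]
    refine Finset.prod_congr rfl fun j _ => ?_
    rw [Real.mul_rpow hτ0.le (hu.1 j).le]; ring
  have h2 : ∏ j, (τ⁻¹ / (1 - ∑ l ∈ Finset.Iio j, u l)) =
      τ⁻¹ ^ k / ∏ j, (1 - ∑ l ∈ Finset.Iio j, u l) := by
    rw [Finset.prod_div_distrib, Fin.prod_const]
  have h3 : t ^ (-θ - k * α) * R ^ (θ + k * α) = (τ ^ (-α)) ^ k * τ ^ (-θ) := by
    rw [← Real.rpow_natCast (τ ^ (-α)), ← Real.rpow_mul hτ0.le, ← Real.rpow_add hτ0, hτ,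
      Real.div_rpow ht.le hR.le, show θ + k * α = -(-θ - k * α) by ring, Real.rpow_neg hR.le,
      show -α * k + -θ = -θ - k * α by ring]
    rfl
  have h4 : t ^ k / R ^ (k + 1) * τ⁻¹ ^ k = 1 / R := by
    rw [hτ, inv_div, div_pow, pow_succ]; field_simp
  rw [h1, h2]
  calc _ = (t ^ k / R ^ (k + 1) * τ⁻¹ ^ k) * ((τ ^ (-α)) ^ k * τ ^ (-θ)) * c ^ k *
        (∏ j, u j ^ (-α)) / ∏ j, (1 - ∑ l ∈ Finset.Iio j, u l) := by ring
    _ = _ := by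
      rw [h4, ← h3]
      field_simp

/-! ### Size-biased picks under `PD*` -/

namespace IsStableSubordinator

variable {Ω : Type*} [MeasurableSpace Ω] {P : Measure Ω} [IsProbabilityMeasure P]
  {σ : ℝ≥0 → Ω → ℝ} {α : ℝ}

/-- The weight with which a configuration of jumps `x` and total mass `u` is counted by
`pickMeasure` of `PD*`. -/
noncomputable def pickWeight (θ : ℝ) {k : ℕ} (F : (Fin k → ℝ) → ℝ≥0∞) (z : (Fin k → ℝ) × ℝ) :
    ℝ≥0∞ :=
  ENNReal.ofReal (z.2 ^ (-θ)) * ENNReal.ofReal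
    (∏ j, (z.2⁻¹ / (1 - ∑ l ∈ Finset.Iio j, z.1 l / z.2))) * F fun j => z.1 j / z.2

lemma measurable_pickWeight (θ : ℝ) {k : ℕ} {F : (Fin k → ℝ) → ℝ≥0∞} (hF : Measurable F) :
    Measurable (pickWeight θ F) := by
  unfold pickWeight
  have : Measurable fun (z : (Fin k → ℝ) × ℝ) (j : Fin k) => z.1 j / z.2 := by fun_prop
  exact Measurable.mul (by fun_prop) (hF.comp this)

/-- In proportions of the total, the mass `t` separates from the picks, so that only a moment of `σ
1` remains to be computed. -/
lemma lintegral_pi_stableMeasure_pickWeight {θ : ℝ} {k : ℕ} {F : (Fin k → ℝ) → ℝ≥0∞}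
    (hF : Measurable F) (hα1 : α < 1) (hα0 : 0 < α) {t : ℝ} (ht : 0 < t) :
    ∫⁻ x, pickWeight θ F (x, t + ∑ j, x j) ∂Measure.pi (fun _ : Fin k => stableMeasure α) =
      ENNReal.ofReal (t ^ (-θ - k * α)) * ∫⁻ u in openSimplex k,
        ENNReal.ofReal ((α / Real.Gamma (1 - α)) ^ k * gemStarShape α θ k u) * F u := by
  have hΓ : 0 < Real.Gamma (1 - α) := Real.Gamma_pos_of_pos (by linarith)
  have hgm : Measurable fun x : Fin k → ℝ => pickWeight θ F (x, t + ∑ j, x j) :=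
    (measurable_pickWeight θ hF).comp (by fun_prop)
  have hdm : Measurable fun x : Fin k → ℝ => ∏ j, stableDensity α (x j) :=
    Finset.measurable_fun_prod _ fun j _ => (measurable_stableDensity α).comp (measurable_pi_apply j)
  have hset : MeasurableSet {x : Fin k → ℝ | ∀ j, 0 < x j} := by
    simp only [Set.ofPred_forall]
    exact .iInter fun n => measurableSet_lt measurable_const (measurable_pi_apply n)
  have : SigmaFinite (volume.withDensity (stableDensity α)) :=
    inferInstanceAs (SigmaFinite (stableMeasure α))
  rw [show (fun _ : Fin k => stableMeasure α) = fun _ => volume.withDensity (stableDensity α) from rfl,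
    pi_withDensity _ (measurable_stableDensity α), lintegral_withDensity_eq_lintegral_mul _ hdm hgm,
    ← volume_pi]
  have hind : ((fun x : Fin k → ℝ => ∏ j, stableDensity α (x j)) *
      fun x => pickWeight θ F (x, t + ∑ j, x j)) = {x : Fin k → ℝ | ∀ j, 0 < x j}.indicator
      ((fun x => ∏ j, stableDensity α (x j)) * fun x => pickWeight θ F (x, t + ∑ j, x j)) := by
    symm
    rw [Set.indicator_eq_self]
    intro x hx j
    by_contra hj
    refine hx ?_
    simp only [Pi.mul_apply]
    rw [Finset.prod_eq_zero (Finset.mem_univ j), zero_mul]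
    unfold stableDensity
    exact Set.indicator_of_notMem hj _
  rw [hind, lintegral_indicator hset, lintegral_orthant_eq_lintegral_openSimplex ht,
    ← lintegral_const_mul' _ _ ENNReal.ofReal_ne_top]
  refine setLIntegral_congr_fun (measurableSet_openSimplex k) fun u hu => ?_
  have hR : 0 < 1 - ∑ j, u j := sub_pos.2 hu.2
  have hτ : 0 < t / (1 - ∑ j, u j) := div_pos ht hR
  have hsum : t + ∑ j, ((t / (1 - ∑ j, u j)) • u) j = t / (1 - ∑ j, u j) := by
    simp only [Pi.smul_apply, smul_eq_mul, ← Finset.mul_sum]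
    field_simp; ring
  have hdiv : ∀ j, ((t / (1 - ∑ j, u j)) • u) j / (t / (1 - ∑ j, u j)) = u j := fun j => by
    rw [Pi.smul_apply, smul_eq_mul, mul_div_cancel_left₀ _ hτ.ne']
  have hdens : ∀ j, stableDensity α (((t / (1 - ∑ j, u j)) • u) j) =
      ENNReal.ofReal (α / Real.Gamma (1 - α) * (t / (1 - ∑ j, u j) * u j) ^ (-α)) := fun j => by
    unfold stableDensity
    exact Set.indicator_of_mem (show ((t / (1 - ∑ j, u j)) • u) j ∈ Set.Ioi (0 : ℝ) from
      mul_pos hτ (hu.1 j)) _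
  have hprodnn : ∀ j ∈ Finset.univ,
      0 ≤ α / Real.Gamma (1 - α) * (t / (1 - ∑ j, u j) * u j) ^ (-α) := fun j _ =>
    mul_nonneg (div_pos hα0 hΓ).le (Real.rpow_nonneg (mul_pos hτ (hu.1 j)).le _)
  simp only [Pi.mul_apply, pickWeight, hsum, hdiv, hdens]
  rw [← ENNReal.ofReal_prod_of_nonneg hprodnn, ← ENNReal.ofReal_mul (by positivity), ← mul_assoc,
    ← mul_assoc, ← ENNReal.ofReal_mul (by positivity),
    ← ENNReal.ofReal_mul (mul_nonneg (by positivity) (Finset.prod_nonneg hprodnn)),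
    ← mul_assoc (ENNReal.ofReal (t ^ (_ : ℝ))), ← ENNReal.ofReal_mul (by positivity),
    ← stable_shape_identity hu ht]
  congr 2
  ring

/-- The first size-biased picks under `PD*` have the density `gemStarDensity`. -/
theorem pickMeasure_pdStar (hσ : IsStableSubordinator P σ α) (hα0 : 0 < α) (hα1 : α < 1) {θ : ℝ}
    (hθ : -(2 * α) < θ) {k : ℕ} (hk : 1 ≤ k) :
    pickMeasure (PDStar P σ θ) k =
      volume.withDensity fun x => ENNReal.ofReal (gemStarDensity α θ k x) := by
  have hk1 : (1 : ℝ) ≤ k := by exact_mod_cast hk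
  -- Each pick lowers the order of the moment of `σ 1` by `α`; with at least one pick it is finite
  -- for `θ > -2 α`.
  have hq : -θ - k * α < α := by nlinarith
  refine Measure.ext_of_lintegral _ fun F hF => ?_
  have hFi : ∀ i : Fin k ↪ ℕ, Measurable fun s : ℕ → ℝ =>
      ENNReal.ofReal (sizeBiasedWeight i s) * F fun j => s (i j) := fun i => by
    have : Measurable fun (s : ℕ → ℝ) (j : Fin k) => s (i j) := by fun_prop
    exact (measurable_sizeBiasedWeight i).ennreal_ofReal.mul (hF.comp this)
  have hterm : ∀ i : Fin k ↪ ℕ,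
      ∫⁻ s, ENNReal.ofReal (sizeBiasedWeight i s) * F (fun j => s (i j)) ∂PDStar P σ θ =
      ∫⁻ ω, (∏ j, ENNReal.ofReal (rankedJump (fun t => σ t ω) (i j))) *
        pickWeight θ F (fun j => rankedJump (fun t => σ t ω) (i j), σ 1 ω) ∂P := by
    intro i
    rw [hσ.lintegral_pdStar θ (hFi i)]
    refine lintegral_congr_ae ?_
    filter_upwards [hσ.ae_properMassSeq hα0 hα1, hσ.ae_rankedJump_pos hα0 hα1,
      hσ.ae_pos_one hα0] with ω h1 h2 h3
    have hw : sizeBiasedWeight i (fun n => rankedJump (fun t => σ t ω) n / σ 1 ω) =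
        (∏ j, rankedJump (fun t => σ t ω) (i j)) * ∏ j, ((σ 1 ω)⁻¹ /
          (1 - ∑ l ∈ Finset.Iio j, rankedJump (fun t => σ t ω) (i l) / σ 1 ω)) := by
      rw [sizeBiasedWeight, ← Finset.prod_mul_distrib]
      refine Finset.prod_congr rfl fun j _ => ?_
      ring
    rw [hw, ENNReal.ofReal_mul (Finset.prod_nonneg fun j _ => (h2 _).le),
      ENNReal.ofReal_prod_of_nonneg fun j _ => (h2 _).le, pickWeight]
    ring
  rw [lintegral_pickMeasure (hσ.ae_pdStar_properMassSeq hα0 hα1 θ) hF, tsum_congr hterm,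
    hσ.lintegral_tsum_rankedJump hα0 hα1 (measurable_pickWeight θ hF)]
  have h1 : ∫⁻ ω, ∫⁻ x, pickWeight θ F (x, σ 1 ω + ∑ j, x j)
      ∂Measure.pi (fun _ : Fin k => stableMeasure α) ∂P =
      ∫⁻ ω, ENNReal.ofReal (σ 1 ω ^ (-θ - k * α)) * (∫⁻ u in openSimplex k,
        ENNReal.ofReal ((α / Real.Gamma (1 - α)) ^ k * gemStarShape α θ k u) * F u) ∂P := by
    refine lintegral_congr_ae ?_
    filter_upwards [hσ.ae_pos_one hα0] with ω hω
    exact lintegral_pi_stableMeasure_pickWeight hF hα1 hα0 hω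
  have hs := hσ.measurable 1
  have hgm : Measurable fun u : Fin k → ℝ =>
      ENNReal.ofReal ((α / Real.Gamma (1 - α)) ^ k * gemStarShape α θ k u) := by
    have := measurable_gemStarShape α θ k
    fun_prop
  rw [h1, lintegral_mul_const _ (by fun_prop), hσ.lintegral_rpow_one hα0 hα1 hq,
    ← lintegral_const_mul' _ _ ENNReal.ofReal_ne_top, ← lintegral_indicator (measurableSet_openSimplex k)]
  simp_rw [gemStarDensity_eq_indicator hα0 hα1 hθ hk]
  rw [lintegral_withDensity_eq_lintegral_mul _
    ((hgm.const_mul _).indicator (measurableSet_openSimplex k)) hF]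
  refine lintegral_congr fun u => ?_
  simp only [Pi.mul_apply]
  by_cases hu : u ∈ openSimplex k
  · rw [Set.indicator_of_mem hu, Set.indicator_of_mem hu, mul_assoc]
  · rw [Set.indicator_of_notMem hu, Set.indicator_of_notMem hu, zero_mul]

end IsStableSubordinator

/-! ### Beta integrals -/

/-- The beta integral on `(0, R)`. -/
lemma lintegral_Ioo_rpow_mul_rpow {a b R : ℝ} (ha : 0 < a) (hb : 0 < b) (hR : 0 < R) :
    ∫⁻ y in Set.Ioo 0 R, ENNReal.ofReal (y ^ (a - 1) * (R - y) ^ (b - 1)) =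
      ENNReal.ofReal (beta a b * R ^ (a + b - 1)) := by
  have hβ := beta_pos ha hb
  have himage : (fun y => R * y) '' Set.Ioo 0 1 = Set.Ioo 0 R := by
    rw [Set.image_mul_left_Ioo hR, mul_zero, mul_one]
  have h1 := lintegral_betaPDF_eq_one ha hb
  rw [lintegral_betaPDF] at h1
  rw [← himage, lintegral_image_eq_lintegral_abs_deriv_mul (f' := fun _ => R) measurableSet_Ioo
    (fun x _ => by simpa using ((hasDerivAt_id x).const_mul R).hasDerivWithinAt)
    (fun x _ y _ hxy => mul_left_cancel₀ hR.ne' hxy), ← mul_one (ENNReal.ofReal (beta a b * _)), ← h1,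
    ← lintegral_const_mul' _ _ ENNReal.ofReal_ne_top]
  refine setLIntegral_congr_fun measurableSet_Ioo fun y hy => ?_
  have hy1 : 0 < 1 - y := sub_pos.2 hy.2
  have hy0 : 0 < y := hy.1
  rw [abs_of_pos hR, ← ENNReal.ofReal_mul hR.le, ← ENNReal.ofReal_mul (by positivity)]
  congr 1
  rw [show R - R * y = R * (1 - y) by ring, Real.mul_rpow hR.le hy0.le, Real.mul_rpow hR.le hy1.le,
    show a + b - 1 = (a - 1) + (b - 1) + 1 by ring, Real.rpow_add_one hR.ne', Real.rpow_add hR]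
  field_simp

lemma integral_Ioo_rpow_mul_rpow {a b R : ℝ} (ha : 0 < a) (hb : 0 < b) (hR : 0 < R) :
    IntegrableOn (fun y => y ^ (a - 1) * (R - y) ^ (b - 1)) (Set.Ioo 0 R) ∧
      ∫ y in Set.Ioo 0 R, y ^ (a - 1) * (R - y) ^ (b - 1) = beta a b * R ^ (a + b - 1) := by
  have h := lintegral_Ioo_rpow_mul_rpow ha hb hR
  have hβ := beta_pos ha hb
  have hnn : 0 ≤ᵐ[volume.restrict (Set.Ioo 0 R)] fun y => y ^ (a - 1) * (R - y) ^ (b - 1) := by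
    filter_upwards [ae_restrict_mem measurableSet_Ioo] with y hy
    exact mul_nonneg (Real.rpow_nonneg hy.1.le _) (Real.rpow_nonneg (sub_pos.2 hy.2).le _)
  have hm : AEStronglyMeasurable (fun y : ℝ => y ^ (a - 1) * (R - y) ^ (b - 1))
      (volume.restrict (Set.Ioo 0 R)) := Measurable.aestronglyMeasurable (by fun_prop)
  refine ⟨⟨hm, ?_⟩, ?_⟩
  · rw [hasFiniteIntegral_iff_ofReal hnn, h]; exact ENNReal.ofReal_lt_top
  · rw [integral_eq_lintegral_of_nonneg_ae hnn hm, h, ENNReal.toReal_ofReal (by positivity)]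

lemma beta_add_one_left {a b : ℝ} (ha : 0 < a) (hb : 0 < b) :
    beta (a + 1) b = beta a b * (a / (a + b)) := by
  have := (Real.Gamma_pos_of_pos (add_pos ha hb)).ne'
  rw [beta, beta, Real.Gamma_add_one ha.ne', show a + 1 + b = a + b + 1 by ring,
    Real.Gamma_add_one (add_pos ha hb).ne']
  field_simp

/-- The mean of an affine function under a rescaled beta distribution. -/
theorem lintegral_affine_mul_rpow_mul_rpow {a b R u v : ℝ} (ha : 0 < a) (hb : 0 < b) (hR : 0 < R)
    (h : ∀ y ∈ Set.Ioo 0 R, 0 ≤ u - v * y) :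
    ∫⁻ y in Set.Ioo 0 R, ENNReal.ofReal ((u - v * y) * (y ^ (a - 1) * (R - y) ^ (b - 1))) =
      ENNReal.ofReal ((u - v * (a / (a + b) * R)) * (beta a b * R ^ (a + b - 1))) := by
  obtain ⟨hi0, he0⟩ := integral_Ioo_rpow_mul_rpow ha hb hR
  obtain ⟨hi1, he1⟩ := integral_Ioo_rpow_mul_rpow (a := a + 1) (by linarith) hb hR
  have heq : Set.EqOn (fun y => (u - v * y) * (y ^ (a - 1) * (R - y) ^ (b - 1)))
      (fun y => u * (y ^ (a - 1) * (R - y) ^ (b - 1)) -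
        v * (y ^ (a + 1 - 1) * (R - y) ^ (b - 1))) (Set.Ioo 0 R) := fun y hy => by
    have hy0 : 0 < y := hy.1
    beta_reduce
    rw [show a + 1 - 1 = (a - 1) + 1 by ring, Real.rpow_add_one hy0.ne']
    ring
  have hint : IntegrableOn (fun y => (u - v * y) * (y ^ (a - 1) * (R - y) ^ (b - 1)))
      (Set.Ioo 0 R) :=
    IntegrableOn.congr_fun (f := fun y => u * (y ^ (a - 1) * (R - y) ^ (b - 1)) -
      v * (y ^ (a + 1 - 1) * (R - y) ^ (b - 1)))
      ((hi0.const_mul u).sub (hi1.const_mul v)) heq.symm measurableSet_Ioo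
  rw [← ofReal_integral_eq_lintegral_ofReal hint]
  · rw [setIntegral_congr_fun measurableSet_Ioo heq, integral_sub (hi0.const_mul u)
      (hi1.const_mul v), integral_const_mul, integral_const_mul, he0, he1, beta_add_one_left ha hb,
      show a + 1 + b - 1 = (a + b - 1) + 1 by ring, Real.rpow_add_one hR.ne']
    congr 1
    ring
  · filter_upwards [ae_restrict_mem measurableSet_Ioo] with y hy
    exact mul_nonneg (h y hy) (mul_nonneg (Real.rpow_nonneg hy.1.le _)
      (Real.rpow_nonneg (sub_pos.2 hy.2).le _))

/-! ### The dislocation density as a mean over the next pick -/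

namespace ProperMassSeq

variable {s : ℕ → ℝ}

lemma summable_sq (hs : s ∈ ProperMassSeq) : Summable fun n => s n ^ 2 := by
  refine Summable.of_nonneg_of_le (fun n => sq_nonneg _) (fun n => ?_) (hasSum hs).summable
  have := sum_lt_one hs {n}
  rw [Finset.sum_singleton] at this
  have := hs.2.1 n
  nlinarith

/-- The full double sum is the square of the total mass `1`, and its diagonal is `∑ s n ^ 2`. -/
lemma tsum_ne (hs : s ∈ ProperMassSeq) :
    ∑' p : ℕ × ℕ, (if p.1 ≠ p.2 then s p.1 * s p.2 else 0) = 1 - ∑' n, s n ^ 2 := by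
  have hsum := hasSum hs
  have hprod : HasSum (fun p : ℕ × ℕ => s p.1 * s p.2) (1 * 1) :=
    hsum.mul hsum (hsum.summable.mul_of_nonneg hsum.summable (fun n => (hs.2.1 n).le)
      fun n => (hs.2.1 n).le)
  have hinj : Function.Injective fun n : ℕ => (n, n) := fun a b h => by simpa using h
  have hdiag : HasSum (fun p : ℕ × ℕ => if p.1 = p.2 then s p.1 * s p.2 else 0)
      (∑' n, s n ^ 2) := by
    rw [← hinj.hasSum_iff]
    · simpa [Function.comp_def, sq] using (summable_sq hs).hasSum
    · rintro ⟨a, b⟩ hab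
      refine if_neg fun h : a = b => hab ⟨a, by rw [h]⟩
  rw [one_mul] at hprod
  rw [← (hprod.sub hdiag).tsum_eq]
  refine tsum_congr fun p => ?_
  by_cases h : p.1 = p.2 <;> simp [h]

lemma hasSum_compl_range {f : ℕ → ℝ} {a : ℝ} (hf : HasSum f a) {k : ℕ} (i : Fin k ↪ ℕ) :
    HasSum (fun n : ↑(Set.range i)ᶜ => f n) (a - ∑ l, f (i l)) := by
  have h1 : HasSum (f ∘ ((↑) : Set.range i → ℕ)) (∑ l, f (i l)) :=
    i.injective.hasSum_range_iff.2 (hasSum_fintype _)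
  refine h1.hasSum_compl_iff.2 ?_
  rwa [add_sub_cancel]

end ProperMassSeq

/-- The bias `γ + (1 - α - γ) (1 - ∑ x_i ^ 2 - (1 - ∑ x_i) y)` from the first picks `x` and the next
pick `y`. -/
noncomputable def nextPickBias (α γ : ℝ) {k : ℕ} (x : Fin k → ℝ) (y : ℝ) : ℝ :=
  γ + (1 - α - γ) * (1 - ∑ j, x j ^ 2 - (1 - ∑ j, x j) * y)

/-- With `Q = ∑ x_j ^ 2 + (1 - ∑ x_j) y`, which lies in `[0, 1]`, the bias is `γ Q + (1 - α) (1 -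
Q)`. This form covers negative `1 - α - γ` too. -/
lemma nextPickBias_nonneg {α γ : ℝ} (hα1 : α < 1) (hγ0 : 0 ≤ γ) {k : ℕ} {x : Fin k → ℝ}
    (hx : ∀ j, 0 ≤ x j) {y : ℝ} (hy0 : 0 ≤ y) (hy1 : ∑ j, x j + y ≤ 1) :
    0 ≤ nextPickBias α γ x y := by
  have hP0 : 0 ≤ ∑ j, x j ^ 2 := Finset.sum_nonneg fun j _ => sq_nonneg _
  have hS0 : 0 ≤ ∑ j, x j := Finset.sum_nonneg fun j _ => hx j
  have hP : ∑ j, x j ^ 2 ≤ ∑ j, x j := Finset.sum_le_sum fun j _ => by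
    have := Finset.single_le_sum (f := x) (fun i _ => hx i) (Finset.mem_univ j)
    have := hx j
    nlinarith
  have h1 : (1 - ∑ j, x j) * y ≤ 1 - ∑ j, x j := by nlinarith
  have h2 : 0 ≤ (1 - ∑ j, x j) * y := mul_nonneg (by linarith) hy0
  have h3 : nextPickBias α γ x y = γ * (∑ j, x j ^ 2 + (1 - ∑ j, x j) * y) +
    (1 - α) * (1 - ∑ j, x j ^ 2 - (1 - ∑ j, x j) * y) := by unfold nextPickBias; ring
  rw [h3]
  exact add_nonneg (mul_nonneg hγ0 (by linarith)) (mul_nonneg (by linarith) (by linarith))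

/-- The density of the alpha-gamma dislocation measure is the mean of `nextPickBias` over the next
size-biased pick. -/
theorem tsum_nextPickBias {α γ : ℝ} (hα1 : α < 1) (hγ0 : 0 ≤ γ) {s : ℕ → ℝ}
    (hs : s ∈ ProperMassSeq) {k : ℕ} (i : Fin k ↪ ℕ) :
    ∑' n : ↑(Set.range i)ᶜ, ENNReal.ofReal (s n / (1 - ∑ l, s (i l))) *
        ENNReal.ofReal (nextPickBias α γ (fun j => s (i j)) (s n)) =
      ENNReal.ofReal
        (γ + (1 - α - γ) * ∑' p : ℕ × ℕ, if p.1 ≠ p.2 then s p.1 * s p.2 else 0) := by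
  have hR : 0 < 1 - ∑ l, s (i l) := sub_pos.2 (ProperMassSeq.sum_comp_lt_one hs i _)
  have hc1 := ProperMassSeq.hasSum_compl_range (ProperMassSeq.hasSum hs) i
  have hc2 := ProperMassSeq.hasSum_compl_range (ProperMassSeq.summable_sq hs).hasSum i
  have hdiv : ∀ n : ↑(Set.range i)ᶜ, 0 ≤ s n / (1 - ∑ l, s (i l)) := fun n =>
    div_nonneg (hs.2.1 _).le hR.le
  have hle : ∀ n : ↑(Set.range i)ᶜ, ∑ j, s (i j) + s n ≤ 1 := fun n => by
    have := ProperMassSeq.sum_comp_lt_one hs (snocEmbedding i n) Finset.univ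
    rw [Fin.sum_univ_castSucc, snocEmbedding_last] at this
    simp only [snocEmbedding_castSucc] at this
    exact this.le
  have hb : ∀ n : ↑(Set.range i)ᶜ, 0 ≤ nextPickBias α γ (fun j => s (i j)) (s n) := fun n =>
    nextPickBias_nonneg hα1 hγ0 (fun j => (hs.2.1 _).le) (hs.2.1 _).le (hle n)
  have hsum : HasSum (fun n : ↑(Set.range i)ᶜ => s n / (1 - ∑ l, s (i l)) *
      nextPickBias α γ (fun j => s (i j)) (s n))
      (γ + (1 - α - γ) * (1 - ∑' n, s n ^ 2)) := by
    -- The factor `1 - ∑ x_j` before `y` in the bias cancels the normalisation of the next pick, so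
    -- the mean of that term is the sum of the unpicked squares, which completes `∑ s n ^ 2`.
    have h := (hc1.mul_left ((γ + (1 - α - γ) * (1 - ∑ j, s (i j) ^ 2)) / (1 - ∑ l, s (i l)))).sub
      (hc2.mul_left (1 - α - γ))
    convert! h using 1
    · ext n
      rw [nextPickBias]
      field_simp
      ring
    · field_simp
      ring
  rw [ProperMassSeq.tsum_ne hs, ← hsum.tsum_eq, ENNReal.ofReal_tsum_of_nonneg
    (fun n => mul_nonneg (hdiv n) (hb n)) hsum.summable]
  exact tsum_congr fun n => (ENNReal.ofReal_mul (hdiv n)).symm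

/-! ### The next pick under `GEM*` -/

/-- The first `k + 1` picks of `GEM*` are the first `k` picks followed by a beta proportion of the
remaining mass. -/
lemma gemStarDensity_snoc {α θ : ℝ} (hα1 : α < 1) {k : ℕ}
    (hθ : 0 < θ + ((k + 1 : ℕ) : ℝ) * α) (hk : 1 ≤ k) {x : Fin k → ℝ} (hx : x ∈ openSimplex k)
    {y : ℝ} (hy : y ∈ Set.Ioo 0 (1 - ∑ j, x j)) :
    gemStarDensity α θ (k + 1) (Fin.snoc x y) = gemStarDensity α θ k x /
      (beta (1 - α) (θ + ((k + 1 : ℕ) : ℝ) * α) * (1 - ∑ j, x j) ^ (θ + k * α)) *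
        (y ^ (1 - α - 1) * (1 - ∑ j, x j - y) ^ (θ + ((k + 1 : ℕ) : ℝ) * α - 1)) := by
  have hR : 0 < 1 - ∑ j, x j := sub_pos.2 hx.2
  have hRy : 0 < 1 - ∑ j, x j - y := sub_pos.2 hy.2
  have hβ := beta_pos (sub_pos.2 hα1) hθ
  have hsum : ∑ j, (Fin.snoc x y : Fin (k + 1) → ℝ) j = ∑ j, x j + y := by
    simp [Fin.sum_univ_castSucc]
  have hmem : (∀ j, 0 < (Fin.snoc x y : Fin (k + 1) → ℝ) j) ∧
      ∑ j, (Fin.snoc x y : Fin (k + 1) → ℝ) j < 1 := by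
    refine ⟨fun j => ?_, by rw [hsum]; linarith⟩
    induction j using Fin.lastCases with
    | last => rw [Fin.snoc_last]; exact hy.1
    | cast j => rw [Fin.snoc_castSucc]; exact hx.1 j
  have hIic : ∏ j, (1 - ∑ l ∈ Finset.Iic j, (Fin.snoc x y : Fin (k + 1) → ℝ) l) =
      (∏ j, (1 - ∑ l ∈ Finset.Iic j, x l)) * (1 - ∑ j, x j - y) := by
    rw [prod_one_sub_sum_Iic, Fin.prod_univ_castSucc, hsum, prod_one_sub_sum_Iic, ← sub_sub]
    congr 2
    · refine Finset.prod_congr rfl fun j _ => ?_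
      rw [Fin.Iio_castSucc, Finset.sum_map]
      simp
    · rw [Fin.Iio_last_eq_map, Finset.sum_map]
      simp
  have hprod : 0 < ∏ j, (1 - ∑ l ∈ Finset.Iic j, x l) :=
    Finset.prod_pos fun j _ => sum_Iic_lt_one_of_mem_openSimplex hx _
  rw [gemStarDensity, if_pos hmem, gemStarDensity,
    if_pos (show (∀ j, 0 < x j) ∧ ∑ j, x j < 1 from hx), hIic, hsum, Fin.prod_univ_castSucc,
    Finset.prod_Icc_succ_top (by omega), ← mul_assoc _ _ (beta _ _), ← div_div _ _ (beta _ _),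
    Real.rpow_sub_one hRy.ne', ← sub_sub, show 1 - α - 1 = -α by ring]
  simp only [Fin.snoc_castSucc, Fin.snoc_last]
  have h1 : (1 - ∑ j, x j) ^ (θ + k * α) ≠ 0 := (Real.rpow_pos_of_pos hR _).ne'
  generalize (1 - ∑ j, x j) ^ (θ + k * α) = A at *
  generalize (1 - ∑ j, x j - y) ^ (θ + ((k + 1 : ℕ) : ℝ) * α) = B at *
  generalize beta (1 - α) (θ + ((k + 1 : ℕ) : ℝ) * α) = b at *
  generalize α * Real.Gamma (2 + θ / α) / (Real.Gamma (1 - α) * Real.Gamma (θ + α + 1) *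
    ∏ j ∈ Finset.Icc 2 k, beta (1 - α) (θ + j * α)) = C
  field_simp

lemma gemStarDensity_snoc_eq_zero {α θ : ℝ} {k : ℕ} {x : Fin k → ℝ} {y : ℝ}
    (h : ¬(x ∈ openSimplex k ∧ y ∈ Set.Ioo 0 (1 - ∑ j, x j))) :
    gemStarDensity α θ (k + 1) (Fin.snoc x y) = 0 := by
  rw [gemStarDensity, if_neg]
  rintro ⟨h1, h2⟩
  have hx : ∀ j, 0 < x j := fun j => by simpa using h1 j.castSucc
  have hy : 0 < y := by simpa using h1 (Fin.last k)
  have hsum : ∑ j, x j + y < 1 := by simpa [Fin.sum_univ_castSucc] using h2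
  exact h ⟨⟨hx, by linarith⟩, hy, by linarith⟩

lemma gemStarDensity_nonneg {α θ : ℝ} (hα0 : 0 < α) (hα1 : α < 1) (hθ : -(2 * α) < θ) {k : ℕ}
    (x : Fin k → ℝ) : 0 ≤ gemStarDensity α θ k x := by
  rw [gemStarDensity]
  split_ifs with hx
  · have hb : ∀ j ∈ Finset.Icc 2 k, 0 ≤ beta (1 - α) (θ + j * α) := fun j hj => by
      have : (2 : ℝ) ≤ j := by exact_mod_cast (Finset.mem_Icc.1 hj).1
      exact (beta_pos (by linarith) (by nlinarith)).le
    have h1 := Real.Gamma_pos_of_pos (s := 2 + θ / α) (by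
      rw [show 2 + θ / α = (2 * α + θ) / α by field_simp]; exact div_pos (by linarith) hα0)
    have h2 := Real.Gamma_pos_of_pos (s := 1 - α) (by linarith)
    have h3 := Real.Gamma_pos_of_pos (s := θ + α + 1) (by linarith)
    exact mul_nonneg (div_nonneg (by positivity) (mul_nonneg (by positivity)
      (Finset.prod_nonneg hb))) (gemStarShape_nonneg (θ := θ) (α := α) hx)
  · rfl

/-- **Tonelli's theorem** for the last coordinate. -/
lemma lintegral_fin_snoc {k : ℕ} {G : (Fin (k + 1) → ℝ) → ℝ≥0∞} (hG : Measurable G) :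
    ∫⁻ x, G x = ∫⁻ x : Fin k → ℝ, ∫⁻ y : ℝ, G (Fin.snoc x y) := by
  have hmp := (volume_preserving_piFinSuccAbove (fun _ : Fin (k + 1) => ℝ) (Fin.last k)).symm
  rw [← hmp.lintegral_comp hG, Measure.volume_eq_prod,
    lintegral_prod_symm (fun z => G ((MeasurableEquiv.piFinSuccAbove (fun _ : Fin (k + 1) => ℝ)
      (Fin.last k)).symm z)) (hG.comp hmp.measurable).aemeasurable]
  refine lintegral_congr fun x => lintegral_congr fun y => ?_
  exact congrArg G (Fin.insertNth_last' y x)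

lemma measurable_gemStarDensity (α θ : ℝ) (k : ℕ) : Measurable (gemStarDensity α θ k) := by
  unfold gemStarDensity
  exact Measurable.ite (measurableSet_openSimplex k) (by fun_prop) measurable_const

/-- The mean of `nextPickBias` over the next pick of `GEM*` is `alphaGammaFactor`. -/
theorem lintegral_nextPickBias_mul_gemStarDensity {α γ : ℝ} (hα0 : 0 < α) (hα1 : α < 1)
    (hγ0 : 0 ≤ γ) (hγα : γ < α) {k : ℕ} (hk : 1 ≤ k) (x : Fin k → ℝ) :
    ∫⁻ y : ℝ, ENNReal.ofReal (nextPickBias α γ x y) *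
        ENNReal.ofReal (gemStarDensity α (-α - γ) (k + 1) (Fin.snoc x y)) =
      ENNReal.ofReal (gemStarDensity α (-α - γ) k x) *
        ENNReal.ofReal (alphaGammaFactor α γ k x) := by
  by_cases hx : x ∈ openSimplex k
  · have hR : 0 < 1 - ∑ j, x j := sub_pos.2 hx.2
    have hk1 : (1 : ℝ) ≤ k := by exact_mod_cast hk
    -- Given `x`, the next pick is `R` times a beta variable with parameters `1 - α` and `k α - γ`,
    -- the latter positive since `γ < α`.
    have hb : 0 < -α - γ + ((k + 1 : ℕ) : ℝ) * α := by push_cast; nlinarith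
    have hβ := beta_pos (sub_pos.2 hα1) hb
    set b := -α - γ + ((k + 1 : ℕ) : ℝ) * α with hbd
    set R := 1 - ∑ j, x j with hRd
    have hg0 := gemStarDensity_nonneg hα0 hα1 (θ := -α - γ) (by linarith) x
    have hden : 0 < beta (1 - α) b * R ^ (-α - γ + k * α) := by positivity
    have hu : ∀ y, nextPickBias α γ x y =
        (γ + (1 - α - γ) * (1 - ∑ j, x j ^ 2)) - ((1 - α - γ) * R) * y := fun y => by
      rw [nextPickBias, ← hRd]; ring
    have hnn : ∀ y ∈ Set.Ioo 0 R, 0 ≤ nextPickBias α γ x y := fun y hy =>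
      nextPickBias_nonneg hα1 hγ0 (fun j => (hx.1 j).le) hy.1.le (by linarith [hy.2])
    have hset : ∀ y, ENNReal.ofReal (nextPickBias α γ x y) *
        ENNReal.ofReal (gemStarDensity α (-α - γ) (k + 1) (Fin.snoc x y)) =
        (Set.Ioo 0 R).indicator (fun y => ENNReal.ofReal (gemStarDensity α (-α - γ) k x /
          (beta (1 - α) b * R ^ (-α - γ + k * α))) *
          ENNReal.ofReal (((γ + (1 - α - γ) * (1 - ∑ j, x j ^ 2)) - ((1 - α - γ) * R) * y) *
            (y ^ (1 - α - 1) * (R - y) ^ (b - 1)))) y := by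
      intro y
      by_cases hy : y ∈ Set.Ioo 0 R
      · rw [Set.indicator_of_mem hy, gemStarDensity_snoc hα1 hb hk hx hy,
          ← ENNReal.ofReal_mul (hnn y hy), ← ENNReal.ofReal_mul (div_nonneg hg0 hden.le), hu]
        congr 1
        ring
      · rw [Set.indicator_of_notMem hy, gemStarDensity_snoc_eq_zero fun h => hy h.2,
          ENNReal.ofReal_zero, mul_zero]
    simp_rw [hset]
    rw [lintegral_indicator measurableSet_Ioo, lintegral_const_mul' _ _ ENNReal.ofReal_ne_top,
      lintegral_affine_mul_rpow_mul_rpow (sub_pos.2 hα1) hb hR fun y hy => by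
        rw [← hu]; exact hnn y hy,
      ← ENNReal.ofReal_mul (div_nonneg hg0 hden.le), ← ENNReal.ofReal_mul hg0]
    congr 1
    -- The beta mean `(1 - α) / (1 - α + b)` is the coefficient in `alphaGammaFactor`; one factor
    -- `R` comes from the bias and one from the scaling of the pick.
    rw [show 1 - α + b - 1 = -α - γ + k * α by rw [hbd]; push_cast; ring,
      show 1 - α + b = 1 + ((k : ℝ) - 1) * α - γ by rw [hbd]; push_cast; ring, alphaGammaFactor,
      ← hRd, div_mul_eq_mul_div, div_eq_iff hden.ne']
    ring
  · have h0 : gemStarDensity α (-α - γ) k x = 0 := if_neg hx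
    rw [h0, ENNReal.ofReal_zero, zero_mul]
    refine (lintegral_congr fun y => ?_).trans lintegral_zero
    rw [gemStarDensity_snoc_eq_zero fun h => hx h.1, ENNReal.ofReal_zero, mul_zero]

/-! ### Size-biased picks under the dislocation measure -/

namespace IsStableSubordinator

variable {Ω : Type*} [MeasurableSpace Ω] {P : Measure Ω} [IsProbabilityMeasure P]
  {σ : ℝ≥0 → Ω → ℝ} {α γ : ℝ}

lemma ae_alphaGammaDislocation_properMassSeq (hσ : IsStableSubordinator P σ α) (hα0 : 0 < α)
    (hα1 : α < 1) : ∀ᵐ s ∂alphaGammaDislocation P σ α γ, s ∈ ProperMassSeq :=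
  (withDensity_absolutelyContinuous _ _).ae_le (hσ.ae_pdStar_properMassSeq hα0 hα1 _)

/-- The first size-biased picks under the alpha-gamma dislocation measure. -/
theorem pickMeasure_alphaGammaDislocation (hσ : IsStableSubordinator P σ α) (hα0 : 0 < α)
    (hα1 : α < 1) (hγ0 : 0 ≤ γ) (hγα : γ < α) {k : ℕ} (hk : 1 ≤ k) :
    pickMeasure (alphaGammaDislocation P σ α γ) k =
      (pickMeasure (PDStar P σ (-α - γ)) k).withDensity
        fun x => ENNReal.ofReal (alphaGammaFactor α γ k x) := by
  have hθ : -(2 * α) < -α - γ := by linarith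
  have hfm : Measurable fun x : Fin k → ℝ => ENNReal.ofReal (alphaGammaFactor α γ k x) := by
    unfold alphaGammaFactor; fun_prop
  have hbm : Measurable fun x : Fin (k + 1) → ℝ =>
      ENNReal.ofReal (nextPickBias α γ (fun j => x j.castSucc) (x (Fin.last k))) := by
    unfold nextPickBias; fun_prop
  have hgm : ∀ n, Measurable fun x : Fin n → ℝ =>
      ENNReal.ofReal (gemStarDensity α (-α - γ) n x) := fun n =>
    (measurable_gemStarDensity _ _ _).ennreal_ofReal
  have hφ : Measurable fun s : ℕ → ℝ => ENNReal.ofReal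
      (γ + (1 - α - γ) * ∑' p : ℕ × ℕ, if p.1 ≠ p.2 then s p.1 * s p.2 else 0) := by
    have : Measurable fun s : ℕ → ℝ => ∑' p : ℕ × ℕ, if p.1 ≠ p.2 then s p.1 * s p.2 else 0 := by
      refine Measurable.tsum fun p => ?_
      split_ifs <;> fun_prop
    fun_prop
  refine Measure.ext_of_lintegral _ fun F hF => ?_
  have hFm : Measurable fun x : Fin (k + 1) → ℝ => F fun j => x j.castSucc :=
    hF.comp (by fun_prop)
  -- The density is moved onto the first `k + 1` picks of `PD*` as `nextPickBias`; the last pick is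
  -- then integrated out with the first `k` held fixed.
  rw [alphaGammaDislocation, lintegral_pickMeasure_withDensity
    (hσ.ae_pdStar_properMassSeq hα0 hα1 _) hφ hbm (fun s hs i => ?_) hF,
    hσ.pickMeasure_pdStar hα0 hα1 hθ hk, hσ.pickMeasure_pdStar hα0 hα1 hθ (by omega : 1 ≤ k + 1),
    lintegral_withDensity_eq_lintegral_mul _ (hgm _) (g := fun x => F (fun j => x j.castSucc) *
      ENNReal.ofReal (nextPickBias α γ (fun j => x j.castSucc) (x (Fin.last k)))) (hFm.mul hbm),
    lintegral_withDensity_eq_lintegral_mul _ hfm hF,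
    lintegral_withDensity_eq_lintegral_mul _ (hgm _) (hfm.mul hF),
    lintegral_fin_snoc (G := (fun x => ENNReal.ofReal (gemStarDensity α (-α - γ) (k + 1) x)) *
      fun x => F (fun j => x j.castSucc) *
        ENNReal.ofReal (nextPickBias α γ (fun j => x j.castSucc) (x (Fin.last k))))
      ((hgm _).mul (hFm.mul hbm))]
  · refine lintegral_congr fun x => ?_
    simp only [Pi.mul_apply, Fin.snoc_castSucc, Fin.snoc_last]
    have hm : Measurable fun y : ℝ => ENNReal.ofReal (nextPickBias α γ x y) *
        ENNReal.ofReal (gemStarDensity α (-α - γ) (k + 1) (Fin.snoc x y)) := by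
      have h1 : Measurable fun y : ℝ => (Fin.snoc x y : Fin (k + 1) → ℝ) := by
        refine measurable_pi_lambda _ fun j => ?_
        induction j using Fin.lastCases with
        | last => simpa using measurable_id'
        | cast j => simp
      refine Measurable.mul ?_ ((hgm _).comp h1)
      unfold nextPickBias; fun_prop
    rw [← mul_assoc, ← lintegral_nextPickBias_mul_gemStarDensity hα0 hα1 hγ0 hγα hk,
      ← lintegral_mul_const _ hm]
    refine lintegral_congr fun y => ?_
    ring
  · simp only [Fin.snoc_castSucc, Fin.snoc_last]
    exact tsum_nextPickBias hα1 hγ0 hs i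

end IsStableSubordinator

theorem proposition4 {Ω : Type*} [MeasurableSpace Ω] (P : Measure Ω) [IsProbabilityMeasure P]
    (α γ : ℝ) (hα0 : 0 < α) (hα1 : α < 1) (hγ0 : 0 ≤ γ) (hγα : γ < α)
    (σ : ℝ≥0 → Ω → ℝ) (hσ : IsStableSubordinator P σ α) :
    (∃! νsb : Measure (ℕ → unitInterval), IsSizeBiased (alphaGammaDislocation P σ α γ) νsb) ∧
    (∃! gem : Measure (ℕ → unitInterval), IsSizeBiased (PDStar P σ (-α - γ)) gem) ∧
    ∀ νsb gem : Measure (ℕ → unitInterval),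
      IsSizeBiased (alphaGammaDislocation P σ α γ) νsb →
      IsSizeBiased (PDStar P σ (-α - γ)) gem →
      ∀ k : ℕ, 1 ≤ k →
        firstMarginals k νsb = (firstMarginals k gem).withDensity
            (fun x => ENNReal.ofReal (alphaGammaFactor α γ k x)) ∧
        firstMarginals k gem = (volume : Measure (Fin k → ℝ)).withDensity
            (fun x => ENNReal.ofReal (gemStarDensity α (-α - γ) k x)) := by
  have hθ : -(2 * α) < -α - γ := by linarith
  -- A real-valued density against a `σ`-finite measure gives a `σ`-finite law of the first pick,
  -- even when its mass is infinite.
  have hsf : SigmaFinite (pickMeasure (PDStar P σ (-α - γ)) 1) := by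
    rw [hσ.pickMeasure_pdStar hα0 hα1 hθ le_rfl]
    exact SigmaFinite.withDensity_ofReal _
  have hsf' : SigmaFinite (pickMeasure (alphaGammaDislocation P σ α γ) 1) := by
    rw [hσ.pickMeasure_alphaGammaDislocation hα0 hα1 hγ0 hγα le_rfl]
    exact SigmaFinite.withDensity_ofReal _
  obtain ⟨μ, hμ, hμm⟩ := exists_isSizeBiased (hσ.ae_pdStar_properMassSeq hα0 hα1 (-α - γ))
  obtain ⟨μ', hμ', hμm'⟩ := exists_isSizeBiased
    (hσ.ae_alphaGammaDislocation_properMassSeq hα0 hα1 (γ := γ))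
  refine ⟨⟨μ', hμ', fun m hm => hm.unique hμ'⟩, ⟨μ, hμ, fun m hm => hm.unique hμ⟩,
    fun νsb gem hν hg k hk => ?_⟩
  rw [hν.unique hμ', hg.unique hμ, hμm k hk, hμm' k hk]
  exact ⟨hσ.pickMeasure_alphaGammaDislocation hα0 hα1 hγ0 hγα hk,
    hσ.pickMeasure_pdStar hα0 hα1 hθ hk⟩
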